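/- A \emph{$G$-variety} is a pair $(X,G)$ consisting of a complex quasi-projective variety $X$ (not necessarily irreducible) and a finite group $G$ acting on $X$ by regular maps. Let $K_0^{\rm fGr}({\rm Var}_{\mathbb C})$ be the Grothendieck ring of complex quasi-projective varieties with actions of finite groups: the abelian group generated by the classes $[(X,G)]$ of all $G$-varieties (for all finite groups $G$) modulo the relations 1) $[(X,G)]=[(X',G')]$ if there are an isomorphism $\psi:X\to X'$ of varieties and a group isomorphism $\varphi:G\to G'$ with $\psi(gx)=\varphi(g)\psi(x)$; 2) $[(X,G)]=[(Y,G)]+[(X\setminus Y,G)]$ for a Zariski closed $G$-invariant $Y\subset X$; 3) $[({\rm Ind}_G^H X,H)]=[(X,G)]$ if $G$ is a subgroup of a finite group $H$, where ${\rm Ind}_G^H X$ is the quotient of $H\times X$ by the right action $(h,x)*g=(hg,g^{-1}x)$ of $G$, with $H$ acting by left multiplication; the multiplication is $[(X_1,G_1)]\cdot[(X_2,G_2)]=[(X_1\times X_2,G_1\times G_2)]$, and the unit is the class of a point with the action of the trivial group. For a group $G$ and $g\in G$ let $C_G(g)$ be the centralizer of $g$, and for $r\ge 1$ let $C_G(g)\langle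 a_{r,g}\rangle$ be the group generated by $C_G(g)$ and an additional element $a_{r,g}$ which commutes with all elements of $C_G(g)$ and satisfies $a_{r,g}^r=g$, that is, the quotient of $C_G(g)\times\langle a\rangle$, with $\langle a\rangle$ infinite cyclic, by the subgroup generated by $(g,a^{-r})$. For a $G$-variety $X$, the group $C_G(g)$ acts on the fixed point set $X^{\langle g\rangle}$, and so does $C_G(g)\langle a_{r,g}\rangle$, with $a_{r,g}$ acting trivially. Let $G_n=G^n\rtimes S_n$ be the wreath product, acting on $X^n$ ($G^n$ componentwise, $S_n$ by permuting the factors). \textbf{Theorem.} (a) There is a unique ring homomorphism $\alpha:K_0^{\rm fGr}({\rm Var}_{\mathbb C})\to K_0^{\rm fGr}({\rm Var}_{\mathbb C})$ with $$\alpha([(X,G)])=\sum_{[g]\in{\rm Conj}\,G}[(X^{\langle g\rangle},C_G(g))]$$ for all $G$-varieties $(X,G)$ (the inertia homomorphism). (b) For each $r\ge1$ there is a unique homomorphism of abelian groups $\alpha_r:K_0^{\rm fGr}({\rm Var}_{\mathbb C})\to K_0^{\rm fGr}({\rm Var}_{\mathbb C})$ with $$\alpha_r([(X,G)])=\sum_{[g]\in{\rm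 Conj}\,G}[(X^{\langle g\rangle},C_G(g)\langle a_{r,g}\rangle)]$$ for all $(X,G)$. (c) There is a unique map $a\mapsto\zeta_a(t)$ from $K_0^{\rm fGr}({\rm Var}_{\mathbb C})$ to the ring of formal power series $K_0^{\rm fGr}({\rm Var}_{\mathbb C})[[t]]$ with $\zeta_0(t)=1$ and $\zeta_{a+b}(t)=\zeta_a(t)\zeta_b(t)$ whose value at each class $[(X,G)]$ is the Kapranov zeta function $$\zeta_{(X,G)}(t)=1+\sum_{n=1}^{\infty}[(X^n,G_n)]\,t^n.$$ (d) For every $G$-variety $(X,G)$, where $\alpha$ is applied to a power series coefficientwise, $$\alpha\left(\zeta_{(X,G)}(t)\right)=\prod_{r=1}^{\infty}\zeta_{\alpha_r([(X,G)])}(t^r),$$ the infinite product being convergent coefficientwise (that is, for each $n$ the coefficient of $t^n$ in the finite partial products stabilizes). -/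

import Mathlib

open scoped LinearAlgebra.Projectivization Topology

noncomputable section

namespace FGr

/-! ### Projective space over `ℂ` with its Zariski topology -/

/-- The complex projective space whose homogeneous coordinates are indexed by `I`. -/
abbrev ProjSpace (I : Type) : Type := ℙ ℂ (I → ℂ)

/-- The vector obtained by evaluating a family of polynomials at a vector. -/
def evalVec {I J : Type} (P : J → MvPolynomial I ℂ) (v : I → ℂ) : J → ℂ :=
  fun j => MvPolynomial.eval v (P j)

/-- The Zariski topology: its open sets are the unions of finite intersections of the sets
`{F ≠ 0}`, for homogeneous polynomials `F`. -/
instance zariskiTopology (I : Type) : TopologicalSpace (ProjSpace I) :=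
  TopologicalSpace.generateFrom
    {U | ∃ (d : ℕ) (F : MvPolynomial I ℂ), F.IsHomogeneous d ∧
      U = {p : ProjSpace I | MvPolynomial.eval p.rep F ≠ 0}}

/-! ### Quasi-projective varieties and regular maps -/

/-- A complex quasi-projective variety (not necessarily irreducible): a set identified with a
locally closed subset, in the Zariski topology, of a finite-dimensional complex projective
space. -/
structure Variety : Type 1 where
  /-- the set of (complex) points -/
  carrier : Type
  /-- the index set of the homogeneous coordinates of the ambient projective space -/
  coord : Type
  finite_coord : Finite coord
  /-- the embedding into projective space -/
  emb : carrier → ProjSpace coord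
  emb_injective : Function.Injective emb
  isLocallyClosed_range : IsLocallyClosed (Set.range emb)

instance : CoeSort Variety Type := ⟨Variety.carrier⟩

/-- The Zariski topology of a quasi-projective variety. -/
instance Variety.topology (X : Variety) : TopologicalSpace X.carrier :=
  TopologicalSpace.induced X.emb inferInstance

/-- A map `f` between sets `T`, `T'` which are mapped to projective spaces by `e` and `e'` is
regular if around each point it is given, in homogeneous coordinates, by homogeneous polynomials
of one and the same degree. (The neighbourhood of `x` is the open set on which the polynomials
`P j` do not all vanish; each smaller neighbourhood contains one of this form, after
multiplication of all `P j` by one homogeneous polynomial.) -/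
def RegularFor {T T' I J : Type} (e : T → ProjSpace I) (e' : T' → ProjSpace J) (f : T → T') :
    Prop :=
  ∀ x : T, ∃ (d : ℕ) (P : J → MvPolynomial I ℂ),
    (∀ j, (P j).IsHomogeneous d) ∧ evalVec P (e x).rep ≠ 0 ∧
    ∀ (y : T) (h : evalVec P (e y).rep ≠ 0),
      e' (f y) = Projectivization.mk ℂ (evalVec P (e y).rep) h

/-- Regular maps (morphisms) of quasi-projective varieties. -/
def IsRegular {X Y : Variety} (f : X → Y) : Prop :=
  RegularFor X.emb Y.emb f

/-! Auxiliary facts: regular maps may be tested on any choice of homogeneous coordinates. -/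

lemma eval_smul {I : Type} {F : MvPolynomial I ℂ} {d : ℕ} (hF : F.IsHomogeneous d)
    (c : ℂ) (v : I → ℂ) :
    MvPolynomial.eval (c • v) F = c ^ d * MvPolynomial.eval v F := by
  rw [MvPolynomial.eval_eq, MvPolynomial.eval_eq, Finset.mul_sum]
  refine Finset.sum_congr rfl fun m hm => ?_
  have h : ∑ i ∈ m.support, m i = d := by
    have := hF (MvPolynomial.mem_support_iff.mp hm)
    simpa [Finsupp.weight_apply, Finsupp.sum] using this
  simp only [Pi.smul_apply, smul_eq_mul, mul_pow, Finset.prod_mul_distrib]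
  rw [Finset.prod_pow_eq_pow_sum, h]
  ring

lemma evalVec_smul {I J : Type} {P : J → MvPolynomial I ℂ} {d : ℕ}
    (hP : ∀ j, (P j).IsHomogeneous d) (c : ℂ) (v : I → ℂ) :
    evalVec P (c • v) = c ^ d • evalVec P v := by
  funext j
  simp [evalVec, eval_smul (hP j)]

lemma eval_bind {I J : Type} (P : J → MvPolynomial I ℂ) (F : MvPolynomial J ℂ) (v : I → ℂ) :
    MvPolynomial.eval v (MvPolynomial.bind₁ P F) = MvPolynomial.eval (evalVec P v) F := by
  induction F using MvPolynomial.induction_on with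
  | C a => simp
  | add p q hp hq => simp [hp, hq]
  | mul_X p j hp => simp [hp, evalVec]

lemma bind_homogeneous {I J : Type} {P : J → MvPolynomial I ℂ} {d e : ℕ}
    (hP : ∀ j, (P j).IsHomogeneous d) {F : MvPolynomial J ℂ} (hF : F.IsHomogeneous e) :
    (MvPolynomial.bind₁ P F).IsHomogeneous (d * e) :=
  hF.aeval P hP

/-- `l` chooses homogeneous coordinates for the points of projective space parametrized by `e`. -/
def IsLift {T I : Type} (e : T → ProjSpace I) (l : T → I → ℂ) : Prop :=
  ∀ x, ∃ h : l x ≠ 0, e x = Projectivization.mk ℂ (l x) h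

lemma isLift_rep {T I : Type} (e : T → ProjSpace I) : IsLift e (fun x => (e x).rep) := fun _ =>
  ⟨Projectivization.rep_nonzero _, (Projectivization.mk_rep _).symm⟩

lemma IsLift.eq_iff {T T' I : Type} {e : T → ProjSpace I} {l : T → I → ℂ} (h : IsLift e l)
    {e' : T' → ProjSpace I} {l' : T' → I → ℂ} (h' : IsLift e' l') (x : T) (y : T') :
    e x = e' y ↔ ∃ c : ℂ, c ≠ 0 ∧ l x = c • l' y := by
  obtain ⟨h1, h2⟩ := h x
  obtain ⟨h3, h4⟩ := h' y
  rw [h2, h4]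
  refine (Projectivization.mk_eq_mk_iff ℂ _ _ h1 h3).trans ⟨?_, ?_⟩
  · rintro ⟨a, ha⟩
    exact ⟨a, a.ne_zero, ha.symm⟩
  · rintro ⟨c, hc, hcc⟩
    exact ⟨Units.mk0 c hc, hcc.symm⟩

lemma IsLift.rep_eq {T I : Type} {e : T → ProjSpace I} {l : T → I → ℂ} (h : IsLift e l) (x : T) :
    ∃ c : ℂ, c ≠ 0 ∧ (e x).rep = c • l x :=
  ((isLift_rep e).eq_iff h x x).1 rfl

lemma mk_rep_eq {I : Type} (v : I → ℂ) (hv : v ≠ 0) :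
    ∃ c : ℂ, c ≠ 0 ∧ (Projectivization.mk ℂ v hv).rep = c • v := by
  obtain ⟨a, ha⟩ := Projectivization.exists_smul_eq_mk_rep ℂ v hv
  exact ⟨a, a.ne_zero, ha.symm⟩

lemma proj_ext {I : Type} {p q : ProjSpace I} {a b : ℂ} (ha : a ≠ 0)
    (h : a • p.rep = b • q.rep) : p = q := by
  have hb : b ≠ 0 := by
    rintro rfl
    rw [zero_smul, smul_eq_zero] at h
    exact h.elim ha (Projectivization.rep_nonzero _)
  refine ((isLift_rep id).eq_iff (isLift_rep id) p q).2
    ⟨a⁻¹ * b, mul_ne_zero (inv_ne_zero ha) hb, ?_⟩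
  rw [id, id, mul_smul, ← h, smul_smul, inv_mul_cancel₀ ha, one_smul]

lemma regularFor_iff {T T' I J : Type} {e : T → ProjSpace I} {e' : T' → ProjSpace J}
    {l : T → I → ℂ} {m : T' → J → ℂ} (hl : IsLift e l) (hm : IsLift e' m) (f : T → T') :
    RegularFor e e' f ↔ ∀ x : T, ∃ (d : ℕ) (P : J → MvPolynomial I ℂ),
      (∀ j, (P j).IsHomogeneous d) ∧ evalVec P (l x) ≠ 0 ∧
      ∀ y : T, evalVec P (l y) ≠ 0 → ∃ c : ℂ, c ≠ 0 ∧ m (f y) = c • evalVec P (l y) := by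
  refine forall_congr' fun x => exists_congr fun d => exists_congr fun P =>
    and_congr_right fun hP => ?_
  have key : ∀ y, ∃ c : ℂ, c ≠ 0 ∧ evalVec P (e y).rep = c • evalVec P (l y) := fun y => by
    obtain ⟨c, hc, h⟩ := hl.rep_eq y
    exact ⟨c ^ d, pow_ne_zero _ hc, by rw [h, evalVec_smul hP]⟩
  have key' : ∀ y, evalVec P (e y).rep ≠ 0 ↔ evalVec P (l y) ≠ 0 := fun y => by
    obtain ⟨c, hc, h⟩ := key y
    rw [h, Ne, Ne, smul_eq_zero]
    simp [hc]
  refine and_congr (key' x) (forall_congr' fun y => ?_)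
  constructor
  · intro h hy
    have h1 := h ((key' y).2 hy)
    obtain ⟨c, hc, h2⟩ := key y
    have h3 : IsLift (fun _ : Unit => e' (f y)) (fun _ => evalVec P (e y).rep) :=
      fun _ => ⟨(key' y).2 hy, h1⟩
    obtain ⟨a, ha, h4⟩ := (hm.eq_iff h3 (f y) ()).1 rfl
    exact ⟨a * c, mul_ne_zero ha hc, by rw [h4, h2, smul_smul]⟩
  · intro h hy
    obtain ⟨a, ha, h1⟩ := h ((key' y).1 hy)
    obtain ⟨c, hc, h2⟩ := key y
    have h3 : IsLift (fun _ : Unit => Projectivization.mk ℂ _ hy)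
      (fun _ => evalVec P (e y).rep) := fun _ => ⟨hy, rfl⟩
    refine (hm.eq_iff h3 (f y) ()).2 ⟨a * c⁻¹, mul_ne_zero ha (inv_ne_zero hc), ?_⟩
    rw [h1, h2, smul_smul, mul_assoc, inv_mul_cancel₀ hc, mul_one]

lemma RegularFor.refl {T I : Type} (e : T → ProjSpace I) : RegularFor e e (fun x => x) := by
  rw [regularFor_iff (isLift_rep e) (isLift_rep e)]
  intro x
  have h : ∀ v : I → ℂ, evalVec MvPolynomial.X v = v := fun v => by
    funext j; simp [evalVec]
  refine ⟨1, MvPolynomial.X, fun j => MvPolynomial.isHomogeneous_X _ _, ?_, fun y _ => ⟨1, ?_⟩⟩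
  · rw [h]; exact Projectivization.rep_nonzero _
  · simp [h]

lemma RegularFor.comp {T₁ T₂ T₃ I J K : Type} {e₁ : T₁ → ProjSpace I} {e₂ : T₂ → ProjSpace J}
    {e₃ : T₃ → ProjSpace K} {g : T₂ → T₃} {f : T₁ → T₂} (hg : RegularFor e₂ e₃ g)
    (hf : RegularFor e₁ e₂ f) : RegularFor e₁ e₃ (fun x => g (f x)) := by
  rw [regularFor_iff (isLift_rep _) (isLift_rep _)] at hf hg ⊢
  intro x
  obtain ⟨d, P, hP, hx, hf⟩ := hf x
  obtain ⟨e, Q, hQ, hfx, hg⟩ := hg (f x)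
  obtain ⟨j, hj⟩ : ∃ j, evalVec P (e₁ x).rep j ≠ 0 := Function.ne_iff.1 hx
  have ev : ∀ v : I → ℂ, evalVec (fun k => MvPolynomial.bind₁ P (Q k) * P j) v =
      (evalVec P v j) • evalVec Q (evalVec P v) := fun v => by
    funext k
    simp only [evalVec, map_mul, Pi.smul_apply, smul_eq_mul]
    rw [mul_comm, eval_bind]
  have ne : ∀ y, evalVec P (e₁ y).rep ≠ 0 →
      (evalVec Q (e₂ (f y)).rep ≠ 0 ↔ evalVec Q (evalVec P (e₁ y).rep) ≠ 0) ∧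
      ∃ c : ℂ, c ≠ 0 ∧ evalVec Q (e₂ (f y)).rep = c • evalVec Q (evalVec P (e₁ y).rep) :=
    fun y hy => by
      obtain ⟨c, hc, h⟩ := hf y hy
      have h2 : evalVec Q (e₂ (f y)).rep = c ^ e • evalVec Q (evalVec P (e₁ y).rep) := by
        rw [h, evalVec_smul hQ]
      refine ⟨?_, c ^ e, pow_ne_zero _ hc, h2⟩
      rw [h2, Ne, smul_eq_zero]
      simp [hc]
  refine ⟨d * e + d, fun k => MvPolynomial.bind₁ P (Q k) * P j,
    fun k => (bind_homogeneous hP (hQ k)).mul (hP j), ?_, fun y hy => ?_⟩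
  · rw [ev]
    exact smul_ne_zero hj (((ne x hx).1).1 hfx)
  · rw [ev] at hy ⊢
    have h1 : evalVec P (e₁ y).rep j ≠ 0 := fun h => hy (by rw [h, zero_smul])
    have h2 : evalVec Q (evalVec P (e₁ y).rep) ≠ 0 := fun h => hy (by rw [h, smul_zero])
    have h3 : evalVec P (e₁ y).rep ≠ 0 := fun h => h1 (by rw [h]; rfl)
    obtain ⟨c, hc, h4⟩ := hg (f y) (((ne y h3).1).2 h2)
    obtain ⟨a, ha, h5⟩ := (ne y h3).2
    refine ⟨c * a * (evalVec P (e₁ y).rep j)⁻¹,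
      mul_ne_zero (mul_ne_zero hc ha) (inv_ne_zero h1), ?_⟩
    rw [h4, h5, smul_smul, smul_smul, inv_mul_cancel_right₀ h1]

/-- Nonvanishing of a homogeneous polynomial in homogeneous coordinates is an open condition. -/
lemma isOpen_ne_zero {T I : Type} (e : T → ProjSpace I) {d : ℕ}
    {F : MvPolynomial I ℂ} (hF : F.IsHomogeneous d) :
    IsOpen[TopologicalSpace.induced e (zariskiTopology I)]
      {x : T | MvPolynomial.eval (e x).rep F ≠ 0} :=
  isOpen_induced_iff.2
    ⟨_, TopologicalSpace.isOpen_generateFrom_of_mem ⟨d, F, hF, rfl⟩, rfl⟩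

lemma RegularFor.continuous {T T' I J : Type} {e : T → ProjSpace I} {e' : T' → ProjSpace J}
    {f : T → T'} (hf : RegularFor e e' f) :
    @Continuous T T' (TopologicalSpace.induced e (zariskiTopology I))
      (TopologicalSpace.induced e' (zariskiTopology J)) f := by
  let _ := TopologicalSpace.induced e (zariskiTopology I)
  rw [continuous_induced_rng, continuous_generateFrom_iff]
  rintro _ ⟨d, F, hF, rfl⟩
  rw [isOpen_iff_mem_nhds]
  intro x hx
  rw [regularFor_iff (isLift_rep _) (isLift_rep _)] at hf
  obtain ⟨k, P, hP, hPx, h⟩ := hf x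
  obtain ⟨j, hj⟩ : ∃ j, evalVec P (e x).rep j ≠ 0 := Function.ne_iff.1 hPx
  have ev : ∀ v, MvPolynomial.eval v (MvPolynomial.bind₁ P F * P j) =
      MvPolynomial.eval (evalVec P v) F * evalVec P v j := fun v => by
    rw [map_mul, eval_bind]
    rfl
  have key : ∀ y, evalVec P (e y).rep ≠ 0 → (MvPolynomial.eval (e' (f y)).rep F ≠ 0 ↔
      MvPolynomial.eval (evalVec P (e y).rep) F ≠ 0) := fun y hy => by
    obtain ⟨c, hc, h2⟩ := h y hy
    rw [h2, eval_smul hF]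
    simp [hc]
  refine Filter.mem_of_superset ((isOpen_ne_zero e
    ((bind_homogeneous hP hF).mul (hP j))).mem_nhds ?_) ?_
  · simp only [Set.mem_ofPred_eq, ev]
    exact mul_ne_zero ((key x hPx).1 hx) hj
  · intro y hy
    simp only [Set.mem_ofPred_eq, ev] at hy
    have h3 : evalVec P (e y).rep ≠ 0 := fun h => right_ne_zero_of_mul hy (by rw [h]; rfl)
    exact (key y h3).2 (left_ne_zero_of_mul hy)

/-- The locus where two regular maps agree is closed. -/
lemma RegularFor.isClosed_eq {T T' I J : Type} {e : T → ProjSpace I} {e' : T' → ProjSpace J}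
    (he' : Function.Injective e') {f g : T → T'} (hf : RegularFor e e' f)
    (hg : RegularFor e e' g) :
    IsClosed[TopologicalSpace.induced e (zariskiTopology I)] {x | f x = g x} := by
  let _ := TopologicalSpace.induced e (zariskiTopology I)
  rw [← isOpen_compl_iff, isOpen_iff_mem_nhds]
  intro x hx
  rw [regularFor_iff (isLift_rep _) (isLift_rep _)] at hf hg
  obtain ⟨d, P, hP, hPx, hf⟩ := hf x
  obtain ⟨k, Q, hQ, hQx, hg⟩ := hg x
  have : ∃ i j, evalVec P (e x).rep i * evalVec Q (e x).rep j -
      evalVec P (e x).rep j * evalVec Q (e x).rep i ≠ 0 := by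
    by_contra! hc
    obtain ⟨j, hj⟩ : ∃ j, evalVec Q (e x).rep j ≠ 0 := Function.ne_iff.1 hQx
    obtain ⟨a, ha, h1⟩ := hf x hPx
    obtain ⟨b, hb, h2⟩ := hg x hQx
    have h3 : evalVec P (e x).rep =
        (evalVec P (e x).rep j / evalVec Q (e x).rep j) • evalVec Q (e x).rep := by
      funext i
      have := hc i j
      simp only [Pi.smul_apply, smul_eq_mul]
      field_simp
      linear_combination this
    rw [h3, smul_smul] at h1
    refine hx (he' (proj_ext (a := b) (b := a * (evalVec P (e x).rep j / evalVec Q (e x).rep j))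
      hb ?_))
    rw [h1, h2, smul_smul, smul_smul, mul_comm]
  obtain ⟨i, j, hij⟩ := this
  have hF : (P i * Q j - P j * Q i).IsHomogeneous (d + k) :=
    ((hP i).mul (hQ j)).sub ((hP j).mul (hQ i))
  refine Filter.mem_of_superset ((isOpen_ne_zero e hF).mem_nhds ?_) ?_
  · simpa [evalVec] using hij
  · intro y hy hfg
    simp only [Set.mem_ofPred_eq, map_sub, map_mul] at hy hfg
    change evalVec P (e y).rep i * evalVec Q (e y).rep j -
      evalVec P (e y).rep j * evalVec Q (e y).rep i ≠ 0 at hy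
    have hP0 : evalVec P (e y).rep ≠ 0 := fun h => hy (by simp [h])
    have hQ0 : evalVec Q (e y).rep ≠ 0 := fun h => hy (by simp [h])
    obtain ⟨a, ha, h1⟩ := hf y hP0
    obtain ⟨b, hb, h2⟩ := hg y hQ0
    rw [hfg, h2] at h1
    have e1 := congrFun h1 i
    have e2 := congrFun h1 j
    simp only [Pi.smul_apply, smul_eq_mul] at e1 e2
    apply hy
    have : a * b * (evalVec P (e y).rep i * evalVec Q (e y).rep j -
      evalVec P (e y).rep j * evalVec Q (e y).rep i) = 0 := by
      linear_combination (-(b * evalVec Q (e y).rep j)) * e1 + (b * evalVec Q (e y).rep i) * e2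
    simpa [ha, hb] using this

lemma isRegular_id (X : Variety) : IsRegular (fun x : X => x) := RegularFor.refl X.emb

lemma IsRegular.comp {X Y Z : Variety} {g : Y → Z} {f : X → Y} (hg : IsRegular g)
    (hf : IsRegular f) : IsRegular (fun x => g (f x)) :=
  RegularFor.comp hg hf

lemma IsRegular.continuous {X Y : Variety} {f : X → Y} (hf : IsRegular f) : Continuous f :=
  RegularFor.continuous hf

lemma IsRegular.isClosed_eq {X Y : Variety} {f g : X → Y} (hf : IsRegular f)
    (hg : IsRegular g) : IsClosed {x | f x = g x} :=
  RegularFor.isClosed_eq Y.emb_injective hf hg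

/-! ### Locally closed subvarieties -/

lemma isInducing_emb (X : Variety) : Topology.IsInducing X.emb := ⟨rfl⟩

/-- A locally closed subset of a quasi-projective variety, as a variety. -/
def Variety.sub (X : Variety) (S : Set X) (hS : IsLocallyClosed S) : Variety where
  carrier := S
  coord := X.coord
  finite_coord := X.finite_coord
  emb := fun x => X.emb x.1
  emb_injective := X.emb_injective.comp Subtype.val_injective
  isLocallyClosed_range := by
    have h := hS.image (isInducing_emb X) X.isLocallyClosed_range
    rwa [Set.image_eq_range] at h

lemma isRegular_val (X : Variety) (S : Set X) (hS : IsLocallyClosed S) :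
    IsRegular (X := X.sub S hS) (Y := X) Subtype.val := fun x => by
  obtain ⟨d, P, hP, hx, h⟩ := isRegular_id X x.1
  exact ⟨d, P, hP, hx, fun y hy => h y.1 hy⟩

lemma isRegular_sub_iff {X Y : Variety} {S : Set Y} {hS : IsLocallyClosed S}
    {f : X → Y.sub S hS} : IsRegular f ↔ IsRegular (X := X) (Y := Y) (fun x => (f x).1) :=
  Iff.rfl

lemma IsRegular.restrict {X Y : Variety} {f : X → Y} (hf : IsRegular f) {S : Set X} {T : Set Y}
    (hS : IsLocallyClosed S) (hT : IsLocallyClosed T) (h : ∀ x ∈ S, f x ∈ T) :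
    IsRegular (X := X.sub S hS) (Y := Y.sub T hT) (fun x => ⟨f x.1, h x.1 x.2⟩) :=
  isRegular_sub_iff.2 (hf.comp (isRegular_val X S hS))

/-! ### Cartesian products, by the Segre embedding -/

lemma isClosed_eq_zero {I : Type} {d : ℕ} {F : MvPolynomial I ℂ} (hF : F.IsHomogeneous d) :
    IsClosed {p : ProjSpace I | MvPolynomial.eval p.rep F = 0} := by
  rw [← isOpen_compl_iff]
  exact TopologicalSpace.isOpen_generateFrom_of_mem ⟨d, F, hF, rfl⟩

/-- Homogeneous coordinates of a point in the image of the Segre embedding. -/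
def segreVec {I J : Type} (v : I → ℂ) (w : J → ℂ) : I × J → ℂ := fun k => v k.1 * w k.2

lemma segreVec_ne_zero {I J : Type} {v : I → ℂ} {w : J → ℂ} (hv : v ≠ 0) (hw : w ≠ 0) :
    segreVec v w ≠ 0 := by
  obtain ⟨i, hi⟩ := Function.ne_iff.1 hv
  obtain ⟨j, hj⟩ := Function.ne_iff.1 hw
  exact Function.ne_iff.2 ⟨(i, j), mul_ne_zero hi hj⟩

/-- The Segre embedding `ℙ(ℂ^I) × ℙ(ℂ^J) → ℙ(ℂ^(I × J))`. -/
def segre {I J : Type} (p : ProjSpace I × ProjSpace J) : ProjSpace (I × J) :=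
  Projectivization.mk ℂ (segreVec p.1.rep p.2.rep)
    (segreVec_ne_zero (Projectivization.rep_nonzero _) (Projectivization.rep_nonzero _))

lemma isLift_segre {T I J : Type} (u : T → ProjSpace I × ProjSpace J) :
    IsLift (fun x => segre (u x)) (fun x => segreVec (u x).1.rep (u x).2.rep) :=
  fun _ => ⟨_, rfl⟩

lemma segre_injective {I J : Type} : Function.Injective (segre (I := I) (J := J)) := by
  rintro ⟨p, q⟩ ⟨p', q'⟩ h
  obtain ⟨c, hc, h⟩ := ((isLift_segre id).eq_iff (isLift_segre id) _ _).1 h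
  have h' : ∀ i j, p.rep i * q.rep j = c * (p'.rep i * q'.rep j) := fun i j =>
    congrFun h (i, j)
  obtain ⟨i, hi⟩ := Function.ne_iff.1 p.rep_nonzero
  obtain ⟨j, hj⟩ := Function.ne_iff.1 q.rep_nonzero
  refine Prod.ext (proj_ext hj (b := c * q'.rep j) ?_) (proj_ext hi (b := c * p'.rep i) ?_)
  · funext k
    simp only [Pi.smul_apply, smul_eq_mul]
    linear_combination h' k j
  · funext k
    simp only [Pi.smul_apply, smul_eq_mul]
    linear_combination h' i k

lemma isClosed_range_segre {I J : Type} : IsClosed (Set.range (segre (I := I) (J := J))) := by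
  have key : Set.range (segre (I := I) (J := J)) =
      ⋂ (k : I × J), ⋂ (l : I × J), {z : ProjSpace (I × J) | MvPolynomial.eval z.rep
        (MvPolynomial.X k * MvPolynomial.X l -
          MvPolynomial.X (k.1, l.2) * MvPolynomial.X (l.1, k.2)) = 0} := by
    ext z
    simp only [Set.mem_range, Set.mem_iInter, Set.mem_ofPred_eq, map_sub, map_mul,
      MvPolynomial.eval_X]
    constructor
    · rintro ⟨p, rfl⟩ k l
      obtain ⟨c, hc, h⟩ := (isLift_segre id).rep_eq p
      simp only [id] at h
      rw [h]
      simp only [Pi.smul_apply, smul_eq_mul, segreVec]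
      ring
    · intro h
      obtain ⟨k, hk⟩ := Function.ne_iff.1 z.rep_nonzero
      set v : I → ℂ := fun i => z.rep (i, k.2) with hv
      set w : J → ℂ := fun j => z.rep (k.1, j) with hw
      have hv0 : v ≠ 0 := Function.ne_iff.2 ⟨k.1, hk⟩
      have hw0 : w ≠ 0 := Function.ne_iff.2 ⟨k.2, hk⟩
      refine ⟨(Projectivization.mk ℂ v hv0, Projectivization.mk ℂ w hw0), ?_⟩
      obtain ⟨a, ha, h1⟩ := mk_rep_eq v hv0
      obtain ⟨b, hb, h2⟩ := mk_rep_eq w hw0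
      refine ((isLift_segre id).eq_iff (isLift_rep id) _ z).2
        ⟨a * b * z.rep k, mul_ne_zero (mul_ne_zero ha hb) hk, ?_⟩
      simp only [id, h1, h2]
      funext l
      simp only [segreVec, Pi.smul_apply, smul_eq_mul, hv, hw]
      linear_combination (-a * b) * h k l
  rw [key]
  exact isClosed_iInter fun k => isClosed_iInter fun l => isClosed_eq_zero
    (((MvPolynomial.isHomogeneous_X _ _).mul (MvPolynomial.isHomogeneous_X _ _)).sub
      ((MvPolynomial.isHomogeneous_X _ _).mul (MvPolynomial.isHomogeneous_X _ _)))

lemma regularFor_segre_fst {T I J : Type} (u : T → ProjSpace I × ProjSpace J) :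
    RegularFor (fun x => segre (u x)) id (fun x => (u x).1) := by
  refine (regularFor_iff (isLift_segre u) (isLift_rep id) _).2 fun x => ?_
  obtain ⟨j, hj⟩ := Function.ne_iff.1 (u x).2.rep_nonzero
  have ev : ∀ y, evalVec (fun i => MvPolynomial.X (i, j))
      (segreVec (u y).1.rep (u y).2.rep) = (u y).2.rep j • (u y).1.rep := fun y => by
    funext i
    simp [evalVec, segreVec, mul_comm]
  refine ⟨1, fun i => MvPolynomial.X (i, j), fun i => MvPolynomial.isHomogeneous_X _ _, ?_,
    fun y hy => ?_⟩
  · rw [ev]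
    exact smul_ne_zero hj (Projectivization.rep_nonzero _)
  · rw [ev] at hy ⊢
    have h : (u y).2.rep j ≠ 0 := fun h => hy (by rw [h, zero_smul])
    exact ⟨_, inv_ne_zero h, by rw [smul_smul, inv_mul_cancel₀ h, one_smul]; rfl⟩

lemma regularFor_segre_snd {T I J : Type} (u : T → ProjSpace I × ProjSpace J) :
    RegularFor (fun x => segre (u x)) id (fun x => (u x).2) := by
  refine (regularFor_iff (isLift_segre u) (isLift_rep id) _).2 fun x => ?_
  obtain ⟨i, hi⟩ := Function.ne_iff.1 (u x).1.rep_nonzero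
  have ev : ∀ y, evalVec (fun j => MvPolynomial.X (i, j))
      (segreVec (u y).1.rep (u y).2.rep) = (u y).1.rep i • (u y).2.rep := fun y => by
    funext j
    simp [evalVec, segreVec]
  refine ⟨1, fun j => MvPolynomial.X (i, j), fun j => MvPolynomial.isHomogeneous_X _ _, ?_,
    fun y hy => ?_⟩
  · rw [ev]
    exact smul_ne_zero hi (Projectivization.rep_nonzero _)
  · rw [ev] at hy ⊢
    have h : (u y).1.rep i ≠ 0 := fun h => hy (by rw [h, zero_smul])
    exact ⟨_, inv_ne_zero h, by rw [smul_smul, inv_mul_cancel₀ h, one_smul]; rfl⟩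

lemma RegularFor.pair {T T₁ T₂ I J K : Type} {e : T → ProjSpace K} {e₁ : T₁ → ProjSpace I}
    {e₂ : T₂ → ProjSpace J} {f : T → T₁} {g : T → T₂} (hf : RegularFor e e₁ f)
    (hg : RegularFor e e₂ g) :
    RegularFor e (fun p : T₁ × T₂ => segre (e₁ p.1, e₂ p.2)) (fun x => (f x, g x)) := by
  rw [regularFor_iff (isLift_rep _) (isLift_rep _)] at hf hg
  refine (regularFor_iff (isLift_rep _)
    (isLift_segre fun p : T₁ × T₂ => (e₁ p.1, e₂ p.2)) _).2 fun x => ?_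
  obtain ⟨d, P, hP, hPx, hf⟩ := hf x
  obtain ⟨k, Q, hQ, hQx, hg⟩ := hg x
  have ev : ∀ v, evalVec (fun k : I × J => P k.1 * Q k.2) v =
      segreVec (evalVec P v) (evalVec Q v) := fun v => by
    funext k
    simp [evalVec, segreVec]
  refine ⟨d + k, fun k => P k.1 * Q k.2, fun k => (hP k.1).mul (hQ k.2), ?_, fun y hy => ?_⟩
  · rw [ev]
    exact segreVec_ne_zero hPx hQx
  · rw [ev] at hy ⊢
    obtain ⟨a, ha, h1⟩ := hf y fun h => hy (by funext k; simp [segreVec, h])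
    obtain ⟨b, hb, h2⟩ := hg y fun h => hy (by funext k; simp [segreVec, h])
    refine ⟨a * b, mul_ne_zero ha hb, ?_⟩
    simp only [h1, h2]
    funext k
    simp only [segreVec, Pi.smul_apply, smul_eq_mul]
    ring

/-- The product of two quasi-projective varieties. -/
def Variety.prod (X Y : Variety) : Variety where
  carrier := X × Y
  coord := X.coord × Y.coord
  finite_coord := by
    have := X.finite_coord
    have := Y.finite_coord
    infer_instance
  emb := fun p => segre (X.emb p.1, Y.emb p.2)
  emb_injective := fun p q h => by
    have h := segre_injective h
    exact Prod.ext (X.emb_injective (congrArg Prod.fst h)) (Y.emb_injective (congrArg Prod.snd h))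
  isLocallyClosed_range := by
    let t := TopologicalSpace.induced (segre (I := X.coord) (J := Y.coord)) (zariskiTopology _)
    have c1 := (regularFor_segre_fst (I := X.coord) (J := Y.coord) id).continuous
    have c2 := (regularFor_segre_snd (I := X.coord) (J := Y.coord) id).continuous
    rw [induced_id] at c1 c2
    have h := @IsLocallyClosed.image _ _ t _ _
      (@IsLocallyClosed.inter _ t _ _
        (@IsLocallyClosed.preimage _ _ t _ _ X.isLocallyClosed_range _ c1)
        (@IsLocallyClosed.preimage _ _ t _ _ Y.isLocallyClosed_range _ c2))
      (segre (I := X.coord) (J := Y.coord))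
      (@Topology.IsInducing.mk _ _ t _ _ rfl) isClosed_range_segre.isLocallyClosed
    convert! h using 1
    ext z
    constructor
    · rintro ⟨p, rfl⟩
      exact ⟨(X.emb p.1, Y.emb p.2), ⟨⟨p.1, rfl⟩, ⟨p.2, rfl⟩⟩, rfl⟩
    · rintro ⟨⟨a, b⟩, ⟨⟨x, hx⟩, ⟨y, hy⟩⟩, rfl⟩
      exact ⟨(x, y), congrArg segre (Prod.ext hx hy)⟩

lemma isRegular_fst (X Y : Variety) : IsRegular (X := X.prod Y) (Y := X) Prod.fst :=
  regularFor_segre_fst (fun p : X × Y => (X.emb p.1, Y.emb p.2))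

lemma isRegular_snd (X Y : Variety) : IsRegular (X := X.prod Y) (Y := Y) Prod.snd :=
  regularFor_segre_snd (fun p : X × Y => (X.emb p.1, Y.emb p.2))

lemma IsRegular.pair {X Y Z : Variety} {f : X → Y} {g : X → Z} (hf : IsRegular f)
    (hg : IsRegular g) : IsRegular (X := X) (Y := Y.prod Z) (fun x => (f x, g x)) :=
  RegularFor.pair hf hg

lemma IsRegular.prodMap {X X' Y Y' : Variety} {f : X → X'} {g : Y → Y'} (hf : IsRegular f)
    (hg : IsRegular g) :
    IsRegular (X := X.prod Y) (Y := X'.prod Y') (fun p => (f p.1, g p.2)) :=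
  (hf.comp (isRegular_fst X Y)).pair (hg.comp (isRegular_snd X Y))

/-! ### Cartesian powers, by the iterated Segre embedding -/

/-- Homogeneous coordinates of a point in the image of the `n`-fold Segre embedding. -/
def powVec {n : ℕ} {I : Type} (v : Fin n → I → ℂ) : (Fin n → I) → ℂ := fun J => ∏ k, v k (J k)

lemma exists_all_ne_zero {n : ℕ} {I : Type} {v : Fin n → I → ℂ} (hv : ∀ k, v k ≠ 0) :
    ∃ J : Fin n → I, ∀ k, v k (J k) ≠ 0 := by
  choose J hJ using fun k => Function.ne_iff.1 (hv k)
  exact ⟨J, hJ⟩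

lemma powVec_ne_zero {n : ℕ} {I : Type} {v : Fin n → I → ℂ} (hv : ∀ k, v k ≠ 0) :
    powVec v ≠ 0 := by
  obtain ⟨J, hJ⟩ := exists_all_ne_zero hv
  exact Function.ne_iff.2 ⟨J, Finset.prod_ne_zero_iff.2 fun k _ => hJ k⟩

lemma powVec_update {n : ℕ} {I : Type} (v : Fin n → I → ℂ) (J : Fin n → I) (k : Fin n) (i : I) :
    powVec v (Function.update J k i) = (∏ m ∈ Finset.univ.erase k, v m (J m)) * v k i := by
  rw [powVec, ← Finset.mul_prod_erase _ _ (Finset.mem_univ k), mul_comm, Function.update_self]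
  congr 1
  refine Finset.prod_congr rfl fun m hm => ?_
  rw [Function.update_of_ne (Finset.ne_of_mem_erase hm)]

lemma powVec_smul {n : ℕ} {I : Type} (c : Fin n → ℂ) (v : Fin n → I → ℂ) :
    powVec (fun k => c k • v k) = (∏ k, c k) • powVec v := by
  funext J
  simp [powVec, Finset.prod_mul_distrib]

/-- The Segre embedding `ℙ(ℂ^I)^n → ℙ(ℂ^(I^n))`. -/
def powSegre {n : ℕ} {I : Type} (p : Fin n → ProjSpace I) : ProjSpace (Fin n → I) :=
  Projectivization.mk ℂ (powVec fun k => (p k).rep)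
    (powVec_ne_zero fun _ => Projectivization.rep_nonzero _)

lemma isLift_powSegre {T I : Type} {n : ℕ} (u : T → Fin n → ProjSpace I) :
    IsLift (fun x => powSegre (u x)) (fun x => powVec fun k => (u x k).rep) :=
  fun _ => ⟨_, rfl⟩

lemma powSegre_injective {n : ℕ} {I : Type} :
    Function.Injective (powSegre (n := n) (I := I)) := by
  intro p q h
  obtain ⟨c, hc, h⟩ := ((isLift_powSegre id).eq_iff (isLift_powSegre id) _ _).1 h
  simp only [id] at h
  obtain ⟨J, hJ⟩ := exists_all_ne_zero fun k => (p k).rep_nonzero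
  funext k
  refine proj_ext (a := ∏ m ∈ Finset.univ.erase k, (p m).rep (J m))
    (b := c * ∏ m ∈ Finset.univ.erase k, (q m).rep (J m))
    (Finset.prod_ne_zero_iff.2 fun m _ => hJ m) ?_
  funext i
  have h1 := congrFun h (Function.update J k i)
  simp only [powVec_update, Pi.smul_apply, smul_eq_mul] at h1 ⊢
  rw [h1, mul_assoc]

lemma isClosed_range_powSegre {n : ℕ} {I : Type} :
    IsClosed (Set.range (powSegre (n := n) (I := I))) := by
  have key : Set.range (powSegre (n := n) (I := I)) =
      ⋂ (J : Fin n → I), ⋂ (L : Fin n → I), ⋂ (k : Fin n),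
        {z : ProjSpace (Fin n → I) | MvPolynomial.eval z.rep
          (MvPolynomial.X J * MvPolynomial.X L -
            MvPolynomial.X (Function.update J k (L k)) *
              MvPolynomial.X (Function.update L k (J k))) = 0} := by
    ext z
    simp only [Set.mem_range, Set.mem_iInter, Set.mem_ofPred_eq, map_sub, map_mul,
      MvPolynomial.eval_X]
    constructor
    · rintro ⟨p, rfl⟩ J L k
      obtain ⟨c, hc, h⟩ := (isLift_powSegre id).rep_eq p
      simp only [id] at h
      rw [h]
      have e1 := powVec_update (fun k => (p k).rep) J k (J k)
      have e2 := powVec_update (fun k => (p k).rep) L k (L k)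
      rw [Function.update_eq_self] at e1 e2
      simp only [Pi.smul_apply, smul_eq_mul, powVec_update, e1, e2]
      ring
    · intro h
      obtain ⟨J, hJ⟩ := Function.ne_iff.1 z.rep_nonzero
      set v : Fin n → I → ℂ := fun k i => z.rep (Function.update J k i) with hv
      have hv0 : ∀ k, v k ≠ 0 := fun k => Function.ne_iff.2 ⟨J k, by
        simpa [hv] using hJ⟩
      have claim : ∀ (L : Fin n → I) (s : Finset (Fin n)),
          z.rep (s.piecewise L J) * z.rep J ^ s.card = z.rep J * ∏ k ∈ s, v k (L k) := by
        intro L s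
        induction s using Finset.induction_on with
        | empty => simp
        | insert k s hk ih =>
          have h1 := h (s.piecewise L J) (Function.update J k (L k)) k
          rw [Function.update_self, Function.update_idem, Finset.piecewise_eq_of_notMem _ _ _ hk,
            Function.update_eq_self] at h1
          rw [Finset.piecewise_insert, Finset.card_insert_of_notMem hk, Finset.prod_insert hk,
            pow_succ]
          simp only [hv] at ih ⊢
          linear_combination (-z.rep J ^ s.card) * h1 + z.rep (Function.update J k (L k)) * ih
      refine ⟨fun k => Projectivization.mk ℂ (v k) (hv0 k), ?_⟩
      choose a ha h1 using fun k => mk_rep_eq (v k) (hv0 k)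
      refine ((isLift_powSegre id).eq_iff (isLift_rep id) _ z).2
        ⟨(∏ k, a k) * (z.rep J ^ n * (z.rep J)⁻¹), mul_ne_zero
          (Finset.prod_ne_zero_iff.2 fun k _ => ha k)
          (mul_ne_zero (pow_ne_zero _ hJ) (inv_ne_zero hJ)), ?_⟩
      change powVec (fun k => (Projectivization.mk ℂ (v k) (hv0 k)).rep) = _ • z.rep
      rw [show (fun k => (Projectivization.mk ℂ (v k) (hv0 k)).rep) = fun k => a k • v k from
        funext h1, powVec_smul, mul_smul]
      congr 1
      funext L
      have h2 := claim L Finset.univ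
      rw [Finset.piecewise_univ, Finset.card_univ, Fintype.card_fin] at h2
      have hJ' : z.rep J ≠ 0 := hJ
      simp only [Pi.smul_apply, smul_eq_mul, powVec]
      field_simp
      linear_combination -h2
  rw [key]
  exact isClosed_iInter fun k => isClosed_iInter fun l => isClosed_iInter fun m =>
    isClosed_eq_zero
      (((MvPolynomial.isHomogeneous_X _ _).mul (MvPolynomial.isHomogeneous_X _ _)).sub
        ((MvPolynomial.isHomogeneous_X _ _).mul (MvPolynomial.isHomogeneous_X _ _)))

lemma regularFor_powSegre {T I : Type} {n : ℕ} (u : T → Fin n → ProjSpace I) (k : Fin n) :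
    RegularFor (fun x => powSegre (u x)) id (fun x => u x k) := by
  refine (regularFor_iff (isLift_powSegre u) (isLift_rep id) _).2 fun x => ?_
  obtain ⟨J, hJ⟩ := exists_all_ne_zero fun k => (u x k).rep_nonzero
  have ev : ∀ y, evalVec (fun i => MvPolynomial.X (Function.update J k i))
      (powVec fun k => (u y k).rep) =
        (∏ m ∈ Finset.univ.erase k, (u y m).rep (J m)) • (u y k).rep := fun y => by
    funext i
    simp [evalVec, powVec_update]
  refine ⟨1, fun i => MvPolynomial.X (Function.update J k i),
    fun i => MvPolynomial.isHomogeneous_X _ _, ?_, fun y hy => ?_⟩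
  · rw [ev]
    exact smul_ne_zero (Finset.prod_ne_zero_iff.2 fun m _ => hJ m)
      (Projectivization.rep_nonzero _)
  · rw [ev] at hy ⊢
    have h : (∏ m ∈ Finset.univ.erase k, (u y m).rep (J m)) ≠ 0 :=
      fun h => hy (by rw [h, zero_smul])
    exact ⟨_, inv_ne_zero h, by rw [smul_smul, inv_mul_cancel₀ h, one_smul]; rfl⟩

lemma RegularFor.tuple {T T' I K : Type} {n : ℕ} {e : T → ProjSpace K} {e' : T' → ProjSpace I}
    {f : Fin n → T → T'} (hf : ∀ k, RegularFor e e' (f k)) :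
    RegularFor e (fun p : Fin n → T' => powSegre fun k => e' (p k)) (fun x k => f k x) := by
  simp only [regularFor_iff (isLift_rep _) (isLift_rep _)] at hf
  refine (regularFor_iff (isLift_rep _)
    (isLift_powSegre fun (p : Fin n → T') k => e' (p k)) _).2 fun x => ?_
  choose d P hP hPx hf using fun k => hf k x
  have ev : ∀ v, evalVec (fun J : Fin n → I => ∏ k, P k (J k)) v =
      powVec (fun k => evalVec (P k) v) := fun v => by
    funext k
    simp [evalVec, powVec, map_prod]
  refine ⟨∑ k, d k, fun J => ∏ k, P k (J k),
    fun J => MvPolynomial.IsHomogeneous.prod _ _ _ fun k _ => hP k (J k), ?_, fun y hy => ?_⟩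
  · rw [ev]
    exact powVec_ne_zero hPx
  · rw [ev] at hy ⊢
    have h0 : ∀ k, evalVec (P k) (e y).rep ≠ 0 := fun k h => hy (by
      funext J
      exact Finset.prod_eq_zero (Finset.mem_univ k) (congrFun h (J k)))
    choose a ha h1 using fun k => hf k y (h0 k)
    refine ⟨∏ k, a k, Finset.prod_ne_zero_iff.2 fun k _ => ha k, ?_⟩
    simp only [h1, powVec_smul]

/-- The Cartesian power `X ^ n` of a quasi-projective variety. -/
def Variety.pow (X : Variety) (n : ℕ) : Variety where
  carrier := Fin n → X
  coord := Fin n → X.coord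
  finite_coord := by
    have := X.finite_coord
    infer_instance
  emb := fun p => powSegre fun k => X.emb (p k)
  emb_injective := fun p q h => by
    have h := powSegre_injective h
    funext k
    exact X.emb_injective (congrFun h k)
  isLocallyClosed_range := by
    let t := TopologicalSpace.induced (powSegre (n := n) (I := X.coord)) (zariskiTopology _)
    have c := fun k => (regularFor_powSegre (n := n) (I := X.coord) id k).continuous
    rw [induced_id] at c
    have h0 : ∀ s : Finset (Fin n), IsLocallyClosed
        (⋂ k ∈ s, (fun p : Fin n → ProjSpace X.coord => p k) ⁻¹' Set.range X.emb) := by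
      intro s
      induction s using Finset.induction_on with
      | empty => simpa using isOpen_univ.isLocallyClosed
      | insert k s hk ih =>
        rw [Finset.set_biInter_insert]
        exact (X.isLocallyClosed_range.preimage (c k)).inter ih
    have h := @IsLocallyClosed.image _ _ t _ _ (h0 Finset.univ)
      (powSegre (n := n) (I := X.coord))
      (@Topology.IsInducing.mk _ _ t _ _ rfl) isClosed_range_powSegre.isLocallyClosed
    convert! h using 1
    ext z
    constructor
    · rintro ⟨p, rfl⟩
      exact ⟨fun k => X.emb (p k), by simp, rfl⟩
    · rintro ⟨q, hq, rfl⟩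
      simp only [Finset.mem_univ, Set.iInter_true, Set.mem_iInter, Set.mem_preimage,
        Set.mem_range] at hq
      choose p hp using hq
      exact ⟨p, congrArg powSegre (funext hp)⟩

lemma isRegular_proj (X : Variety) {n : ℕ} (k : Fin n) :
    IsRegular (X := X.pow n) (Y := X) (fun p => p k) :=
  regularFor_powSegre (fun (p : Fin n → X) k => X.emb (p k)) k

lemma IsRegular.tuple {X Y : Variety} {n : ℕ} {f : Fin n → X → Y} (hf : ∀ k, IsRegular (f k)) :
    IsRegular (X := X) (Y := Y.pow n) (fun x k => f k x) :=
  RegularFor.tuple hf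

/-! ### The one-point variety -/

lemma projSpace_unit_subsingleton : Subsingleton (ProjSpace Unit) := ⟨fun p q => by
  have hp : p.rep () ≠ 0 := fun h => p.rep_nonzero (funext fun _ => h)
  have hq : q.rep () ≠ 0 := fun h => q.rep_nonzero (funext fun _ => h)
  refine proj_ext (a := q.rep ()) (b := p.rep ()) hq ?_
  funext i
  simp [mul_comm]⟩

/-- The one-point variety `Spec ℂ`. -/
def Variety.point : Variety where
  carrier := Unit
  coord := Unit
  finite_coord := inferInstance
  emb := fun _ => Projectivization.mk ℂ (fun _ => 1) (Function.ne_iff.2 ⟨(), one_ne_zero⟩)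
  emb_injective := fun _ _ _ => rfl
  isLocallyClosed_range := by
    have := projSpace_unit_subsingleton
    rw [Set.range_eq_univ.2 fun p => ⟨(), Subsingleton.elim _ _⟩]
    exact isOpen_univ.isLocallyClosed

lemma isRegular_point {X : Variety} (f : X → Variety.point) : IsRegular f := fun x => by
  have := projSpace_unit_subsingleton
  refine ⟨0, fun _ => 1, fun _ => MvPolynomial.isHomogeneous_one _ _,
    Function.ne_iff.2 ⟨(), ?_⟩, fun y hy => Subsingleton.elim (α := ProjSpace Unit) _ _⟩
  simp only [evalVec, map_one]
  exact one_ne_zero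

/-- `f` is an isomorphism of `X` onto a Zariski closed subvariety of `Y`. -/
def IsClosedEmb {X Y : Variety} (f : X → Y) : Prop :=
  IsRegular f ∧ ∃ (hc : IsClosed (Set.range f)) (s : Y.sub (Set.range f) hc.isLocallyClosed → X),
    IsRegular s ∧ ∀ x, s ⟨f x, x, rfl⟩ = x

/-! ### Varieties with actions of finite groups -/

/-- A quasi-projective variety `X` with an action of a finite group `G` (by regular maps). -/
structure GVariety : Type 1 where
  X : Variety
  G : Type
  [group : Group G]
  [finite : Finite G]
  [action : MulAction G X.carrier]
  regular : ∀ g : G, IsRegular (fun x : X => g • x)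

attribute [instance] GVariety.group GVariety.finite GVariety.action

namespace GVariety

/-- Isomorphism of pairs: compatible isomorphisms of the varieties and of the groups. -/
def Isomorphic (V W : GVariety) : Prop :=
  ∃ (ψ : V.X ≃ W.X) (φ : V.G ≃* W.G), IsRegular ψ ∧ IsRegular ψ.symm ∧
    ∀ (g : V.G) (x : V.X), ψ (g • x) = φ g • ψ x

/-- A `G`-invariant locally closed subvariety with the restricted action. -/
def sub (V : GVariety) (S : Set V.X) (hS : IsLocallyClosed S)
    (h : ∀ (g : V.G), ∀ x ∈ S, g • x ∈ S) : GVariety where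
  X := V.X.sub S hS
  G := V.G
  action :=
    { smul := fun g x => (⟨g • x.1, h g x.1 x.2⟩ : S)
      one_smul := fun x => Subtype.ext (one_smul V.G x.1)
      mul_smul := fun g g' x => Subtype.ext (mul_smul g g' x.1) }
  regular := fun g => (V.regular g).restrict hS hS (h g)

/-- Invariance of the complement. -/
lemma compl_invariant (V : GVariety) {S : Set V.X} (h : ∀ (g : V.G), ∀ x ∈ S, g • x ∈ S)
    (g : V.G) (x : V.X) (hx : x ∈ Sᶜ) : g • x ∈ Sᶜ := fun hgx =>
  hx (by simpa using h g⁻¹ _ hgx)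

/-- `Z` is (isomorphic to) the `Z.G`-variety induced from the `V.G`-variety `V` along the
embedding `φ` of `V.G` as a subgroup of `Z.G`: the map `q : Z.G × V.X → Z.X` is the quotient by
the right action `(h, x) * g = (h φ(g), g⁻¹ x)`, it is equivariant, and `Z.X` has the structure of
variety coming from the disjoint union `Z.G × V.X` of copies of `V.X`, that is, each copy
`{h} × V.X` is mapped isomorphically onto a closed subvariety. -/
def IsInduced (Z V : GVariety) (φ : V.G →* Z.G) : Prop :=
  Function.Injective φ ∧ ∃ q : Z.G → V.X → Z.X,
    (∀ h h' x x', q h x = q h' x' ↔ ∃ g : V.G, h' = h * φ g ∧ x' = g⁻¹ • x) ∧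
    (∀ z, ∃ h x, q h x = z) ∧
    (∀ h₀ h x, h₀ • q h x = q (h₀ * h) x) ∧
    ∀ h, IsClosedEmb (q h)

/-- The product of two varieties with actions. -/
def prod (V W : GVariety) : GVariety where
  X := V.X.prod W.X
  G := V.G × W.G
  action :=
    { smul := fun g x => (g.1 • x.1, g.2 • x.2)
      one_smul := fun x => Prod.ext (one_smul V.G x.1) (one_smul W.G x.2)
      mul_smul := fun g g' x => Prod.ext (mul_smul g.1 g'.1 x.1) (mul_smul g.2 g'.2 x.2) }
  regular := fun g => (V.regular g.1).prodMap (W.regular g.2)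

/-- The point with the action of the trivial group. -/
def point : GVariety where
  X := Variety.point
  G := Unit
  action :=
    { smul := fun _ x => x
      one_smul := fun _ => rfl
      mul_smul := fun _ _ _ => rfl }
  regular := fun _ => isRegular_point _

/-- The wreath product `G_n = G^n ⋊ S_n`. -/
abbrev Wreath (G : Type) [Group G] (n : ℕ) : Type :=
  (Fin n → G) ⋊[mulAutArrow (G := Equiv.Perm (Fin n)) (A := Fin n) (M := G)] Equiv.Perm (Fin n)

/-- The Cartesian power `X^n` with the action of the wreath product `G_n`: the group `G^n` acts
componentwise, and `S_n` permutes the factors. -/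
def pow (V : GVariety) (n : ℕ) : GVariety where
  X := V.X.pow n
  G := Wreath V.G n
  finite := Finite.of_equiv _ SemidirectProduct.equivProd.symm
  action :=
    { smul := fun w x => fun i => w.left i • x (w.right⁻¹ i)
      one_smul := fun x => funext fun i => one_smul V.G (x i)
      mul_smul := fun w w' x => funext fun i => by
        change (w.left i * w'.left (w.right⁻¹ i)) • x ((w.right * w'.right)⁻¹ i) =
          w.left i • w'.left (w.right⁻¹ i) • x (w'.right⁻¹ (w.right⁻¹ i))
        rw [mul_smul, mul_inv_rev]
        rfl }
  regular := fun w => IsRegular.tuple fun i =>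
    (V.regular (w.left i)).comp (isRegular_proj V.X (w.right⁻¹ i))

/-! ### Fixed points and centralizers -/

/-- The variety of fixed points of an element `g` (equivalently, of the group generated
by `g`). -/
def fixedPoints (V : GVariety) (g : V.G) : Variety :=
  V.X.sub {x | g • x = x} ((V.regular g).isClosed_eq (isRegular_id V.X)).isLocallyClosed

lemma smul_fixed (V : GVariety) (g : V.G) (c : Subgroup.centralizer {g}) (x : V.X)
    (hx : g • x = x) : g • (c : V.G) • x = (c : V.G) • x := by
  rw [← mul_smul, ← Subgroup.mem_centralizer_singleton_iff.1 c.2, mul_smul, hx]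

/-- The action of the centralizer of `g` on the fixed points of `g`. -/
instance centralizerAction (V : GVariety) (g : V.G) :
    MulAction (Subgroup.centralizer {g}) (V.fixedPoints g).carrier where
  smul c x := (⟨(c : V.G) • x.1, V.smul_fixed g c x.1 x.2⟩ : {x : V.X | g • x = x})
  one_smul x := Subtype.ext (one_smul V.G x.1)
  mul_smul c c' x := Subtype.ext (mul_smul (c : V.G) (c' : V.G) x.1)

lemma centralizer_regular (V : GVariety) (g : V.G) (c : Subgroup.centralizer {g}) :
    IsRegular (fun x : V.fixedPoints g => c • x) :=
  (V.regular (c : V.G)).restrict _ _ fun x hx => V.smul_fixed g c x hx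

/-- The pair `(X^⟨g⟩, C_G(g))`. -/
def fixed (V : GVariety) (g : V.G) : GVariety where
  X := V.fixedPoints g
  G := Subgroup.centralizer {g}
  regular := V.centralizer_regular g

/-- The element `g` of its centralizer. -/
def selfCentralizer {G : Type} [Group G] (g : G) : Subgroup.centralizer {g} :=
  ⟨g, Subgroup.mem_centralizer_singleton_iff.2 rfl⟩

/-- The subgroup of `C_G(g) × ℤ` generated by `(g, -r)`. -/
def rootRelation {G : Type} [Group G] (r : ℕ+) (g : G) :
    Subgroup (Subgroup.centralizer {g} × Multiplicative ℤ) :=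
  Subgroup.zpowers (selfCentralizer g, Multiplicative.ofAdd (-(r : ℤ)))

lemma commute_rootRelation {G : Type} [Group G] (r : ℕ+) (g : G)
    (p : Subgroup.centralizer {g} × Multiplicative ℤ) :
    Commute p (selfCentralizer g, Multiplicative.ofAdd (-(r : ℤ))) :=
  Prod.ext (Subtype.ext (Subgroup.mem_centralizer_singleton_iff.1 p.1.2)) (mul_comm _ _)

instance {G : Type} [Group G] (r : ℕ+) (g : G) : (rootRelation r g).Normal where
  conj_mem := by
    rintro _ ⟨k, rfl⟩ p
    refine ⟨k, ?_⟩
    dsimp only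
    rw [((commute_rootRelation r g p).zpow_right k).eq, mul_inv_cancel_right]

/-- The group `C_G(g)⟨a_{r,g}⟩` generated by `C_G(g)` and an additional element `a = a_{r,g}`
which commutes with `C_G(g)` and satisfies `a ^ r = g`: the quotient of the direct product of
`C_G(g)` and of the infinite cyclic group generated by `a`, by the relation `g a⁻ʳ = 1`. -/
abbrev RootCentralizer {G : Type} [Group G] (r : ℕ+) (g : G) : Type :=
  (Subgroup.centralizer {g} × Multiplicative ℤ) ⧸ rootRelation r g

instance {G : Type} [Group G] [Finite G] (r : ℕ+) (g : G) : Finite (RootCentralizer r g) := by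
  refine Finite.of_surjective
    (fun p : Subgroup.centralizer {g} × Fin r =>
      (QuotientGroup.mk (p.1, Multiplicative.ofAdd (p.2 : ℤ)) : RootCentralizer r g)) ?_
  intro y
  induction y using QuotientGroup.induction_on with
  | H p =>
    obtain ⟨c, k⟩ := p
    have hr : (0 : ℤ) < r := by exact_mod_cast r.pos
    set m : ℤ := Multiplicative.toAdd k with hm
    refine ⟨(c * selfCentralizer g ^ (m / r), ⟨(m % r).toNat, ?_⟩), ?_⟩
    · have := Int.emod_lt_of_pos m hr
      have := Int.emod_nonneg m hr.ne'
      omega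
    · refine (QuotientGroup.eq.2 ⟨-(m / r), ?_⟩)
      refine Prod.ext ?_ ?_
      · simp
      · apply Multiplicative.toAdd.injective
        have h1 := Int.emod_nonneg m hr.ne'
        have h2 := Int.emod_add_mul_ediv m r
        simp [Int.toNat_of_nonneg h1, ← hm]
        linarith

/-- The homomorphism `C_G(g)⟨a⟩ → Sym(X^⟨g⟩)` which gives the action of `C_G(g)` and sends `a`
to the identity. -/
def rootHom (V : GVariety) (r : ℕ+) (g : V.G) :
    RootCentralizer r g →* Equiv.Perm (V.fixedPoints g).carrier :=
  QuotientGroup.lift (rootRelation r g)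
    ((MulAction.toPermHom (Subgroup.centralizer {g}) (V.fixedPoints g).carrier).comp
      (MonoidHom.fst _ _)) (by
    rintro _ ⟨k, rfl⟩
    dsimp only
    rw [MonoidHom.mem_ker, map_zpow]
    suffices h : MulAction.toPermHom (Subgroup.centralizer {g}) (V.fixedPoints g).carrier
        (selfCentralizer g) = 1 by
      change (MulAction.toPermHom (Subgroup.centralizer {g}) (V.fixedPoints g).carrier
        (selfCentralizer g)) ^ k = 1
      rw [h, one_zpow]
    ext x : 1
    exact Subtype.ext x.2)

/-- The pair `(X^⟨g⟩, C_G(g)⟨a_{r,g}⟩)`, where `a_{r,g}` acts trivially. -/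
def rootFixed (V : GVariety) (r : ℕ+) (g : V.G) : GVariety where
  X := V.fixedPoints g
  G := RootCentralizer r g
  action := MulAction.compHom _ (V.rootHom r g)
  regular := fun y => by
    induction y using QuotientGroup.induction_on with
    | H p => exact V.centralizer_regular g p.1

end GVariety

/-! ### The Grothendieck ring of varieties with actions of finite groups -/

/-- The defining relations of the Grothendieck group: 1) isomorphic pairs, 2) cutting out a closed
invariant subvariety, 3) induction. -/
inductive GrothendieckRel : FreeAbelianGroup GVariety → Prop
  | iso (V W : GVariety) (h : V.Isomorphic W) :
      GrothendieckRel (FreeAbelianGroup.of V - FreeAbelianGroup.of W)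
  | scissor (V : GVariety) (Y : Set V.X) (hY : IsClosed Y)
      (h : ∀ (g : V.G), ∀ x ∈ Y, g • x ∈ Y) :
      GrothendieckRel (FreeAbelianGroup.of V -
        (FreeAbelianGroup.of (V.sub Y hY.isLocallyClosed h) +
          FreeAbelianGroup.of
            (V.sub Yᶜ hY.isOpen_compl.isLocallyClosed (V.compl_invariant h))))
  | induced (Z V : GVariety) (φ : V.G →* Z.G) (h : Z.IsInduced V φ) :
      GrothendieckRel (FreeAbelianGroup.of Z - FreeAbelianGroup.of V)

/-- The Grothendieck ring `K_0^{fGr}(Var_ℂ)` of complex quasi-projective varieties with actions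
of finite groups, as an abelian group. -/
def K0 : Type 1 :=
  FreeAbelianGroup GVariety ⧸ AddSubgroup.closure {x | GrothendieckRel x}

instance : AddCommGroup K0 :=
  inferInstanceAs (AddCommGroup (FreeAbelianGroup GVariety ⧸ AddSubgroup.closure _))

/-- The projection of the free abelian group on the pairs to `K0`. -/
def K0.mk : FreeAbelianGroup GVariety →+ K0 := QuotientAddGroup.mk' _

lemma K0.mk_eq_zero {x : FreeAbelianGroup GVariety} (h : GrothendieckRel x) : K0.mk x = 0 :=
  (QuotientAddGroup.eq_zero_iff x).2 (AddSubgroup.subset_closure h)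

/-- The class `[(X, G)]`. -/
def cls (V : GVariety) : K0 := K0.mk (FreeAbelianGroup.of V)

lemma cls_eq_of_rel {a b : FreeAbelianGroup GVariety} (h : GrothendieckRel (a - b)) :
    K0.mk a = K0.mk b := by
  rw [← sub_eq_zero, ← map_sub]
  exact K0.mk_eq_zero h

lemma cls_iso {V W : GVariety} (h : V.Isomorphic W) : cls V = cls W :=
  cls_eq_of_rel (.iso V W h)

lemma cls_scissor (V : GVariety) (Y : Set V.X) (hY : IsClosed Y)
    (h : ∀ (g : V.G), ∀ x ∈ Y, g • x ∈ Y) :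
    cls V = cls (V.sub Y hY.isLocallyClosed h) +
      cls (V.sub Yᶜ hY.isOpen_compl.isLocallyClosed (V.compl_invariant h)) :=
  (cls_eq_of_rel (.scissor V Y hY h)).trans (map_add _ _ _)

lemma cls_induced {Z V : GVariety} (φ : V.G →* Z.G) (h : Z.IsInduced V φ) : cls Z = cls V :=
  cls_eq_of_rel (.induced Z V φ h)

/-- A function of pairs which respects the relations defines a homomorphism on `K0`. -/
def K0.lift {A : Type*} [AddCommGroup A] (f : GVariety → A)
    (hf : ∀ x, GrothendieckRel x → FreeAbelianGroup.lift f x = 0) : K0 →+ A :=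
  QuotientAddGroup.lift _ (FreeAbelianGroup.lift f)
    ((AddSubgroup.closure_le (FreeAbelianGroup.lift f).ker).2 hf)

lemma K0.lift_cls {A : Type*} [AddCommGroup A] (f : GVariety → A)
    (hf : ∀ x, GrothendieckRel x → FreeAbelianGroup.lift f x = 0) (V : GVariety) :
    K0.lift f hf (cls V) = f V :=
  FreeAbelianGroup.lift_apply_of f V

lemma K0.hom_ext {A : Type*} [AddCommGroup A] {f g : K0 →+ A}
    (h : ∀ V, f (cls V) = g (cls V)) : f = g :=
  QuotientAddGroup.addMonoidHom_ext _ (FreeAbelianGroup.lift_ext _ _ h)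

/-! Products of pairs respect isomorphisms and the relations. -/

namespace GVariety

lemma Isomorphic.prod_right {V V' : GVariety} (h : V.Isomorphic V') (W : GVariety) :
    (V.prod W).Isomorphic (V'.prod W) := by
  obtain ⟨ψ, φ, h1, h2, h3⟩ := h
  exact ⟨Equiv.prodCongr ψ (Equiv.refl _), MulEquiv.prodCongr φ (MulEquiv.refl _),
    h1.prodMap (isRegular_id W.X), h2.prodMap (isRegular_id W.X),
    fun g x => Prod.ext (h3 g.1 x.1) rfl⟩

lemma isomorphic_prod_comm (V W : GVariety) : (V.prod W).Isomorphic (W.prod V) :=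
  ⟨Equiv.prodComm _ _, MulEquiv.prodComm, (isRegular_snd V.X W.X).pair (isRegular_fst V.X W.X),
    (isRegular_snd W.X V.X).pair (isRegular_fst W.X V.X), fun _ _ => rfl⟩

lemma isomorphic_prod_assoc (U V W : GVariety) :
    ((U.prod V).prod W).Isomorphic (U.prod (V.prod W)) :=
  ⟨Equiv.prodAssoc _ _ _, MulEquiv.prodAssoc,
    (((isRegular_fst U.X V.X).comp (isRegular_fst (U.X.prod V.X) W.X))).pair
      (((isRegular_snd U.X V.X).comp (isRegular_fst (U.X.prod V.X) W.X)).pair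
        (isRegular_snd (U.X.prod V.X) W.X)),
    ((isRegular_fst U.X (V.X.prod W.X)).pair
      ((isRegular_fst V.X W.X).comp (isRegular_snd U.X (V.X.prod W.X)))).pair
        ((isRegular_snd V.X W.X).comp (isRegular_snd U.X (V.X.prod W.X))),
    fun _ _ => rfl⟩

lemma isomorphic_prod_point (V : GVariety) : (V.prod point).Isomorphic V :=
  ⟨Equiv.prodPUnit _, MulEquiv.prodUnique (N := Unit), isRegular_fst V.X Variety.point,
    (isRegular_id V.X).pair (isRegular_point _), fun _ _ => rfl⟩

lemma isomorphic_sub_prod (V W : GVariety) (S : Set V.X) (hS : IsLocallyClosed S)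
    (h : ∀ (g : V.G), ∀ x ∈ S, g • x ∈ S) (hS' : IsLocallyClosed (X := (V.prod W).X.carrier)
      (Prod.fst ⁻¹' S)) (h' : ∀ (g : (V.prod W).G), ∀ x ∈ (Prod.fst ⁻¹' S : Set (V.prod W).X),
        g • x ∈ (Prod.fst ⁻¹' S : Set (V.prod W).X)) :
    ((V.prod W).sub (Prod.fst ⁻¹' S) hS' h').Isomorphic ((V.sub S hS h).prod W) := by
  have r1 : IsRegular (X := (V.prod W).X.sub (Prod.fst ⁻¹' S) hS') (Y := V.X)
      (fun x => x.1.1) := (isRegular_fst V.X W.X).comp (isRegular_val _ _ hS')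
  have r2 : IsRegular (X := (V.prod W).X.sub (Prod.fst ⁻¹' S) hS') (Y := W.X)
      (fun x => x.1.2) := (isRegular_snd V.X W.X).comp (isRegular_val _ _ hS')
  exact ⟨⟨fun x => (⟨x.1.1, x.2⟩, x.1.2), fun y => ⟨(y.1.1, y.2), y.1.2⟩, fun _ => rfl,
    fun _ => rfl⟩, MulEquiv.refl _,
    IsRegular.pair (X := (V.prod W).X.sub (Prod.fst ⁻¹' S) hS') (Y := V.X.sub S hS) (Z := W.X)
      (isRegular_sub_iff.2 r1) r2,
    (isRegular_val V.X S hS).prodMap (isRegular_id W.X),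
    fun _ _ => rfl⟩

lemma IsInduced.prod_right {Z V : GVariety} {φ : V.G →* Z.G} (h : Z.IsInduced V φ)
    (W : GVariety) : (Z.prod W).IsInduced (V.prod W) (φ.prodMap (MonoidHom.id W.G)) := by
  obtain ⟨hφ, q, h1, h2, h3, h4⟩ := h
  refine ⟨hφ.prodMap Function.injective_id, fun k x => (q k.1 x.1, k.2 • x.2), ?_, ?_, ?_, ?_⟩
  · rintro ⟨a, b⟩ ⟨a', b'⟩ ⟨x, y⟩ ⟨x', y'⟩
    constructor
    · intro h
      obtain ⟨g, hg, hg'⟩ := (h1 _ _ _ _).1 (congrArg Prod.fst h)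
      have hy : b • y = b' • y' := congrArg Prod.snd h
      refine ⟨(g, b⁻¹ * b'), Prod.ext hg ?_, Prod.ext hg' ?_⟩
      · exact (mul_inv_cancel_left b b').symm
      · change y' = (b⁻¹ * b')⁻¹ • y
        rw [mul_inv_rev, inv_inv, mul_smul, hy, inv_smul_smul]
    · rintro ⟨⟨g, c⟩, hg, hx⟩
      have e1 : b' = b * c := congrArg Prod.snd hg
      have e2 : y' = c⁻¹ • y := congrArg Prod.snd hx
      refine Prod.ext ((h1 _ _ _ _).2 ⟨g, congrArg Prod.fst hg, congrArg Prod.fst hx⟩) ?_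
      change b • y = b' • y'
      rw [e1, e2, mul_smul, smul_inv_smul]
  · rintro ⟨z, w⟩
    obtain ⟨k, x, rfl⟩ := h2 z
    exact ⟨(k, 1), (x, w), Prod.ext rfl (one_smul W.G w)⟩
  · intro k₀ k x
    exact Prod.ext (h3 _ _ _) (mul_smul _ _ _).symm
  · rintro ⟨k, b⟩
    obtain ⟨hr, hc, s, hs, hs'⟩ := h4 k
    have hrange : Set.range (fun x : (V.prod W).X => ((q k x.1, b • x.2) : (Z.prod W).X)) =
        (Prod.fst ⁻¹' Set.range (q k) : Set (Z.prod W).X) := by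
      ext ⟨z, w⟩
      constructor
      · rintro ⟨x, hx⟩
        exact ⟨x.1, congrArg Prod.fst hx⟩
      · rintro ⟨x, hx⟩
        exact ⟨(x, b⁻¹ • w), Prod.ext hx (smul_inv_smul b w)⟩
    have hcl : IsClosed (X := (Z.prod W).X.carrier) (Set.range
        (fun x : (V.prod W).X => ((q k x.1, b • x.2) : (Z.prod W).X))) := by
      have h := hc.preimage (isRegular_fst Z.X W.X).continuous
      exact (congrArg (IsClosed (X := (Z.prod W).X.carrier)) hrange).mpr h
    have hmem : ∀ y : (Z.prod W).X.sub _ hcl.isLocallyClosed, y.1.1 ∈ Set.range (q k) :=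
      fun y => by
        have h : y.1 ∈ (Prod.fst ⁻¹' Set.range (q k) : Set (Z.prod W).X) := hrange ▸ y.2
        exact h
    refine ⟨hr.prodMap (W.regular b), hcl,
      fun y => (s ⟨y.1.1, hmem y⟩, b⁻¹ • y.1.2), ?_, fun x => ?_⟩
    · have r1 : IsRegular (X := (Z.prod W).X.sub _ hcl.isLocallyClosed) (Y := Z.X)
          (fun y => y.1.1) := (isRegular_fst Z.X W.X).comp (isRegular_val _ _ _)
      have r2 : IsRegular (X := (Z.prod W).X.sub _ hcl.isLocallyClosed) (Y := W.X)
          (fun y => y.1.2) := (isRegular_snd Z.X W.X).comp (isRegular_val _ _ _)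
      have r3 : IsRegular (X := (Z.prod W).X.sub _ hcl.isLocallyClosed)
          (Y := Z.X.sub _ hc.isLocallyClosed) (fun y => ⟨y.1.1, hmem y⟩) :=
        isRegular_sub_iff.2 r1
      exact (hs.comp r3).pair ((W.regular b⁻¹).comp r2)
    · exact Prod.ext (hs' x.1) (inv_smul_smul b x.2)

end GVariety

/-- Multiplication by the class of `W`, on the left factor. -/
def mulCls (W : GVariety) : K0 →+ K0 :=
  K0.lift (fun V => cls (V.prod W)) (by
    rintro _ (⟨V, V', h⟩ | ⟨V, Y, hY, h⟩ | ⟨Z, V, φ, h⟩)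
    · simpa [sub_eq_zero] using cls_iso (h.prod_right W)
    · have hY' : IsClosed (X := (V.prod W).X.carrier) (Prod.fst ⁻¹' Y) :=
        hY.preimage (isRegular_fst V.X W.X).continuous
      have h' : ∀ (g : (V.prod W).G), ∀ x ∈ (Prod.fst ⁻¹' Y : Set (V.prod W).X),
          g • x ∈ (Prod.fst ⁻¹' Y : Set (V.prod W).X) := fun g x hx => h g.1 x.1 hx
      have e := cls_scissor (V.prod W) _ hY' h'
      have e1 := cls_iso (V.isomorphic_sub_prod W Y hY.isLocallyClosed h hY'.isLocallyClosed h')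
      have e2 := cls_iso (V.isomorphic_sub_prod W Yᶜ hY.isOpen_compl.isLocallyClosed
          (V.compl_invariant h) hY'.isOpen_compl.isLocallyClosed
          ((V.prod W).compl_invariant h'))
      have e3 := e.trans (congrArg₂ (· + ·) e1 e2)
      simpa [sub_eq_zero] using e3
    · simpa [sub_eq_zero] using cls_induced _ (h.prod_right W))

lemma mulCls_cls (V W : GVariety) : mulCls W (cls V) = cls (V.prod W) := K0.lift_cls _ _ _

/-- The multiplication of `K0` as a biadditive map, with the factors in reversed order. -/
def mulHom : K0 →+ K0 →+ K0 :=
  K0.lift mulCls (by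
    intro x hx
    refine K0.hom_ext fun V => ?_
    have h : ∀ y : FreeAbelianGroup GVariety, (FreeAbelianGroup.lift mulCls y) (cls V) =
        mulCls V (K0.mk y) := by
      intro y
      induction y using FreeAbelianGroup.induction_on with
      | zero => simp
      | of W =>
        rw [FreeAbelianGroup.lift_apply_of, mulCls_cls]
        exact (cls_iso (GVariety.isomorphic_prod_comm V W)).trans (mulCls_cls W V).symm
      | neg W h =>
        simp only [map_neg, AddMonoidHom.neg_apply, h]
      | add y z hy hz =>
        simp only [map_add, AddMonoidHom.add_apply, hy, hz]
    rw [h, K0.mk_eq_zero hx, map_zero, AddMonoidHom.zero_apply])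

lemma mulHom_cls (V W : GVariety) : mulHom (cls W) (cls V) = cls (V.prod W) := by
  rw [mulHom, K0.lift_cls, mulCls_cls]

/-- The multiplication is given by the Cartesian product,
`[(X₁, G₁)] [(X₂, G₂)] = [(X₁ × X₂, G₁ × G₂)]` (see `cls_mul`), and the unit is the class of the
point with the action of the trivial group. -/
instance : CommRing K0 :=
  have hcomm : ∀ a b : K0, mulHom b a = mulHom a b := fun a b => by
    have : mulHom.flip = mulHom := K0.hom_ext fun V => K0.hom_ext fun W => by
      rw [AddMonoidHom.flip_apply, mulHom_cls, mulHom_cls]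
      exact cls_iso (GVariety.isomorphic_prod_comm V W)
    exact DFunLike.congr_fun (DFunLike.congr_fun this a) b
  have hone : ∀ a : K0, mulHom (cls GVariety.point) a = a := fun a => by
    have : mulHom (cls GVariety.point) = AddMonoidHom.id K0 := K0.hom_ext fun V => by
      rw [mulHom_cls]
      exact cls_iso V.isomorphic_prod_point
    exact DFunLike.congr_fun this a
  have hassoc : ∀ a b c : K0, mulHom c (mulHom b a) = mulHom (mulHom c b) a := fun a b c => by
    have : (AddMonoidHom.compHom.comp mulHom).compl₂ mulHom =
        (AddMonoidHom.compHom mulHom).comp mulHom := by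
      refine K0.hom_ext fun U => K0.hom_ext fun V => K0.hom_ext fun W => ?_
      simp only [AddMonoidHom.compl₂_apply, AddMonoidHom.comp_apply, AddMonoidHom.compHom_apply_apply,
        mulHom_cls]
      exact cls_iso (GVariety.isomorphic_prod_assoc W V U)
    exact DFunLike.congr_fun (DFunLike.congr_fun (DFunLike.congr_fun this c) b) a
  { (inferInstance : AddCommGroup K0) with
    mul := fun a b => mulHom b a
    one := cls GVariety.point
    mul_assoc := fun a b c => hassoc a b c
    one_mul := fun a => (hcomm _ _).trans (hone a)
    mul_one := hone
    left_distrib := fun a b c => DFunLike.congr_fun (mulHom.map_add b c) a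
    right_distrib := fun a b c => (mulHom c).map_add a b
    zero_mul := fun a => (mulHom a).map_zero
    mul_zero := fun a => DFunLike.congr_fun mulHom.map_zero a
    mul_comm := fun a b => hcomm a b }

lemma cls_mul (V W : GVariety) : cls V * cls W = cls (V.prod W) := mulHom_cls V W

lemma cls_point : cls GVariety.point = 1 := rfl

/-- `K0` carries the discrete topology, so that power series over it converge coefficientwise. -/
instance : TopologicalSpace K0 := ⊥

/-! ### The inertia homomorphisms and the Kapranov zeta function -/

/-- A representative of a conjugacy class. -/
def conjRep {G : Type} [Group G] (c : ConjClasses G) : G := (ConjClasses.exists_rep c).choose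

lemma mk_conjRep {G : Type} [Group G] (c : ConjClasses G) : ConjClasses.mk (conjRep c) = c :=
  (ConjClasses.exists_rep c).choose_spec

/-- `α` is the inertia homomorphism:
`α([(X, G)]) = ∑_{[g] ∈ Conj G} [(X^⟨g⟩, C_G(g))]`. -/
def IsInertiaHom (α : K0 →+* K0) : Prop :=
  ∀ V : GVariety, α (cls V) = ∑ᶠ c : ConjClasses V.G, cls (V.fixed (conjRep c))

/-- `β` is the homomorphism `α_r`:
`α_r([(X, G)]) = ∑_{[g] ∈ Conj G} [(X^⟨g⟩, C_G(g)⟨a_{r,g}⟩)]`. -/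
def IsRootInertiaHom (r : ℕ+) (β : K0 →+ K0) : Prop :=
  ∀ V : GVariety, β (cls V) = ∑ᶠ c : ConjClasses V.G, cls (V.rootFixed r (conjRep c))

/-- The Kapranov zeta function `ζ_{(X,G)}(t) = 1 + ∑_{n ≥ 1} [(X^n, G_n)] t^n`. -/
def kapranovZeta (V : GVariety) : PowerSeries K0 :=
  PowerSeries.mk fun n => if n = 0 then 1 else cls (V.pow n)

/-- `ζ` is the extension of the Kapranov zeta function to an additive-to-multiplicative map on
the Grothendieck ring. -/
structure IsKapranovZeta (ζ : K0 → PowerSeries K0) : Prop where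
  map_zero : ζ 0 = 1
  map_add : ∀ a b, ζ (a + b) = ζ a * ζ b
  map_cls : ∀ V : GVariety, ζ (cls V) = kapranovZeta V

end FGr

end

open scoped PowerSeries.WithPiTopology

/-!
The inertia homomorphism is realized geometrically. The inertia variety `V.inertia` of a pair
`V = (X, G)` consists of the pairs `(g, x)` with `g x = x`, on which `G` acts by conjugation on `g`
and by the given action on `x`. Its points over one conjugacy class form the pair induced from
`(X^⟨g⟩, C_G(g))`, so that `cls V.inertia` is the sum defining `α` (`cls_inertia_eq_sum`). This
description makes it plain that `α` is additive, multiplicative and compatible with induction.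

For the power `X^n`, a point of the inertia variety is a pair `(w, x)` with `w ∈ G_n` and `w x = x`,
and it may be sorted by the lengths of the cycles of the permutation underlying `w`:
`V.cycInertia T n` is the part in which all these lengths lie in `T`. If `w` is one full cycle of
length `r`, then it is conjugate to a standard cycle, determined by an element `g` of `G` up to
conjugation; the fixed points of the standard cycle are the diagonal ones with coordinate in
`X^⟨g⟩`, and its centralizer is `C_G(g)⟨a⟩`, with `a` corresponding to the cycle itself. Hence
`α_r [V]` is the class of `V.cycInertia {r} r` (`cls_cycInertia_eq_sum`). A full cycle acts
transitively on the indices, and therefore `α_r` is additive (`cls_cycInertia_add`).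

Let `cycleZeta V T` be the generating function of the classes of `V.cycInertia T n`. For
`T = Set.univ` it is `α(ζ_V)`. Separating the indices which lie on cycles with length in `T` from
those on cycles with length in `T'`, for disjoint `T` and `T'`, shows that
`cycleZeta V (T ∪ T') = cycleZeta V T * cycleZeta V T'` (`cycleZeta_union`). If all cycles have
length `r`, then `n = m r`, and the blocks of indices formed by the cycles exhibit
`V.cycInertia {r} n` as the pair induced from the `m`-th power of `V.cycInertia {r} r`, along the
embedding of `(G ≀ S_r) ≀ S_m` in `G ≀ S_n` (`cycInertia.isInductionMap_block`); so
`cycleZeta V {r}` is the Kapranov zeta function of `α_r [V]` at `t^r` (`cycleZeta_singleton`). The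
product formula is the decomposition of `Set.univ` into singletons.

The additivity of the Kapranov zeta function is of the same kind as `cycleZeta_union`, the indices
being separated by whether the coordinate lies in a closed subset. Both rest on
`IsMarking.cls_stratum`: the points with `a` marked indices are induced from the points in which the
first `a` indices are the marked ones.

Invariance under the relations of `K0` is checked on one kind of morphism only, the induction maps
(`IsInductionMap`), which comprise the isomorphisms of pairs.
-/

namespace FGr

/-! ### Locally constant maps and finite discrete varieties -/

/-- The sets `{F ≠ 0}` are a basis of the Zariski topology, and not only a subbasis. -/
lemma exists_homogeneous_of_mem_open {T I : Type} (e : T → ProjSpace I) {U : Set T}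
    (hU : IsOpen[TopologicalSpace.induced e (zariskiTopology I)] U) {x : T} (hx : x ∈ U) :
    ∃ (d : ℕ) (F : MvPolynomial I ℂ), F.IsHomogeneous d ∧ MvPolynomial.eval (e x).rep F ≠ 0 ∧
      ∀ y, MvPolynomial.eval (e y).rep F ≠ 0 → y ∈ U := by
  obtain ⟨O, hO, rfl⟩ := isOpen_induced_iff.1 hU
  suffices h : ∀ p ∈ O, ∃ (d : ℕ) (F : MvPolynomial I ℂ), F.IsHomogeneous d ∧
      MvPolynomial.eval p.rep F ≠ 0 ∧ ∀ q : ProjSpace I, MvPolynomial.eval q.rep F ≠ 0 → q ∈ O by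
    obtain ⟨d, F, hF, h1, h2⟩ := h (e x) hx
    exact ⟨d, F, hF, h1, fun y hy => h2 _ hy⟩
  clear hx hU
  induction hO with
  | basic s hs =>
    obtain ⟨d, F, hF, rfl⟩ := hs
    exact fun p hp => ⟨d, F, hF, hp, fun q hq => hq⟩
  | univ => exact fun p _ => ⟨0, 1, MvPolynomial.isHomogeneous_one _ _, by simp, fun _ _ => trivial⟩
  | inter s t _ _ hs ht =>
    rintro p ⟨hps, hpt⟩
    obtain ⟨d, F, hF, h1, h2⟩ := hs p hps
    obtain ⟨k, Q, hQ, h3, h4⟩ := ht p hpt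
    refine ⟨d + k, F * Q, hF.mul hQ, by simpa using ⟨h1, h3⟩, fun q hq => ?_⟩
    rw [map_mul] at hq
    exact ⟨h2 q (left_ne_zero_of_mul hq), h4 q (right_ne_zero_of_mul hq)⟩
  | sUnion S _ ih =>
    rintro p ⟨s, hs, hp⟩
    obtain ⟨d, F, hF, h1, h2⟩ := ih s hs p hp
    exact ⟨d, F, hF, h1, fun q hq => ⟨s, hs, h2 q hq⟩⟩

lemma isRegular_of_isLocallyConstant {X Y : Variety} {f : X → Y} (hf : IsLocallyConstant f) :
    IsRegular f := fun x => by
  obtain ⟨d, F, hF, hx, h⟩ := exists_homogeneous_of_mem_open X.emb (hf.isOpen_fiber (f x)) rfl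
  have ev : ∀ v, evalVec (fun j => MvPolynomial.C ((Y.emb (f x)).rep j) * F) v =
      MvPolynomial.eval v F • (Y.emb (f x)).rep := fun v => by
    funext j
    simp [evalVec, mul_comm]
  -- The polynomials have the ratio of the coordinates of the value `f x`, and vanish where `f` may
  -- take another value.
  refine ⟨d, fun j => MvPolynomial.C ((Y.emb (f x)).rep j) * F, fun j => ?_, ?_, fun y hy => ?_⟩
  · simpa using (MvPolynomial.isHomogeneous_C _ _).mul hF
  · rw [ev]
    exact smul_ne_zero hx (Projectivization.rep_nonzero _)
  · have hy' := hy
    rw [ev] at hy'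
    have hF0 : MvPolynomial.eval (X.emb y).rep F ≠ 0 := fun h0 => hy' (by rw [h0, zero_smul])
    have hfy : f y = f x := h y hF0
    rw [hfy]
    refine ((isLift_rep (fun _ : Unit => Y.emb (f x))).eq_iff
      (l' := fun _ : Unit => _) (fun _ => ⟨hy, rfl⟩) () ()).2
      ⟨(MvPolynomial.eval (X.emb y).rep F)⁻¹, inv_ne_zero hF0, ?_⟩
    rw [ev, smul_smul, inv_mul_cancel₀ hF0, one_smul]

/-- The coordinate point of `ℙ(ℂ^F)` with index `f`. -/
noncomputable def coordPoint {F : Type} (f : F) : ProjSpace F := by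
  classical
  exact Projectivization.mk ℂ (Pi.single f 1) (by simp)

lemma exists_rep_coordPoint {F : Type} (f : F) :
    ∃ c : ℂ, c ≠ 0 ∧ (coordPoint f).rep f = c ∧ ∀ i, i ≠ f → (coordPoint f).rep i = 0 := by
  classical
  obtain ⟨c, hc, h⟩ := mk_rep_eq (Pi.single f (1 : ℂ)) (by simp)
  change (coordPoint f).rep = _ at h
  refine ⟨c, hc, ?_, fun i hi => ?_⟩
  · simp [h]
  · simp [h, Pi.single_eq_of_ne hi]

/-- A finite set `F` as a variety: the coordinate points of `ℙ(ℂ^F)`. -/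
noncomputable def Variety.discrete (F : Type) [Finite F] : Variety where
  carrier := F
  coord := F
  finite_coord := inferInstance
  emb := coordPoint
  emb_injective := fun f f' h => by
    obtain ⟨c, hc, h1, _⟩ := exists_rep_coordPoint f
    obtain ⟨_, _, _, h2⟩ := exists_rep_coordPoint f'
    by_contra hne
    rw [h, h2 f hne] at h1
    exact hc h1.symm
  isLocallyClosed_range := by
    have key : Set.range (coordPoint (F := F)) =
        ⋂ (i : F), ⋂ (j : F), ⋂ (_ : i ≠ j), {p : ProjSpace F | MvPolynomial.eval p.rep
          (MvPolynomial.X i * MvPolynomial.X j) = 0} := by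
      ext p
      simp only [Set.mem_range, Set.mem_iInter, Set.mem_ofPred_eq, map_mul, MvPolynomial.eval_X]
      constructor
      · rintro ⟨f, rfl⟩ i j hij
        obtain ⟨_, _, _, h⟩ := exists_rep_coordPoint f
        by_cases hi : i = f
        · rw [h j (hi ▸ hij.symm), mul_zero]
        · rw [h i hi, zero_mul]
      · intro h
        obtain ⟨f, hf⟩ := Function.ne_iff.1 p.rep_nonzero
        obtain ⟨c, hc, h1, h2⟩ := exists_rep_coordPoint f
        refine ⟨f, proj_ext (b := c) hf ?_⟩
        funext i
        simp only [Pi.smul_apply, smul_eq_mul]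
        by_cases hi : i = f
        · rw [hi, h1, mul_comm]
        · rw [h2 i hi, (mul_eq_zero.1 (h i f hi)).resolve_right hf, mul_zero, mul_zero]
    rw [key]
    exact (isClosed_iInter fun i => isClosed_iInter fun j => isClosed_iInter fun _ =>
      isClosed_eq_zero ((MvPolynomial.isHomogeneous_X ℂ i).mul
        (MvPolynomial.isHomogeneous_X ℂ j))).isLocallyClosed

instance (F : Type) [Finite F] : DiscreteTopology (Variety.discrete F).carrier := by
  refine discreteTopology_iff_isOpen_singleton.2 fun (f : F) => ?_
  have h := isOpen_ne_zero (coordPoint (F := F)) (MvPolynomial.isHomogeneous_X ℂ f)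
  convert! h using 1
  ext (g : F)
  obtain ⟨c, hc, h1, h2⟩ := exists_rep_coordPoint g
  change g = f ↔ MvPolynomial.eval (coordPoint g).rep (MvPolynomial.X f) ≠ 0
  rw [MvPolynomial.eval_X]
  constructor
  · rintro rfl
    rwa [h1]
  · intro h
    by_contra hne
    exact h (h2 f (Ne.symm hne))

lemma isRegular_discrete_iff {X : Variety} {F : Type} [Finite F] {f : X → F} :
    IsRegular (X := X) (Y := Variety.discrete F) f ↔ IsLocallyConstant f :=
  ⟨fun h => (IsLocallyConstant.iff_continuous (Y := (Variety.discrete F).carrier) f).2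
    h.continuous, fun h => isRegular_of_isLocallyConstant (Y := Variety.discrete F) h⟩

lemma isRegular_const {X Y : Variety} (y : Y) : IsRegular (fun _ : X => y) :=
  isRegular_of_isLocallyConstant (IsLocallyConstant.const y)

lemma isLocallyConstant_pi {T F I : Type} [TopologicalSpace T] [Finite I] {f : I → T → F}
    (hf : ∀ i, IsLocallyConstant (f i)) : IsLocallyConstant (fun x i => f i x) := by
  rw [IsLocallyConstant.iff_exists_open]
  intro x
  refine ⟨⋂ i, f i ⁻¹' {f i x}, isOpen_iInter_of_finite fun i => (hf i).isOpen_fiber _,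
    by simp, fun y hy => ?_⟩
  funext i
  exact Set.mem_iInter.1 hy i

lemma IsRegular.isLocallyConstant_comp {X Y : Variety} {F : Type} {f : X → Y} (hf : IsRegular f)
    {g : Y → F} (hg : IsLocallyConstant g) :
    IsLocallyConstant (fun x => g (f x)) :=
  hg.comp_continuous hf.continuous

/-! ### Closed embeddings -/

/-- An isomorphism onto a closed subset `S`, with inverse `s`, is a closed embedding. -/
lemma IsClosedEmb.of_inverse {X Y : Variety} {f : X → Y} (hf : IsRegular f) {S : Set Y}
    (hS : IsClosed S) (hfS : ∀ x, f x ∈ S) (s : Y.sub S hS.isLocallyClosed → X)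
    (hs : IsRegular s) (hsf : ∀ x, s ⟨f x, hfS x⟩ = x)
    (hfs : ∀ y : Y.sub S hS.isLocallyClosed, f (s y) = y.1) : IsClosedEmb f := by
  have hr : Set.range f = S := by
    ext y
    exact ⟨fun ⟨x, hx⟩ => hx ▸ hfS x, fun hy => ⟨s ⟨y, hy⟩, hfs ⟨y, hy⟩⟩⟩
  subst hr
  exact ⟨hf, hS, s, hs, hsf⟩

lemma IsClosedEmb.injective {X Y : Variety} {f : X → Y} (hf : IsClosedEmb f) :
    Function.Injective f := by
  obtain ⟨_, hc, s, _, hs⟩ := hf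
  intro x y h
  rw [← hs x, ← hs y]
  exact congrArg s (Subtype.ext h)

/-! ### Induced pairs -/

/-- The closed embedding `j` of `V.X` in `Z.X`, equivariant along `φ`, exhibits `Z` as the pair
induced from `V`: the translates of its image cover `Z.X`, and two of them meet only if they
differ by an element of the image of `φ`. An isomorphism of pairs is the special case in which
`φ` and `j` are bijective. -/
structure IsInductionMap (Z V : GVariety) (φ : V.G →* Z.G) (j : V.X → Z.X) : Prop where
  emb : IsClosedEmb j
  injective : Function.Injective φ
  map_smul : ∀ (g : V.G) (x : V.X), j (g • x) = φ g • j x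
  mem_range : ∀ (h : Z.G) (x x' : V.X), h • j x = j x' → ∃ g, φ g = h
  cover : ∀ z, ∃ (h : Z.G) (x : V.X), h • j x = z

namespace IsInductionMap

variable {Z V : GVariety} {φ : V.G →* Z.G} {j : V.X → Z.X}

/-- The quotient map from `Z.G × V.X` to `Z.X` is `(h, x) ↦ h • j x`. -/
lemma isInduced (H : IsInductionMap Z V φ j) : Z.IsInduced V φ := by
  have hj := H.emb.injective
  refine ⟨H.injective, fun h x => h • j x, fun h h' x x' => ⟨fun e => ?_, ?_⟩, H.cover,
    fun h₀ h x => (mul_smul _ _ _).symm, fun h => ?_⟩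
  · have e' : (h'⁻¹ * h) • j x = j x' := by
      rw [mul_smul, show h • j x = h' • j x' from e, inv_smul_smul]
    obtain ⟨g, hg⟩ := H.mem_range _ _ _ e'
    refine ⟨g⁻¹, by rw [map_inv, hg]; group, hj ?_⟩
    rw [inv_inv, H.map_smul, hg, e']
  · rintro ⟨g, rfl, rfl⟩
    dsimp only
    rw [H.map_smul, map_inv, mul_smul, smul_inv_smul]
  · obtain ⟨hr, hc, s, hs, hsj⟩ := H.emb
    have hjs : ∀ z (hz : z ∈ Set.range j), j (s ⟨z, hz⟩) = z := by
      rintro _ ⟨x, rfl⟩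
      rw [hsj]
    have hC : IsClosed ((fun z : Z.X => h⁻¹ • z) ⁻¹' Set.range j) :=
      hc.preimage (Z.regular h⁻¹).continuous
    refine IsClosedEmb.of_inverse ((Z.regular h).comp hr) hC
      (fun x => ⟨x, (inv_smul_smul h _).symm⟩) (fun z => s ⟨h⁻¹ • z.1, z.2⟩) ?_ (fun x => ?_)
      (fun z => ?_)
    · exact hs.comp ((Z.regular h⁻¹).restrict hC.isLocallyClosed hc.isLocallyClosed
        fun z hz => hz)
    · rw [← hsj x]
      exact congrArg s (Subtype.ext (by dsimp only; rw [inv_smul_smul, hsj]))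
    · rw [smul_eq_iff_eq_inv_smul]
      exact hjs _ z.2

lemma cls_eq (H : IsInductionMap Z V φ j) : cls Z = cls V := cls_induced φ H.isInduced

/-- An invariant subvariety of an induced pair is induced. -/
lemma restrict (H : IsInductionMap Z V φ j) {S : Set Z.X} (hS : IsLocallyClosed S)
    (h : ∀ (g : Z.G), ∀ x ∈ S, g • x ∈ S) (hT : IsLocallyClosed (j ⁻¹' S))
    (h' : ∀ (g : V.G), ∀ x ∈ j ⁻¹' S, g • x ∈ j ⁻¹' S) :
    IsInductionMap (Z.sub S hS h) (V.sub (j ⁻¹' S) hT h') φ (fun x => ⟨j x.1, x.2⟩) where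
  emb := by
    have hj := H.emb.injective
    obtain ⟨hr, hc, s, hs, hsj⟩ := H.emb
    have hC : IsClosed (X := (Z.X.sub S hS).carrier) (Subtype.val ⁻¹' Set.range j) :=
      hc.preimage (isRegular_val Z.X S hS).continuous
    have hjs : ∀ z (hz : z ∈ Set.range j), j (s ⟨z, hz⟩) = z := by
      rintro _ ⟨x, rfl⟩
      rw [hsj]
    refine IsClosedEmb.of_inverse (X := V.X.sub _ hT) (Y := Z.X.sub S hS)
      (hr.restrict hT hS fun x hx => hx) hC (fun x => ⟨x.1, rfl⟩)
      (fun y => ⟨s ⟨y.1.1, y.2⟩, ?_⟩) ?_ (fun x => Subtype.ext (hsj x.1))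
      (fun y => Subtype.ext (hjs _ y.2))
    · exact (congrArg (· ∈ S) (hjs _ y.2)).mpr y.1.2
    · refine hs.comp (X := (Z.X.sub S hS).sub _ hC.isLocallyClosed)
        (Y := Z.X.sub _ hc.isLocallyClosed) (f := fun y => ⟨y.1.1, y.2⟩) ?_
      exact (isRegular_val Z.X S hS).comp (isRegular_val (Z.X.sub S hS) _ hC.isLocallyClosed)
  injective := H.injective
  map_smul := fun g x => Subtype.ext (H.map_smul g x.1)
  mem_range := fun h x x' e => H.mem_range h x.1 x'.1 (congrArg Subtype.val e)
  cover := fun z => by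
    obtain ⟨h₀, x, hx⟩ := H.cover z.1
    refine ⟨h₀, ⟨x, ?_⟩, Subtype.ext hx⟩
    have := h h₀⁻¹ z.1 z.2
    rwa [← hx, inv_smul_smul] at this

end IsInductionMap

namespace GVariety

lemma IsInduced.exists_inductionMap {Z V : GVariety} {φ : V.G →* Z.G} (H : Z.IsInduced V φ) :
    ∃ j, IsInductionMap Z V φ j := by
  obtain ⟨hφ, q, h1, h2, h3, h4⟩ := H
  have hq : ∀ h x, h • q 1 x = q h x := fun h x => by rw [h3, mul_one]
  refine ⟨q 1, h4 1, hφ, fun g x => ?_, fun h x x' e => ?_, fun z => ?_⟩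
  · rw [hq]
    exact (h1 _ _ _ _).2 ⟨g, by simp, by simp⟩
  · rw [hq] at e
    obtain ⟨g, hg, -⟩ := (h1 _ _ _ _).1 e
    exact ⟨g⁻¹, by rw [map_inv]; exact inv_eq_of_mul_eq_one_left hg.symm⟩
  · obtain ⟨h, x, hx⟩ := h2 z
    exact ⟨h, x, by rw [hq, hx]⟩

lemma Isomorphic.exists_inductionMap {Z V : GVariety} (H : V.Isomorphic Z) :
    ∃ (φ : V.G →* Z.G) (j : V.X → Z.X), IsInductionMap Z V φ j := by
  obtain ⟨ψ, φ, h1, h2, h3⟩ := H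
  refine ⟨φ.toMonoidHom, ψ, ?_, φ.injective, h3, fun h _ _ _ => ⟨φ.symm h, φ.apply_symm_apply h⟩,
    fun z => ⟨1, ψ.symm z, by simp⟩⟩
  exact IsClosedEmb.of_inverse h1 isClosed_univ (fun _ => trivial) (fun z => ψ.symm z.1)
    (h2.comp (isRegular_val Z.X _ _)) (fun x => ψ.symm_apply_apply x)
    (fun z => ψ.apply_symm_apply z.1)

end GVariety

/-- To respect the relations of `K0`, a function of pairs has only to be invariant under induction
(which includes isomorphisms) and additive. -/
lemma lift_eq_zero_of_rel {A : Type*} [AddCommGroup A] (f : GVariety → A)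
    (hind : ∀ (Z V : GVariety) (φ : V.G →* Z.G) (j : V.X → Z.X), IsInductionMap Z V φ j → f Z = f V)
    (hadd : ∀ (V : GVariety) (Y : Set V.X) (hY : IsClosed Y)
      (h : ∀ (g : V.G), ∀ x ∈ Y, g • x ∈ Y), f V = f (V.sub Y hY.isLocallyClosed h) +
        f (V.sub Yᶜ hY.isOpen_compl.isLocallyClosed (V.compl_invariant h)))
    (x : FreeAbelianGroup GVariety) (hx : GrothendieckRel x) : FreeAbelianGroup.lift f x = 0 := by
  obtain ⟨V, W, h⟩ | ⟨V, Y, hY, h⟩ | ⟨Z, V, φ, h⟩ := hx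
  · obtain ⟨φ, j, H⟩ := h.exists_inductionMap
    simp [hind _ _ _ _ H]
  · simpa [sub_eq_zero] using hadd V Y hY h
  · obtain ⟨j, H⟩ := h.exists_inductionMap
    simp [hind _ _ _ _ H]

/-! ### Cutting a pair into pieces -/

lemma cls_sub_congr (V : GVariety) {S T : Set V.X} (e : S = T) (hS : IsLocallyClosed S)
    (h : ∀ (g : V.G), ∀ x ∈ S, g • x ∈ S) (hT : IsLocallyClosed T)
    (h' : ∀ (g : V.G), ∀ x ∈ T, g • x ∈ T) : cls (V.sub S hS h) = cls (V.sub T hT h') := by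
  subst e
  rfl

lemma isomorphic_sub_sub (V : GVariety) {S C R : Set V.X} (hS : IsLocallyClosed S)
    (h : ∀ (g : V.G), ∀ x ∈ S, g • x ∈ S) (hR : IsLocallyClosed R)
    (h' : ∀ (g : V.G), ∀ x ∈ R, g • x ∈ R) (hRC : R = S ∩ C)
    (hC : IsLocallyClosed (X := (V.X.sub S hS).carrier) (Subtype.val ⁻¹' C))
    (hC' : ∀ (g : (V.sub S hS h).G), ∀ x ∈ (Subtype.val ⁻¹' C : Set (V.sub S hS h).X),
      g • x ∈ (Subtype.val ⁻¹' C : Set (V.sub S hS h).X)) :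
    (V.sub R hR h').Isomorphic ((V.sub S hS h).sub (Subtype.val ⁻¹' C) hC hC') := by
  subst hRC
  refine ⟨⟨fun x => ⟨⟨x.1, x.2.1⟩, x.2.2⟩, fun y => ⟨y.1.1, y.1.2, y.2⟩, fun _ => rfl,
    fun _ => rfl⟩, MulEquiv.refl _, ?_, ?_, fun _ _ => rfl⟩
  · exact isRegular_val V.X _ hR
  · exact (isRegular_val V.X S hS).comp (isRegular_val (V.X.sub S hS) _ hC)

lemma cls_sub_eq_add (V : GVariety) {S C R R' : Set V.X} (hS : IsLocallyClosed S)
    (h : ∀ (g : V.G), ∀ x ∈ S, g • x ∈ S) (hC : IsClosed C)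
    (hCi : ∀ (g : V.G), ∀ x ∈ C, g • x ∈ C) (hR : IsLocallyClosed R)
    (hRi : ∀ (g : V.G), ∀ x ∈ R, g • x ∈ R) (hR' : IsLocallyClosed R')
    (hRi' : ∀ (g : V.G), ∀ x ∈ R', g • x ∈ R') (e : R = S ∩ C) (e' : R' = S ∩ Cᶜ) :
    cls (V.sub S hS h) = cls (V.sub R hR hRi) + cls (V.sub R' hR' hRi') := by
  have hcl : IsClosed (X := (V.X.sub S hS).carrier) (Subtype.val ⁻¹' C) :=
    hC.preimage (isRegular_val V.X S hS).continuous
  rw [cls_scissor (V.sub S hS h) (Subtype.val ⁻¹' C) hcl (fun g x hx => hCi g x.1 hx)]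
  exact congrArg₂ (· + ·) (cls_iso (isomorphic_sub_sub V hS h hR hRi e _ _)).symm
    (cls_iso (isomorphic_sub_sub V hS h hR' hRi' e' hcl.isOpen_compl.isLocallyClosed _)).symm

lemma cls_sub_univ (V : GVariety) :
    cls (V.sub Set.univ isClosed_univ.isLocallyClosed fun _ _ _ => trivial) = cls V :=
  cls_iso ⟨Equiv.Set.univ _, MulEquiv.refl _,
    isRegular_val V.X Set.univ isClosed_univ.isLocallyClosed, isRegular_id V.X, fun _ _ => rfl⟩

/-- An empty pair may be cut into two pieces each of which is the pair itself. -/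
lemma cls_eq_zero_of_isEmpty (V : GVariety) [IsEmpty V.X] : cls V = 0 := by
  have h := cls_sub_eq_add V (S := Set.univ) (C := Set.univ) (R := Set.univ) (R' := Set.univ)
    isClosed_univ.isLocallyClosed (fun _ _ _ => trivial) isClosed_univ (fun _ _ _ => trivial)
    isClosed_univ.isLocallyClosed (fun _ _ _ => trivial) isClosed_univ.isLocallyClosed
    (fun _ _ _ => trivial) (Set.eq_univ_of_univ_subset (by simp)).symm (Subsingleton.elim _ _)
  rw [cls_sub_univ] at h
  simpa using h

lemma isLocallyClosed_stratum {T : Type} [TopologicalSpace T] {f : T → ℕ}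
    (hf : ∀ k, IsClosed {x | k ≤ f x}) (k : ℕ) : IsLocallyClosed {x | f x = k} := by
  have : {x | f x = k} = {x | k ≤ f x} ∩ {x | k + 1 ≤ f x}ᶜ := by
    ext x
    simp only [Set.mem_ofPred_eq, Set.mem_inter_iff, Set.mem_compl_iff]
    omega
  rw [this]
  exact (hf k).isLocallyClosed.inter (hf (k + 1)).isOpen_compl.isLocallyClosed

/-- Cutting a pair along an upper semicontinuous invariant function. -/
lemma cls_eq_sum_strata (V : GVariety) (f : V.X → ℕ) (hf : ∀ k, IsClosed {x | k ≤ f x})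
    (hinv : ∀ (g : V.G) (x : V.X), f (g • x) = f x) {N : ℕ} (hN : ∀ x, f x < N) :
    cls V = ∑ k ∈ Finset.range N, cls (V.sub {x | f x = k} (isLocallyClosed_stratum hf k)
      fun g x hx => (hinv g x).trans hx) := by
  have inv : ∀ k (g : V.G), ∀ x ∈ {x | k ≤ f x}, g • x ∈ {x | k ≤ f x} := fun k g x hx =>
    hx.trans_eq (hinv g x).symm
  have key : ∀ M, cls V = (∑ k ∈ Finset.range M, cls (V.sub {x | f x = k}
      (isLocallyClosed_stratum hf k) fun g x hx => (hinv g x).trans hx)) +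
      cls (V.sub {x | M ≤ f x} (hf M).isLocallyClosed (inv M)) := by
    intro M
    induction M with
    | zero =>
      rw [Finset.sum_range_zero, zero_add, ← cls_sub_univ V]
      exact cls_sub_congr V (by simp) _ _ _ _
    | succ M ih =>
      rw [ih, Finset.sum_range_succ, add_assoc]
      congr 1
      rw [add_comm]
      refine cls_sub_eq_add V _ _ (hf (M + 1)) (inv (M + 1)) _ _ _ _ ?_ ?_ <;>
      · ext x
        simp only [Set.mem_ofPred_eq, Set.mem_inter_iff, Set.mem_compl_iff]
        omega
  have : IsEmpty (V.sub {x | N ≤ f x} (hf N).isLocallyClosed (inv N)).X :=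
    ⟨fun x => absurd x.2 (not_le.2 (hN x.1))⟩
  rw [key N, cls_eq_zero_of_isEmpty (V.sub {x | N ≤ f x} (hf N).isLocallyClosed (inv N)), add_zero]

/-- Cutting a pair into finitely many invariant closed pieces. -/
lemma cls_eq_sum_fibers {ι : Type} [Fintype ι] (V : GVariety) (f : V.X → ι)
    (hf : ∀ i, IsClosed {x | f x = i}) (hinv : ∀ (g : V.G) (x : V.X), f (g • x) = f x) :
    cls V = ∑ i, cls (V.sub {x | f x = i} (hf i).isLocallyClosed
      fun g x hx => (hinv g x).trans hx) := by
  have e := Fintype.equivFin ι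
  have hcl : ∀ k, IsClosed {x | k ≤ (e (f x) : ℕ)} := fun k => by
    have : {x | k ≤ (e (f x) : ℕ)} = ⋃ i ∈ {i | k ≤ (e i : ℕ)}, {x | f x = i} := by
      ext x
      simp
    rw [this]
    exact (Set.toFinite _).isClosed_biUnion fun i _ => hf i
  rw [cls_eq_sum_strata V (fun x => (e (f x) : ℕ)) hcl (fun g x => by rw [hinv])
    (fun x => (e (f x)).2), Finset.sum_range]
  refine (Fintype.sum_equiv e _ _ fun i => cls_sub_congr V ?_ _ _ _ _).symm
  ext x
  simp [Fin.val_inj]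

open GVariety

/-! ### Elements and homomorphisms of wreath products -/

section Wreath

variable {G H : Type} [Group G] [Group H] {n a b m r : ℕ}

/-- The element of `G` by which `w` moves the `i`-th factor to the factor with index `w.right i`;
the field `w.left` is indexed by the target instead. -/
def fiberElt (w : Wreath G n) (i : Fin n) : G := w.left (w.right i)

/-- The element of the wreath product with given permutation `σ` which moves the `i`-th factor
by `l i`. -/
def mkWreath (σ : Equiv.Perm (Fin n)) (l : Fin n → G) : Wreath G n :=
  ⟨fun i => l (σ.symm i), σ⟩

@[simp] lemma right_mkWreath (σ : Equiv.Perm (Fin n)) (l : Fin n → G) :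
    (mkWreath σ l).right = σ := rfl

@[simp] lemma fiberElt_mkWreath (σ : Equiv.Perm (Fin n)) (l : Fin n → G) (i : Fin n) :
    fiberElt (mkWreath σ l) i = l i := by
  simp [fiberElt, mkWreath]

lemma fiberElt_mul (w w' : Wreath G n) (i : Fin n) :
    fiberElt (w * w') i = fiberElt w (w'.right i) * fiberElt w' i := by
  change w.left (w.right (w'.right i)) *
    w'.left (w.right.symm (w.right (w'.right i))) = _
  rw [Equiv.symm_apply_apply]
  rfl

@[simp] lemma fiberElt_one (i : Fin n) : fiberElt (1 : Wreath G n) i = 1 := rfl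

lemma wreath_ext {w w' : Wreath G n} (h : ∀ i, w.right i = w'.right i)
    (h' : ∀ i, fiberElt w i = fiberElt w' i) : w = w' := by
  have hr : w.right = w'.right := Equiv.ext h
  refine SemidirectProduct.ext (funext fun i => ?_) hr
  obtain ⟨k, rfl⟩ := w.right.surjective i
  rw [← fiberElt, h' k, fiberElt, hr]

/-- The homomorphism of wreath products given by a homomorphism of the base groups. -/
def wreathMap (n : ℕ) (φ : G →* H) : Wreath G n →* Wreath H n :=
  MonoidHom.mk' (fun w => mkWreath w.right fun i => φ (fiberElt w i)) fun w w' =>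
    wreath_ext (fun i => rfl) fun i => by simp [fiberElt_mul]

@[simp] lemma right_wreathMap (φ : G →* H) (w : Wreath G n) :
    (wreathMap n φ w).right = w.right := rfl

@[simp] lemma fiberElt_wreathMap (φ : G →* H) (w : Wreath G n) (i : Fin n) :
    fiberElt (wreathMap n φ w) i = φ (fiberElt w i) := by
  simp [wreathMap]

lemma wreathMap_injective {φ : G →* H} (hφ : Function.Injective φ) :
    Function.Injective (wreathMap n φ) := fun w w' h =>
  wreath_ext (fun i => by rw [← right_wreathMap φ w, h, right_wreathMap])
    fun i => hφ (by rw [← fiberElt_wreathMap, h, fiberElt_wreathMap])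

lemma exists_wreathMap_eq {φ : G →* H} {w : Wreath H n} (h : ∀ i, ∃ g, φ g = fiberElt w i) :
    ∃ v, wreathMap n φ v = w := by
  choose l hl using h
  exact ⟨mkWreath w.right l, wreath_ext (fun i => rfl) fun i => by simp [hl]⟩

/-- The embedding of `G_a × G_b` in `G_n` for a decomposition `e` of the set of indices. -/
def sumWreath (e : Fin a ⊕ Fin b ≃ Fin n) : Wreath G a × Wreath G b →* Wreath G n :=
  MonoidHom.mk' (fun p => mkWreath (e.permCongr (Equiv.sumCongr p.1.right p.2.right))
    fun i => Sum.elim (fiberElt p.1) (fiberElt p.2) (e.symm i)) fun p p' => by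
    refine wreath_ext (fun i => ?_) fun i => ?_ <;> obtain ⟨i | i, rfl⟩ := e.surjective i <;>
    simp [Equiv.permCongr_apply, fiberElt_mul]

section

variable (e : Fin a ⊕ Fin b ≃ Fin n) (p : Wreath G a × Wreath G b)

@[simp] lemma right_sumWreath_inl (i : Fin a) :
    (sumWreath e p).right (e (.inl i)) = e (.inl (p.1.right i)) := by
  simp [sumWreath, Equiv.permCongr_apply]

@[simp] lemma right_sumWreath_inr (i : Fin b) :
    (sumWreath e p).right (e (.inr i)) = e (.inr (p.2.right i)) := by
  simp [sumWreath, Equiv.permCongr_apply]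

@[simp] lemma fiberElt_sumWreath_inl (i : Fin a) :
    fiberElt (sumWreath e p) (e (.inl i)) = fiberElt p.1 i := by
  simp [sumWreath]

@[simp] lemma fiberElt_sumWreath_inr (i : Fin b) :
    fiberElt (sumWreath e p) (e (.inr i)) = fiberElt p.2 i := by
  simp [sumWreath]

end

lemma sumWreath_injective (e : Fin a ⊕ Fin b ≃ Fin n) :
    Function.Injective (sumWreath (G := G) e) := fun p p' h => by
  refine Prod.ext (wreath_ext (fun i => ?_) fun i => ?_) (wreath_ext (fun i => ?_) fun i => ?_)
  · simpa [h] using (right_sumWreath_inl e p i).symm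
  · simpa [h] using (fiberElt_sumWreath_inl e p i).symm
  · simpa [h] using (right_sumWreath_inr e p i).symm
  · simpa [h] using (fiberElt_sumWreath_inr e p i).symm

/-- The image of `sumWreath` consists of the elements which preserve the decomposition. -/
lemma exists_sumWreath_eq (e : Fin a ⊕ Fin b ≃ Fin n) {w : Wreath G n}
    (h : ∀ i, ∃ i', w.right (e (.inl i)) = e (.inl i')) : ∃ p, sumWreath e p = w := by
  obtain ⟨⟨σ, τ⟩, hs⟩ := Equiv.Perm.mem_sumCongrHom_range_of_perm_mapsTo_inl
    (σ := e.symm.permCongr w.right) (by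
      rintro _ ⟨i, rfl⟩
      obtain ⟨i', hi'⟩ := h i
      exact ⟨i', by simp [Equiv.permCongr_apply, hi']⟩)
  have hs' : ∀ j, w.right (e j) = e (Equiv.sumCongr σ τ j) := fun j => by
    have := Equiv.congr_fun hs j
    simp only [Equiv.Perm.sumCongrHom_apply, Equiv.permCongr_apply, Equiv.symm_symm] at this
    rw [Equiv.eq_symm_apply] at this
    exact this.symm
  refine ⟨(mkWreath σ fun i => fiberElt w (e (.inl i)),
    mkWreath τ fun i => fiberElt w (e (.inr i))),
    wreath_ext (fun j => ?_) fun j => ?_⟩ <;> obtain ⟨i | i, rfl⟩ := e.surjective j <;>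
    simp [hs']

/-- The embedding of `(G ≀ S_r) ≀ S_m` in `G_n` for a decomposition `e` of the set of indices in
`m` blocks of size `r`. -/
def blockWreath (e : Fin m × Fin r ≃ Fin n) : Wreath (Wreath G r) m →* Wreath G n :=
  MonoidHom.mk' (fun v => mkWreath
    (e.permCongr (Equiv.prodShear v.right fun k => (fiberElt v k).right))
    fun i => fiberElt (fiberElt v (e.symm i).1) (e.symm i).2) fun v v' => by
    refine wreath_ext (fun i => ?_) fun i => ?_ <;> obtain ⟨⟨k, i⟩, rfl⟩ := e.surjective i <;>
    simp [Equiv.permCongr_apply, fiberElt_mul]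

section

variable (e : Fin m × Fin r ≃ Fin n) (v : Wreath (Wreath G r) m) (k : Fin m) (i : Fin r)

@[simp] lemma right_blockWreath :
    (blockWreath e v).right (e (k, i)) = e (v.right k, (fiberElt v k).right i) := by
  simp [blockWreath, Equiv.permCongr_apply]

@[simp] lemma fiberElt_blockWreath :
    fiberElt (blockWreath e v) (e (k, i)) = fiberElt (fiberElt v k) i := by
  simp [blockWreath]

end

lemma blockWreath_injective [NeZero r] (e : Fin m × Fin r ≃ Fin n) :
    Function.Injective (blockWreath (G := G) e) := fun v v' h => by
  have h1 : ∀ k i, v.right k = v'.right k ∧ (fiberElt v k).right i = (fiberElt v' k).right i :=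
    fun k i => by simpa [h] using (right_blockWreath e v k i).symm
  refine wreath_ext (fun k => (h1 k 0).1) fun k => wreath_ext (fun i => (h1 k i).2) fun i => ?_
  simpa [h] using (fiberElt_blockWreath e v k i).symm

/-- The image of `blockWreath` consists of the elements which map blocks to blocks. -/
lemma exists_blockWreath_eq [NeZero r] (e : Fin m × Fin r ≃ Fin n) {w : Wreath G n}
    (h : ∀ k i i', (e.symm (w.right (e (k, i)))).1 = (e.symm (w.right (e (k, i')))).1) :
    ∃ v, blockWreath e v = w := by
  let τ : Fin m → Fin m := fun k => (e.symm (w.right (e (k, 0)))).1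
  have hτ : Function.Bijective τ := by
    refine Function.Surjective.bijective_of_finite fun k => ?_
    obtain ⟨⟨l, i⟩, hl⟩ := e.surjective (w.right.symm (e (k, 0)))
    exact ⟨l, by simp only [τ]; rw [h l 0 i, hl]; simp⟩
  let π : Fin m → Fin r → Fin r := fun k i => (e.symm (w.right (e (k, i)))).2
  have hwe : ∀ k i, w.right (e (k, i)) = e (τ k, π k i) := fun k i => by
    rw [← Equiv.symm_apply_eq]
    exact Prod.ext (h k i 0) rfl
  have hπ : ∀ k, Function.Bijective (π k) := fun k => by
    refine Function.Injective.bijective_of_finite fun i i' hi => ?_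
    have : w.right (e (k, i)) = w.right (e (k, i')) := by rw [hwe, hwe, hi]
    simpa using this
  refine ⟨mkWreath (Equiv.ofBijective τ hτ) fun k =>
    mkWreath (Equiv.ofBijective (π k) (hπ k)) fun i => fiberElt w (e (k, i)),
    wreath_ext (fun j => ?_) fun j => ?_⟩ <;> obtain ⟨⟨k, i⟩, rfl⟩ := e.surjective j <;>
  simp [hwe]

end Wreath

/-! ### Cartesian powers -/

lemma pow_smul_apply (V : GVariety) {n : ℕ} (w : (V.pow n).G) (x : (V.pow n).X) (i : Fin n) :
    (w • x : (V.pow n).X) (w.right i) = fiberElt (G := V.G) w i • x i := by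
  change w.left (w.right i) • x (w.right.symm (w.right i)) = _
  rw [Equiv.symm_apply_apply]
  rfl

lemma pow_smul_eq_iff (V : GVariety) {n : ℕ} (w : (V.pow n).G) (x y : (V.pow n).X) :
    w • x = y ↔ ∀ i : Fin n, fiberElt (G := V.G) w i • x i = y (w.right i) := by
  constructor
  · rintro rfl i
    exact (pow_smul_apply V w x i).symm
  · intro h
    funext i
    obtain ⟨k, rfl⟩ := w.right.surjective i
    exact (pow_smul_apply V w x k).trans (h k)

/-- Cartesian powers of an induced pair are induced. -/
lemma IsInductionMap.pow {Z V : GVariety} {φ : V.G →* Z.G} {j : V.X → Z.X}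
    (H : IsInductionMap Z V φ j) (n : ℕ) :
    IsInductionMap (Z.pow n) (V.pow n) (wreathMap n φ) (fun x i => j (x i)) where
  emb := by
    obtain ⟨hr, hc, s, hs, hsj⟩ := H.emb
    have hjs : ∀ z (hz : z ∈ Set.range j), j (s ⟨z, hz⟩) = z := by
      rintro _ ⟨x, rfl⟩
      rw [hsj]
    have hC : IsClosed (X := (Z.X.pow n).carrier) (⋂ i, (fun z => z i) ⁻¹' Set.range j) :=
      isClosed_iInter fun i => hc.preimage (isRegular_proj Z.X i).continuous
    refine IsClosedEmb.of_inverse (X := V.X.pow n) (Y := Z.X.pow n)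
      (IsRegular.tuple fun i => hr.comp (isRegular_proj V.X i)) hC
      (fun x => Set.mem_iInter.2 fun i => ⟨x i, rfl⟩)
      (fun z i => s ⟨z.1 i, Set.mem_iInter.1 z.2 i⟩) (IsRegular.tuple fun i => hs.comp ?_)
      (fun x => funext fun i => hsj (x i)) (fun z => funext fun i => hjs _ _)
    exact (isRegular_proj Z.X i).comp (isRegular_val (Z.X.pow n) _ hC.isLocallyClosed)
  injective := wreathMap_injective H.injective
  map_smul := fun w x => ((pow_smul_eq_iff Z _ _ _).2 fun i => by
    have h := (pow_smul_eq_iff V w x _).1 rfl i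
    refine Eq.trans ?_ (congrArg j h)
    rw [H.map_smul]
    exact congrArg (· • j (x i)) (fiberElt_wreathMap φ w i)).symm
  mem_range := fun w x x' e => exists_wreathMap_eq fun i =>
    H.mem_range _ _ _ ((pow_smul_eq_iff Z w _ _).1 e i)
  cover := fun z => by
    choose h x hx using fun i => H.cover (z i)
    exact ⟨mkWreath 1 h, x, (pow_smul_eq_iff Z _ _ _).2 fun i =>
      (congrArg (· • j (x i)) (fiberElt_mkWreath 1 h i)).trans (hx i)⟩

/-! ### Decomposition along a marking of the indices -/

/-- Data for cutting an action of `G_n`: in each point `x` some indices are marked, the set `A x` of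
marked indices moves with `x`, and it is a closed condition that a given index is marked. -/
structure IsMarking {G : Type} [Group G] {n : ℕ} (E : GVariety) (ρ : E.G ≃* Wreath G n)
    (A : E.X → Finset (Fin n)) : Prop where
  mem_smul_iff : ∀ (g : E.G) (x : E.X) (i : Fin n), (ρ g).right i ∈ A (g • x) ↔ i ∈ A x
  isClosed : ∀ i, IsClosed {x | i ∈ A x}

namespace IsMarking

variable {G : Type} [Group G] {n : ℕ} {E : GVariety} {ρ : E.G ≃* Wreath G n}
  {A : E.X → Finset (Fin n)}

lemma card_smul (H : IsMarking E ρ A) (g : E.G) (x : E.X) : (A (g • x)).card = (A x).card := by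
  rw [← Finset.card_map (ρ g).right.toEmbedding (s := A x)]
  congr 1
  ext i
  obtain ⟨k, rfl⟩ := (ρ g).right.surjective i
  rw [H.mem_smul_iff]
  simp

lemma isClosed_card (H : IsMarking E ρ A) (k : ℕ) : IsClosed {x | k ≤ (A x).card} := by
  have : {x | k ≤ (A x).card} = ⋃ B ∈ {B : Finset (Fin n) | B.card = k},
      ⋂ i ∈ B, {x | i ∈ A x} := by
    ext x
    simp only [Set.mem_ofPred_eq, Set.mem_iUnion, Set.mem_iInter, exists_prop]
    exact ⟨fun h => (Finset.exists_subset_card_eq h).imp fun B hB => ⟨hB.2, hB.1⟩,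
      fun ⟨B, hB, hBA⟩ => hB ▸ Finset.card_le_card hBA⟩
  rw [this]
  exact (Set.toFinite _).isClosed_biUnion fun B _ => isClosed_biInter fun i _ => H.isClosed i

/-- The points with `a` marked indices. -/
def stratum (H : IsMarking E ρ A) (a : ℕ) : GVariety :=
  E.sub {x | (A x).card = a} (isLocallyClosed_stratum H.isClosed_card a)
    fun g x hx => (H.card_smul g x).trans hx

lemma cls_eq_sum_stratum (H : IsMarking E ρ A) :
    cls E = ∑ p ∈ Finset.HasAntidiagonal.antidiagonal n, cls (H.stratum p.1) := by
  rw [cls_eq_sum_strata E (fun x => (A x).card) H.isClosed_card H.card_smul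
    (N := n + 1) (fun x => Nat.lt_succ_of_le ((Finset.card_le_univ _).trans_eq (by simp))),
    Finset.Nat.sum_antidiagonal_eq_sum_range_succ_mk]
  rfl

variable {a b : ℕ} (e : Fin a ⊕ Fin b ≃ Fin n)

/-- The points in which the marked indices are those of the first part of the decomposition `e`. -/
def std (A : E.X → Finset (Fin n)) (e : Fin a ⊕ Fin b ≃ Fin n) : Set E.X :=
  {x | (∀ i, e (.inl i) ∈ A x) ∧ ∀ i, e (.inr i) ∉ A x}

lemma isLocallyClosed_std (H : IsMarking E ρ A) : IsLocallyClosed (std A e) := by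
  have : std A e = (⋂ i, {x | e (.inl i) ∈ A x}) ∩ (⋂ i, {x | e (.inr i) ∈ A x}ᶜ) := by
    ext x
    simp [std]
  rw [this]
  exact (isClosed_iInter fun i => H.isClosed _).isLocallyClosed.inter
    (isOpen_iInter_of_finite fun i => (H.isClosed _).isOpen_compl).isLocallyClosed

lemma mem_std {x : E.X} (hc : (A x).card = a) (h : ∀ i, e (.inl i) ∈ A x) : x ∈ std A e := by
  refine ⟨h, fun i hi => ?_⟩
  have hsub : Finset.univ.map (Function.Embedding.inl.trans e.toEmbedding) ⊆ A x := fun k hk => by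
    obtain ⟨l, -, rfl⟩ := Finset.mem_map.1 hk
    exact h l
  have heq := Finset.eq_of_subset_of_card_le hsub (by simp [hc])
  rw [← heq] at hi
  simp at hi

lemma card_of_mem_std {x : E.X} (hx : x ∈ std A e) : (A x).card = a := by
  have heq : A x = Finset.univ.map (Function.Embedding.inl.trans e.toEmbedding) := by
    ext k
    obtain ⟨l | l, rfl⟩ := e.surjective k
    · simpa using hx.1 l
    · simpa using hx.2 l
  simp [heq]

/-- If the points with standard marking form an `(G_a × G_b)`-variety `F`, then the stratum of
the points with `a` marked indices is induced from `F`. -/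
lemma cls_stratum (H : IsMarking E ρ A) (F : GVariety) (ρF : F.G ≃* Wreath G a × Wreath G b)
    (j : F.X → E.X) (hj : IsRegular j) (hstd : ∀ x, j x ∈ std A e)
    (hsmul : ∀ (g : F.G) (x : F.X), j (g • x) = ρ.symm (sumWreath e (ρF g)) • j x)
    (s : E.X.sub (std A e) (H.isLocallyClosed_std e) → F.X) (hs : IsRegular s)
    (hsj : ∀ x, s ⟨j x, hstd x⟩ = x)
    (hjs : ∀ y : E.X.sub (std A e) (H.isLocallyClosed_std e), j (s y) = y.1) :
    cls (H.stratum a) = cls F := by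
  refine IsInductionMap.cls_eq (Z := H.stratum a)
    (φ := ρ.symm.toMonoidHom.comp ((sumWreath e).comp ρF.toMonoidHom))
    (j := fun x => ⟨j x, card_of_mem_std e (hstd x)⟩) ⟨?_, ?_, ?_, ?_, ?_⟩
  · have hC : IsClosed (X := (H.stratum a).X.carrier)
        (Subtype.val ⁻¹' (⋂ i, {x | e (.inl i) ∈ A x})) :=
      (isClosed_iInter fun i => H.isClosed _).preimage
        (isRegular_val E.X _ (isLocallyClosed_stratum H.isClosed_card a)).continuous
    refine IsClosedEmb.of_inverse (Y := (H.stratum a).X) hj hC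
      (fun x => Set.mem_iInter.2 (hstd x).1)
      (fun y => s ⟨y.1.1, mem_std e y.1.2
        (Set.mem_iInter (s := fun i => {x | e (.inl i) ∈ A x}) |>.1 y.2)⟩)
      (hs.comp ?_) hsj (fun y => Subtype.ext (hjs _))
    exact (isRegular_val E.X _ (isLocallyClosed_stratum H.isClosed_card a)).comp
      (isRegular_val (H.stratum a).X _ hC.isLocallyClosed)
  · exact ρ.symm.injective.comp ((sumWreath_injective e).comp ρF.injective)
  · exact fun g x => Subtype.ext (hsmul g x)
  · intro h x x' hx
    have hx' : (show E.G from h) • j x = j x' := congrArg Subtype.val hx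
    obtain ⟨p, hp⟩ : ∃ p, sumWreath e p = ρ h := exists_sumWreath_eq e fun i => by
      have h1 := (H.mem_smul_iff h _ _).2 ((hstd x).1 i)
      rw [hx'] at h1
      obtain ⟨k | k, hk⟩ := e.surjective ((ρ h).right (e (.inl i)))
      · exact ⟨k, hk.symm⟩
      · rw [← hk] at h1
        exact absurd h1 ((hstd x').2 k)
    refine ⟨ρF.symm p, ?_⟩
    change ρ.symm (sumWreath e (ρF (ρF.symm p))) = h
    rw [ρF.apply_symm_apply, hp]
    exact ρ.symm_apply_apply h
  · rintro ⟨z, hz⟩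
    have hcard : (Finset.univ.map (Function.Embedding.inl.trans e.toEmbedding)).card =
        (A z).card := (show (A z).card = a from hz) ▸ by simp
    -- a permutation which maps the first part of `e` to the set of marked indices
    let σ := (Finset.equivOfCardEq hcard).extendSubtype
    have hσ : ∀ i, σ (e (.inl i)) ∈ A z := fun i =>
      (Finset.equivOfCardEq hcard).extendSubtype_mem _ (by simp)
    let h : E.G := ρ.symm (mkWreath σ 1)
    have hh : (ρ h).right = σ := by simp [h]
    have hy : h⁻¹ • z ∈ std A e := by
      refine mem_std e ((H.card_smul _ _).trans hz) fun i => ?_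
      rw [← H.mem_smul_iff h, smul_inv_smul, hh]
      exact hσ i
    refine ⟨h, s ⟨_, hy⟩, Subtype.ext ?_⟩
    exact (congrArg (h • ·) (hjs ⟨_, hy⟩)).trans (smul_inv_smul h z)

end IsMarking

/-! ### The Kapranov zeta function -/

/-- The index decomposition attached to an element of the antidiagonal. -/
def sumIndexEquiv {n : ℕ} {p : ℕ × ℕ} (hp : p ∈ Finset.HasAntidiagonal.antidiagonal n) :
    Fin p.1 ⊕ Fin p.2 ≃ Fin n :=
  finSumFinEquiv.trans (finCongr (Finset.HasAntidiagonal.mem_antidiagonal.1 hp))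

lemma cls_eq_one_of_unique (V : GVariety) [Unique V.X] [Subsingleton V.G] : cls V = 1 := by
  refine cls_iso (W := GVariety.point) ⟨Equiv.ofUnique V.X Unit, ?_, isRegular_point _,
    isRegular_const default, fun _ _ => rfl⟩
  have : Unique V.G := uniqueOfSubsingleton 1
  exact MulEquiv.ofUnique (M := V.G) (N := Unit)

lemma cls_pow_zero (V : GVariety) : cls (V.pow 0) = 1 := by
  have : Unique (V.pow 0).X := inferInstanceAs (Unique (Fin 0 → V.X))
  have : Subsingleton (V.pow 0).G :=
    ⟨fun w w' => wreath_ext (G := V.G) (fun i => i.elim0) fun i => i.elim0⟩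
  exact cls_eq_one_of_unique _

lemma coeff_kapranovZeta (V : GVariety) (n : ℕ) :
    PowerSeries.coeff n (kapranovZeta V) = cls (V.pow n) := by
  rw [kapranovZeta, PowerSeries.coeff_mk]
  split_ifs with h
  · rw [h, cls_pow_zero]
  · rfl

/-- A point of `X^n` is cut according to the set of indices of its coordinates in `Y`: the points
with `a` of them form the pair induced from the product of a power of `Y` and one of the
complement. -/
lemma kapranovZeta_add (V : GVariety) (Y : Set V.X) (hY : IsClosed Y)
    (h : ∀ (g : V.G), ∀ x ∈ Y, g • x ∈ Y) :
    kapranovZeta V = kapranovZeta (V.sub Y hY.isLocallyClosed h) *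
      kapranovZeta (V.sub Yᶜ hY.isOpen_compl.isLocallyClosed (V.compl_invariant h)) := by
  classical
  ext n
  let A : (V.pow n).X → Finset (Fin n) := fun x => {i | x i ∈ Y}
  have memA : ∀ x i, i ∈ A x ↔ x i ∈ Y := fun x i => by simp [A]
  have H : IsMarking (G := V.G) (V.pow n) (MulEquiv.refl _) A := by
    refine ⟨fun w x i => ?_, fun i => ?_⟩
    · rw [memA, memA]
      have e := (pow_smul_eq_iff V w x _).1 rfl i
      refine (congrArg (· ∈ Y) e).to_iff.symm.trans ⟨fun hx => ?_, h _ _⟩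
      simpa using h (fiberElt (G := V.G) w i)⁻¹ _ hx
    · simp only [memA]
      exact hY.preimage (isRegular_proj V.X i).continuous
  rw [PowerSeries.coeff_mul, coeff_kapranovZeta, H.cls_eq_sum_stratum]
  refine Finset.sum_congr rfl fun p hp => ?_
  rw [coeff_kapranovZeta, coeff_kapranovZeta, cls_mul]
  obtain ⟨a, b⟩ := p
  let e : Fin a ⊕ Fin b ≃ Fin n := sumIndexEquiv hp
  let U := V.sub Y hY.isLocallyClosed h
  let U' := V.sub Yᶜ hY.isOpen_compl.isLocallyClosed (V.compl_invariant h)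
  let j : ((U.pow a).prod (U'.pow b)).X → (V.pow n).X := fun x k =>
    Sum.elim (fun i => (x.1 i).1) (fun i => (x.2 i).1) (e.symm k)
  have jl : ∀ x i, j x (e (.inl i)) = (x.1 i).1 := fun x i => by simp [j]
  have jr : ∀ x i, j x (e (.inr i)) = (x.2 i).1 := fun x i => by simp [j]
  have hval := isRegular_val (V.X.pow n) _ (H.isLocallyClosed_std e)
  refine H.cls_stratum e _ (MulEquiv.refl _) j (IsRegular.tuple fun k => ?_) (fun x => ?_) ?_
    (fun y => ((fun i => ⟨y.1 (e (.inl i)), (memA _ _).1 (y.2.1 i)⟩), fun i =>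
      ⟨y.1 (e (.inr i)), fun hi => y.2.2 i ((memA _ _).2 hi)⟩)) ?_ (fun x => ?_) (fun y => ?_)
  · rcases e.symm k with i | i
    · exact (isRegular_val V.X Y hY.isLocallyClosed).comp ((isRegular_proj U.X i).comp
        (isRegular_fst (U.X.pow a) (U'.X.pow b)))
    · exact (isRegular_val V.X Yᶜ hY.isOpen_compl.isLocallyClosed).comp
        ((isRegular_proj U'.X i).comp (isRegular_snd (U.X.pow a) (U'.X.pow b)))
  · refine ⟨fun i => (memA _ _).2 ?_, fun i hi => ?_⟩
    · rw [jl]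
      exact (x.1 i).2
    · rw [memA, jr] at hi
      exact (x.2 i).2 hi
  · intro g x
    refine ((pow_smul_eq_iff V _ _ _).2 fun k => ?_).symm
    obtain ⟨i | i, rfl⟩ := e.surjective k
    · refine Eq.trans ?_ (congrArg (j (g • x)) (right_sumWreath_inl (G := V.G) e g i)).symm
      rw [jl, jl]
      refine Eq.trans ?_ (congrArg Subtype.val ((pow_smul_eq_iff U g.1 x.1 _).1 rfl i))
      exact congrArg (· • (x.1 i).1) (fiberElt_sumWreath_inl (G := V.G) e g i)
    · refine Eq.trans ?_ (congrArg (j (g • x)) (right_sumWreath_inr (G := V.G) e g i)).symm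
      rw [jr, jr]
      refine Eq.trans ?_ (congrArg Subtype.val ((pow_smul_eq_iff U' g.2 x.2 _).1 rfl i))
      exact congrArg (· • (x.2 i).1) (fiberElt_sumWreath_inr (G := V.G) e g i)
  · exact IsRegular.pair (Y := U.X.pow a) (Z := U'.X.pow b)
      (IsRegular.tuple (Y := U.X) fun i => (isRegular_proj V.X (e (.inl i))).comp hval)
      (IsRegular.tuple (Y := U'.X) fun i => (isRegular_proj V.X (e (.inr i))).comp hval)
  · exact Prod.ext (funext fun i => Subtype.ext (jl x i)) (funext fun i => Subtype.ext (jr x i))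
  · funext k
    obtain ⟨i | i, rfl⟩ := e.surjective k
    · exact jl _ _
    · exact jr _ _

lemma isUnit_kapranovZeta (V : GVariety) : IsUnit (kapranovZeta V) := by
  rw [PowerSeries.isUnit_iff_constantCoeff, ← PowerSeries.coeff_zero_eq_constantCoeff_apply,
    coeff_kapranovZeta, cls_pow_zero]
  exact isUnit_one

/-- The Kapranov zeta function as a homomorphism to the multiplicative group of units. The
invertibility of its values is what extends it to differences of classes. -/
noncomputable def zetaHom : K0 →+ Additive (PowerSeries K0)ˣ :=
  K0.lift (fun V => Additive.ofMul (isUnit_kapranovZeta V).unit) (lift_eq_zero_of_rel _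
    (fun Z V φ j H => congrArg Additive.ofMul (Units.ext (by
      ext n
      rw [IsUnit.unit_spec, IsUnit.unit_spec, coeff_kapranovZeta, coeff_kapranovZeta]
      exact (H.pow n).cls_eq)))
    fun V Y hY h => congrArg Additive.ofMul (Units.ext (kapranovZeta_add V Y hY h)))

lemma IsKapranovZeta.ext {ζ ζ' : K0 → PowerSeries K0} (h : IsKapranovZeta ζ)
    (h' : IsKapranovZeta ζ') : ζ = ζ' := by
  -- The values of such a map are units, `ξ (-a)` being inverse to `ξ a`.
  have key : ∀ ξ : K0 → PowerSeries K0, IsKapranovZeta ξ →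
      ∃ f : K0 →+ Additive (PowerSeries K0)ˣ, ∀ a, (f a).toMul.val = ξ a := fun ξ hξ =>
    ⟨AddMonoidHom.mk' (fun a => Additive.ofMul ⟨ξ a, ξ (-a),
      by rw [← hξ.map_add, add_neg_cancel, hξ.map_zero],
      by rw [← hξ.map_add, neg_add_cancel, hξ.map_zero]⟩)
      fun a b => congrArg Additive.ofMul (Units.ext (hξ.map_add a b)), fun a => rfl⟩
  obtain ⟨f, hf⟩ := key ζ h
  obtain ⟨f', hf'⟩ := key ζ' h'
  have : f = f' := K0.hom_ext fun V => Additive.toMul.injective (Units.ext (by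
    rw [hf, hf', h.map_cls, h'.map_cls]))
  funext a
  rw [← hf, ← hf', this]

theorem existsUnique_isKapranovZeta : ∃! ζ : K0 → PowerSeries K0, IsKapranovZeta ζ := by
  refine ⟨fun a => (zetaHom a).toMul.val, ⟨?_, fun a b => ?_, fun V => ?_⟩,
    fun ζ hζ => hζ.ext ⟨?_, fun a b => ?_, fun V => ?_⟩⟩ <;>
  simp [zetaHom, K0.lift_cls]

/-! ### Inertia varieties -/

namespace GVariety

/-- The pairs `(g, x)` with `g x = x`. -/
def inertiaSet (V : GVariety) : Set ((Variety.discrete V.G).prod V.X).carrier :=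
  {p : V.G × V.X | p.1 • p.2 = p.2}

lemma isClosed_inertiaSet (V : GVariety) : IsClosed V.inertiaSet := by
  have : V.inertiaSet = ⋃ g : V.G, (fun p : (Variety.discrete V.G).prod V.X => p.1) ⁻¹' {g} ∩
      (fun p : (Variety.discrete V.G).prod V.X => p.2) ⁻¹' {x | g • x = x} := by
    ext p
    simp only [Set.mem_iUnion]
    exact ⟨fun hp => ⟨p.1, rfl, hp⟩, fun ⟨g, hg, hp⟩ => by
      obtain rfl : p.1 = g := hg
      exact hp⟩
  rw [this]
  refine isClosed_iUnion_of_finite fun g => IsClosed.inter ?_ ?_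
  · exact (isClosed_discrete (α := (Variety.discrete V.G).carrier) {g}).preimage
      (isRegular_fst (Variety.discrete V.G) V.X).continuous
  · exact ((V.regular g).isClosed_eq (isRegular_id V.X)).preimage
      (isRegular_snd (Variety.discrete V.G) V.X).continuous

lemma smul_mem_inertiaSet (V : GVariety) (h : V.G) (p : V.G × V.X) (hp : p ∈ V.inertiaSet) :
    ((h * p.1 * h⁻¹, h • p.2) : V.G × V.X) ∈ V.inertiaSet := by
  change p.1 • p.2 = p.2 at hp
  change (h * p.1 * h⁻¹) • h • p.2 = h • p.2
  rw [mul_smul, mul_smul, inv_smul_smul, hp]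

/-- The inertia variety: the pairs `(g, x)` with `g x = x`, on which `G` acts by conjugation on `g`
and by the given action on `x`. -/
noncomputable def inertia (V : GVariety) : GVariety where
  X := ((Variety.discrete V.G).prod V.X).sub V.inertiaSet V.isClosed_inertiaSet.isLocallyClosed
  G := V.G
  action :=
    { smul := fun h p => ⟨_, V.smul_mem_inertiaSet h p.1 p.2⟩
      one_smul := fun p => Subtype.ext (Prod.ext
        ((mul_inv_eq_iff_eq_mul (G := V.G)).2 ((one_mul _).trans (mul_one _).symm))
        (one_smul V.G p.1.2))
      mul_smul := fun h h' p => Subtype.ext (Prod.ext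
        ((MulAut.conj_apply (h * h') (p.1.1 : V.G)).symm.trans
          (DFunLike.congr_fun (map_mul MulAut.conj h h') (p.1.1 : V.G)))
        (mul_smul h h' p.1.2)) }
  regular := fun h => by
    refine IsRegular.restrict (X := (Variety.discrete V.G).prod V.X)
      (Y := (Variety.discrete V.G).prod V.X)
      (f := fun p : V.G × V.X => (h * p.1 * h⁻¹, h • p.2)) ?_ _ _ (V.smul_mem_inertiaSet h)
    exact IsRegular.prodMap (X := Variety.discrete V.G) (X' := Variety.discrete V.G)
      (f := fun g : V.G => h * g * h⁻¹)
      (isRegular_discrete_iff (X := Variety.discrete V.G) (F := V.G).2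
        (IsLocallyConstant.of_discrete _)) (V.regular h)

namespace inertia

variable {V : GVariety}

/-- The automorphism of a point of the inertia variety. -/
def elt (p : V.inertia.X) : V.G := p.1.1

/-- The underlying point of a point of the inertia variety. -/
def pt (p : V.inertia.X) : V.X := p.1.2

/-- The point `(g, x)` of the inertia variety. -/
def mk (g : V.G) (x : V.X) (h : g • x = x) : V.inertia.X := ⟨(g, x), h⟩

lemma elt_smul_pt (p : V.inertia.X) : elt p • pt p = pt p := p.2

lemma ext {p q : V.inertia.X} (h : elt p = elt q) (h' : pt p = pt q) : p = q :=
  Subtype.ext (Prod.ext h h')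

noncomputable instance : MulAction V.G V.inertia.X.carrier := V.inertia.action

lemma smul_eq_iff (h : V.G) (p q : V.inertia.X) :
    h • p = q ↔ h * elt p = elt q * h ∧ h • pt p = pt q := by
  constructor
  · rintro rfl
    exact ⟨(inv_mul_cancel_right (G := V.G) _ _).symm, rfl⟩
  · rintro ⟨h1, h2⟩
    exact ext (mul_inv_eq_iff_eq_mul.2 h1) h2

lemma isLocallyConstant_elt : IsLocallyConstant (elt (V := V)) :=
  isRegular_discrete_iff.1 (((isRegular_fst (Variety.discrete V.G) V.X).comp
    (isRegular_val _ _ V.isClosed_inertiaSet.isLocallyClosed)))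

lemma isRegular_pt : IsRegular (X := V.inertia.X) (pt (V := V)) :=
  (isRegular_snd (Variety.discrete V.G) V.X).comp
    (isRegular_val _ _ V.isClosed_inertiaSet.isLocallyClosed)

lemma isRegular_of_elt_pt {Y : Variety} {f : Y → V.inertia.X}
    (h : IsLocallyConstant fun y => elt (f y)) (h' : IsRegular fun y => pt (f y)) : IsRegular f :=
  IsRegular.pair (Y := Variety.discrete V.G) (isRegular_discrete_iff (F := V.G).2 h) h'

end inertia

end GVariety

open GVariety.inertia in
/-- The inertia variety of an induced pair is induced. -/
lemma IsInductionMap.inertia {Z V : GVariety} {φ : V.G →* Z.G} {j : V.X → Z.X}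
    (H : IsInductionMap Z V φ j) : IsInductionMap Z.inertia V.inertia φ
      (fun p => inertia.mk (φ (elt p)) (j (pt p)) (by rw [← H.map_smul, elt_smul_pt])) where
  emb := by
    have hj := H.emb.injective
    obtain ⟨hr, hc, s, hs, hsj⟩ := H.emb
    obtain ⟨ψ, hψ⟩ := H.injective.hasLeftInverse
    have hjs : ∀ z (hz : z ∈ Set.range j), j (s ⟨z, hz⟩) = z := by
      rintro _ ⟨x, rfl⟩
      rw [hsj]
    have hC : IsClosed (elt (V := Z) ⁻¹' Set.range φ ∩ pt ⁻¹' Set.range j) :=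
      IsClosed.inter ⟨isLocallyConstant_elt (Set.range φ)ᶜ⟩
        (hc.preimage isRegular_pt.continuous)
    have hv := isRegular_val Z.inertia.X _ hC.isLocallyClosed
    have hψ' : ∀ g ∈ Set.range φ, φ (ψ g) = g := by
      rintro _ ⟨g, rfl⟩
      rw [hψ]
    refine IsClosedEmb.of_inverse (isRegular_of_elt_pt
      ((isLocallyConstant_elt (V := V)).comp φ) (hr.comp isRegular_pt)) hC
      (fun p => ⟨⟨elt p, rfl⟩, ⟨pt p, rfl⟩⟩)
      (fun q => inertia.mk (ψ (elt q.1)) (s ⟨pt q.1, q.2.2⟩) (hj ?_)) ?_ (fun p => ?_) (fun q => ?_)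
    · rw [H.map_smul, hψ' _ q.2.1, hjs _ q.2.2, elt_smul_pt]
    · exact isRegular_of_elt_pt
        ((hv.isLocallyConstant_comp isLocallyConstant_elt).comp ψ)
        (hs.comp (X := Z.inertia.X.sub _ hC.isLocallyClosed)
          (Y := Z.X.sub _ hc.isLocallyClosed) (f := fun q => ⟨pt q.1, q.2.2⟩)
          (isRegular_pt.comp hv))
    · exact inertia.ext (hψ _) (hsj _)
    · exact inertia.ext (hψ' _ q.2.1) (hjs _ q.2.2)
  injective := H.injective
  map_smul := fun g p => ((inertia.smul_eq_iff _ _ _).2 (by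
    obtain ⟨h1, h2⟩ := (inertia.smul_eq_iff (V := V) g p _).1 rfl
    refine ⟨?_, ?_⟩
    · exact (map_mul φ _ _).symm.trans ((congrArg φ h1).trans (map_mul φ _ _))
    · exact (H.map_smul _ _).symm.trans (congrArg j h2))).symm
  mem_range := fun h p p' e => H.mem_range h _ _ ((inertia.smul_eq_iff _ _ _).1 e).2
  cover := fun q => by
    obtain ⟨h, x, hx⟩ := H.cover (pt q)
    have h1 : (h⁻¹ * elt q * h) • j x = j x := by
      rw [mul_smul, mul_smul, hx, elt_smul_pt, inv_smul_eq_iff, hx]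
    obtain ⟨g, hg⟩ := H.mem_range _ _ _ h1
    refine ⟨h, inertia.mk g x (H.emb.injective ?_), (inertia.smul_eq_iff _ _ _).2 ⟨?_, hx⟩⟩
    · rw [H.map_smul, hg, h1]
    · change h * φ g = elt q * h
      rw [hg]
      group

/-- The inertia variety of an invariant subvariety. -/
lemma isomorphic_inertia_sub (V : GVariety) (S : Set V.X) (hS : IsLocallyClosed S)
    (h : ∀ (g : V.G), ∀ x ∈ S, g • x ∈ S) (hS' : IsLocallyClosed (inertia.pt (V := V) ⁻¹' S))
    (h' : ∀ (g : V.inertia.G), ∀ x ∈ inertia.pt (V := V) ⁻¹' S, g • x ∈ inertia.pt (V := V) ⁻¹' S) :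
    (V.inertia.sub _ hS' h').Isomorphic (V.sub S hS h).inertia := by
  have hv := isRegular_val V.inertia.X _ hS'
  have hv' := isRegular_val V.X S hS
  refine ⟨⟨fun p => inertia.mk (V := V.sub S hS h) (inertia.elt (V := V) p.1)
      ⟨inertia.pt p.1, p.2⟩
      (Subtype.ext (inertia.elt_smul_pt p.1)),
    fun q => ⟨inertia.mk (V := V) (inertia.elt (V := V.sub S hS h) q)
      (inertia.pt (V := V.sub S hS h) q).1
      (congrArg Subtype.val (inertia.elt_smul_pt (V := V.sub S hS h) q)),
      (inertia.pt (V := V.sub S hS h) q).2⟩, fun _ => rfl,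
    fun _ => rfl⟩, MulEquiv.refl _, ?_, ?_, fun _ _ => rfl⟩
  · exact inertia.isRegular_of_elt_pt (V := V.sub S hS h)
      (hv.isLocallyConstant_comp inertia.isLocallyConstant_elt) (inertia.isRegular_pt.comp hv)
  · exact inertia.isRegular_of_elt_pt (V := V)
      (inertia.isLocallyConstant_elt (V := V.sub S hS h))
      (hv'.comp (inertia.isRegular_pt (V := V.sub S hS h)))

lemma cls_inertia_add (V : GVariety) (Y : Set V.X) (hY : IsClosed Y)
    (h : ∀ (g : V.G), ∀ x ∈ Y, g • x ∈ Y) :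
    cls V.inertia = cls (V.sub Y hY.isLocallyClosed h).inertia +
      cls (V.sub Yᶜ hY.isOpen_compl.isLocallyClosed (V.compl_invariant h)).inertia := by
  have hY' : IsClosed (inertia.pt (V := V) ⁻¹' Y) := hY.preimage inertia.isRegular_pt.continuous
  rw [cls_scissor V.inertia _ hY' (fun g x hx => h g _ hx)]
  exact congrArg₂ (· + ·) (cls_iso (isomorphic_inertia_sub V Y _ _ _ _))
    (cls_iso (isomorphic_inertia_sub V Yᶜ _ _ hY'.isOpen_compl.isLocallyClosed _))

lemma isomorphic_inertia_prod (V W : GVariety) :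
    (V.prod W).inertia.Isomorphic (V.inertia.prod W.inertia) := by
  refine ⟨⟨fun p => (inertia.mk (inertia.elt p).1 (inertia.pt p).1
      (congrArg Prod.fst (inertia.elt_smul_pt p)), inertia.mk (inertia.elt p).2 (inertia.pt p).2
      (congrArg Prod.snd (inertia.elt_smul_pt p))),
    fun q => inertia.mk (V := V.prod W) (inertia.elt q.1, inertia.elt q.2)
      (inertia.pt q.1, inertia.pt q.2)
      (Prod.ext (inertia.elt_smul_pt q.1) (inertia.elt_smul_pt q.2)), fun _ => rfl,
    fun _ => rfl⟩, MulEquiv.refl _, ?_, ?_, fun _ _ => rfl⟩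
  · have h1 := inertia.isLocallyConstant_elt (V := V.prod W)
    have h2 := inertia.isRegular_pt (V := V.prod W)
    exact IsRegular.pair (Y := V.inertia.X) (Z := W.inertia.X)
      (inertia.isRegular_of_elt_pt (h1.comp Prod.fst) ((isRegular_fst V.X W.X).comp h2))
      (inertia.isRegular_of_elt_pt (h1.comp Prod.snd) ((isRegular_snd V.X W.X).comp h2))
  · have h1 := isRegular_fst V.inertia.X W.inertia.X
    have h2 := isRegular_snd V.inertia.X W.inertia.X
    exact inertia.isRegular_of_elt_pt (V := V.prod W)
      ((h1.isLocallyConstant_comp inertia.isLocallyConstant_elt).prodMk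
        (h2.isLocallyConstant_comp inertia.isLocallyConstant_elt))
      (IsRegular.pair (Y := V.X) (Z := W.X) (inertia.isRegular_pt.comp h1)
        (inertia.isRegular_pt.comp h2))

/-- The fixed points of the elements of a conjugacy class form a piece of the inertia variety
which is induced from the fixed points of one of them. -/
lemma cls_inertia_eq_sum (V : GVariety) :
    cls V.inertia = ∑ᶠ c : ConjClasses V.G, cls (V.fixed (conjRep c)) := by
  have := Fintype.ofFinite (ConjClasses V.G)
  have hcl : ∀ c : ConjClasses V.G,
      IsClosed {p : V.inertia.X | ConjClasses.mk (inertia.elt p) = c} := fun c =>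
    (inertia.isLocallyConstant_elt.comp ConjClasses.mk).isClosed_fiber c
  have hinv : ∀ (h : V.inertia.G) (p : V.inertia.X),
      ConjClasses.mk (inertia.elt (h • p)) = ConjClasses.mk (inertia.elt p) := fun h p =>
    ConjClasses.mk_eq_mk_iff_isConj.2 (isConj_iff.2 ⟨h, rfl⟩ : IsConj (inertia.elt p) _).symm
  rw [finsum_eq_sum_of_fintype, cls_eq_sum_fibers V.inertia _ hcl hinv]
  refine Finset.sum_congr rfl fun c _ => IsInductionMap.cls_eq
    (φ := (Subgroup.centralizer {conjRep c}).subtype)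
    (j := fun x => ⟨inertia.mk (conjRep c) x.1 x.2, mk_conjRep c⟩) ⟨?_, ?_, ?_, ?_, ?_⟩
  · have hv := isRegular_val V.inertia.X _ (hcl c).isLocallyClosed
    have hC : IsClosed (X := (V.inertia.X.sub _ (hcl c).isLocallyClosed).carrier)
        ((fun p => inertia.elt p.1) ⁻¹' {conjRep c}) :=
      (hv.isLocallyConstant_comp inertia.isLocallyConstant_elt).isClosed_fiber _
    refine IsClosedEmb.of_inverse (Y := V.inertia.X.sub _ (hcl c).isLocallyClosed)
      (inertia.isRegular_of_elt_pt (V := V) (IsLocallyConstant.const _)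
        (isRegular_val V.X _ ((V.regular _).isClosed_eq (isRegular_id V.X)).isLocallyClosed))
      hC (fun x => rfl)
      (fun p => ⟨inertia.pt p.1.1, ?_⟩) ?_ (fun _ => rfl)
      (fun p => Subtype.ext (inertia.ext (show inertia.elt p.1.1 = _ from p.2).symm rfl))
    · exact (congrArg (· • inertia.pt p.1.1) p.2).symm.trans (inertia.elt_smul_pt p.1.1)
    · exact inertia.isRegular_pt.comp (hv.comp (isRegular_val _ _ hC.isLocallyClosed))
  · exact Subtype.val_injective
  · intro g x
    refine Subtype.ext ((inertia.smul_eq_iff _ _ _).2 ⟨?_, rfl⟩).symm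
    exact (Subgroup.mem_centralizer_singleton_iff.1 g.2)
  · intro h x x' e
    have := ((inertia.smul_eq_iff _ _ _).1 (congrArg Subtype.val e)).1
    exact ⟨⟨h, Subgroup.mem_centralizer_singleton_iff.2 this⟩, rfl⟩
  · rintro ⟨p, hp⟩
    obtain ⟨h, hh⟩ := isConj_iff.1
      (ConjClasses.mk_eq_mk_iff_isConj.1 ((mk_conjRep c).trans hp.symm))
    refine ⟨h, ⟨h⁻¹ • inertia.pt p, ?_⟩, Subtype.ext ((inertia.smul_eq_iff _ _ _).2 ⟨?_, ?_⟩)⟩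
    · change conjRep c • h⁻¹ • inertia.pt p = h⁻¹ • inertia.pt p
      rw [eq_inv_smul_iff, ← mul_smul, ← mul_smul, hh, inertia.elt_smul_pt]
    · change h * conjRep c = inertia.elt p * h
      rw [← hh]
      group
    · exact smul_inv_smul h _

/-- The inertia homomorphism, as the homomorphism of abelian groups which takes the class of a pair
to that of its inertia variety. -/
noncomputable def inertiaAddHom : K0 →+ K0 :=
  K0.lift (fun V => cls V.inertia) (lift_eq_zero_of_rel _ (fun _ _ _ _ H => H.inertia.cls_eq)
    cls_inertia_add)

lemma inertiaAddHom_cls (V : GVariety) : inertiaAddHom (cls V) = cls V.inertia := K0.lift_cls _ _ _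

/-- The inertia homomorphism. -/
noncomputable def inertiaHom : K0 →+* K0 where
  toFun := inertiaAddHom
  map_zero' := map_zero _
  map_add' := map_add _
  map_one' := by
    rw [← cls_point, inertiaAddHom_cls]
    have : Unique GVariety.point.inertia.X :=
      ⟨⟨inertia.mk 1 () rfl⟩, fun _ => inertia.ext rfl rfl⟩
    have : Subsingleton GVariety.point.inertia.G := inferInstanceAs (Subsingleton Unit)
    exact cls_eq_one_of_unique _
  map_mul' := by
    refine AddMonoidHom.map_mul_iff _ |>.2 (K0.hom_ext fun V => K0.hom_ext fun W => ?_)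
    simp only [AddMonoidHom.compr₂_apply, AddMonoidHom.compl₂_apply, AddMonoidHom.comp_apply,
      AddMonoidHom.mul_apply, cls_mul, inertiaAddHom_cls]
    exact cls_iso (isomorphic_inertia_prod V W)

lemma inertiaHom_cls (V : GVariety) : inertiaHom (cls V) = cls V.inertia := inertiaAddHom_cls V

lemma isInertiaHom_iff {α : K0 →+* K0} : IsInertiaHom α ↔ α = inertiaHom := by
  constructor
  · intro h
    refine RingHom.ext fun a => DFunLike.congr_fun (f := α.toAddMonoidHom)
      (g := inertiaHom.toAddMonoidHom) (K0.hom_ext fun V => ?_) a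
    exact (h V).trans ((inertiaHom_cls V).trans (cls_inertia_eq_sum V)).symm
  · rintro rfl V
    exact (inertiaHom_cls V).trans (cls_inertia_eq_sum V)

/-! ### Inertia varieties of Cartesian powers, by cycle lengths -/

/-- The elements of the wreath product whose permutation has only cycles with lengths in `T`. -/
def cycleLengthsIn (G : Type) [Group G] (T : Set ℕ) (n : ℕ) : Set (Wreath G n) :=
  {w | ∀ i, Function.minimalPeriod w.right i ∈ T}

lemma minimalPeriod_eq_of_semiconj {A B : Type} {f : A → A} {g : B → B} {u : A → B}
    (hu : Function.Injective u) (h : Function.Semiconj u f g) (a : A) :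
    Function.minimalPeriod g (u a) = Function.minimalPeriod f a := by
  refine Function.minimalPeriod_eq_minimalPeriod_iff.2 fun n => ?_
  simp only [Function.IsPeriodicPt, Function.IsFixedPt, ← (h.iterate_right n).eq, hu.eq_iff]

lemma mem_cycleLengthsIn_of_mul_eq {G : Type} [Group G] {T : Set ℕ} {n : ℕ} {h w w' : Wreath G n}
    (hw : w ∈ cycleLengthsIn G T n) (e : h * w = w' * h) : w' ∈ cycleLengthsIn G T n := fun i => by
  obtain ⟨k, rfl⟩ := h.right.surjective i
  exact (minimalPeriod_eq_of_semiconj h.right.injective (fun l =>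
    Equiv.congr_fun (congrArg SemidirectProduct.right e) l) k).symm ▸ hw k

namespace GVariety

lemma isLocallyClosed_cycInertia (V : GVariety) (T : Set ℕ) (n : ℕ) : IsLocallyClosed
    {p : (V.pow n).inertia.X | inertia.elt p ∈ cycleLengthsIn V.G T n} :=
  IsOpen.isLocallyClosed (inertia.isLocallyConstant_elt (V := V.pow n) (cycleLengthsIn V.G T n))

lemma smul_mem_cycInertia (V : GVariety) (T : Set ℕ) (n : ℕ) (h : (V.pow n).inertia.G)
    (p : (V.pow n).inertia.X) (hp : inertia.elt p ∈ cycleLengthsIn V.G T n) :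
    inertia.elt (h • p) ∈ cycleLengthsIn V.G T n :=
  mem_cycleLengthsIn_of_mul_eq (h := h) (w := inertia.elt p) hp
    ((inertia.smul_eq_iff (V := V.pow n) h p _).1 rfl).1

/-- The points `(w, x)` of the inertia variety of the Cartesian power `X^n` such that the lengths
of the cycles of the permutation underlying `w` lie in `T`. -/
noncomputable def cycInertia (V : GVariety) (T : Set ℕ) (n : ℕ) : GVariety :=
  (V.pow n).inertia.sub {p | inertia.elt p ∈ cycleLengthsIn V.G T n}
    (V.isLocallyClosed_cycInertia T n) (V.smul_mem_cycInertia T n)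

namespace cycInertia

variable {V : GVariety} {T : Set ℕ} {n : ℕ}

/-- The automorphism `w` of the point `(w, x)`. -/
noncomputable def elt (p : (V.cycInertia T n).X) : Wreath V.G n := inertia.elt (V := V.pow n) p.1

/-- The coordinates of the point `x` of `(w, x)`. -/
noncomputable def pt (p : (V.cycInertia T n).X) (i : Fin n) : V.X := inertia.pt (V := V.pow n) p.1 i

lemma elt_mem (p : (V.cycInertia T n).X) : elt p ∈ cycleLengthsIn V.G T n := p.2

lemma fiberElt_smul (p : (V.cycInertia T n).X) (i : Fin n) :
    fiberElt (elt p) i • pt p i = pt p ((elt p).right i) :=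
  (pow_smul_eq_iff V _ _ _).1 (inertia.elt_smul_pt (V := V.pow n) p.1) i

/-- The point `(w, x)`. -/
noncomputable def mk (w : Wreath V.G n) (x : Fin n → V.X) (hw : w ∈ cycleLengthsIn V.G T n)
    (h : ∀ i, fiberElt w i • x i = x (w.right i)) : (V.cycInertia T n).X :=
  ⟨inertia.mk (V := V.pow n) w x ((pow_smul_eq_iff V _ _ _).2 h), hw⟩

lemma ext {p q : (V.cycInertia T n).X} (h : elt p = elt q) (h' : ∀ i, pt p i = pt q i) : p = q :=
  Subtype.ext (inertia.ext h (funext h'))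

noncomputable instance : MulAction (Wreath V.G n) (V.cycInertia T n).X.carrier :=
  (V.cycInertia T n).action

lemma smul_eq_iff (h : Wreath V.G n) (p q : (V.cycInertia T n).X) :
    h • p = q ↔ h * elt p = elt q * h ∧ ∀ i, fiberElt h i • pt p i = pt q (h.right i) :=
  (Subtype.ext_iff.trans (inertia.smul_eq_iff (V := V.pow n) h p.1 q.1)).trans
    (and_congr Iff.rfl (pow_smul_eq_iff V _ _ _))

lemma isLocallyConstant_elt : IsLocallyConstant (elt (V := V) (T := T) (n := n)) :=
  (isRegular_val _ _ (V.isLocallyClosed_cycInertia T n)).isLocallyConstant_comp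
    (inertia.isLocallyConstant_elt (V := V.pow n))

lemma isRegular_pt (i : Fin n) : IsRegular (fun p : (V.cycInertia T n).X => pt p i) :=
  (isRegular_proj V.X i).comp ((inertia.isRegular_pt (V := V.pow n)).comp
    (isRegular_val _ _ (V.isLocallyClosed_cycInertia T n)))

lemma isRegular_of_elt_pt {Y : Variety} {f : Y → (V.cycInertia T n).X}
    (h : IsLocallyConstant fun y => elt (f y)) (h' : ∀ i, IsRegular fun y => pt (f y) i) :
    IsRegular f :=
  inertia.isRegular_of_elt_pt (V := V.pow n) h (IsRegular.tuple h')

end cycInertia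

end GVariety

lemma IsInductionMap.cls_cycInertia {Z V : GVariety} {φ : V.G →* Z.G} {j : V.X → Z.X}
    (H : IsInductionMap Z V φ j) (T : Set ℕ) (n : ℕ) :
    cls (Z.cycInertia T n) = cls (V.cycInertia T n) :=
  ((H.pow n).inertia.restrict (Z.isLocallyClosed_cycInertia T n)
    (Z.smul_mem_cycInertia T n) (V.isLocallyClosed_cycInertia T n)
    (V.smul_mem_cycInertia T n)).cls_eq

/-- The part of the variety `V.cycInertia T n` over an invariant subvariety of `V`. -/
lemma isomorphic_cycInertia_sub (V : GVariety) (T : Set ℕ) (n : ℕ) (S : Set V.X)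
    (hS : IsLocallyClosed S) (h : ∀ (g : V.G), ∀ x ∈ S, g • x ∈ S)
    (R : Set (V.cycInertia T n).X) (hR : ∀ p, p ∈ R ↔ ∀ i, cycInertia.pt p i ∈ S)
    (hS' : IsLocallyClosed R) (h' : ∀ (g : (V.cycInertia T n).G), ∀ x ∈ R, g • x ∈ R) :
    ((V.cycInertia T n).sub R hS' h').Isomorphic ((V.sub S hS h).cycInertia T n) := by
  have hv := isRegular_val (V.cycInertia T n).X R hS'
  have hv' := isRegular_val V.X S hS
  refine ⟨⟨fun p => cycInertia.mk (V := V.sub S hS h) (T := T) (n := n)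
      (cycInertia.elt (V := V) p.1)
      (fun i => ⟨cycInertia.pt p.1 i, (hR _).1 p.2 i⟩) (cycInertia.elt_mem p.1)
      (fun i => Subtype.ext (cycInertia.fiberElt_smul p.1 i)),
    fun q => ⟨cycInertia.mk (V := V) (T := T) (n := n)
      (cycInertia.elt (V := V.sub S hS h) q)
      (fun i => (cycInertia.pt (V := V.sub S hS h) q i).1)
      (cycInertia.elt_mem (V := V.sub S hS h) q) (fun i => congrArg Subtype.val
        (cycInertia.fiberElt_smul (V := V.sub S hS h) q i)),
      (hR _).2 fun i => (cycInertia.pt (V := V.sub S hS h) q i).2⟩, fun _ => rfl,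
    fun _ => rfl⟩, MulEquiv.refl _, ?_, ?_, fun _ _ => rfl⟩
  · exact cycInertia.isRegular_of_elt_pt (V := V.sub S hS h)
      (hv.isLocallyConstant_comp cycInertia.isLocallyConstant_elt)
      (fun i => (cycInertia.isRegular_pt i).comp hv)
  · exact cycInertia.isRegular_of_elt_pt (V := V)
      (cycInertia.isLocallyConstant_elt (V := V.sub S hS h))
      (fun i => hv'.comp (cycInertia.isRegular_pt (V := V.sub S hS h) i))

/-! ### Full cycles -/

/-- A permutation of `r` points all of whose cycles have length `r` is transitive. -/
lemma exists_iterate_eq {r : ℕ} {σ : Equiv.Perm (Fin r)}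
    (hσ : ∀ i, Function.minimalPeriod σ i = r) (i j : Fin r) :
    ∃ k : Fin r, σ^[(k : ℕ)] i = j := by
  have hinj : Function.Injective fun k : Fin r => σ^[(k : ℕ)] i := fun k l h =>
    Fin.ext (Function.iterate_injOn_Iio_minimalPeriod (f := σ) (x := i)
      (Set.mem_Iio.2 (by rw [hσ]; exact k.2)) (Set.mem_Iio.2 (by rw [hσ]; exact l.2)) h)
  exact Finite.surjective_of_injective hinj j

/-- A point of the inertia variety of `X^r` over a full cycle has its coordinates in one orbit. -/
lemma cycInertia_pt_mem_iff {V : GVariety} {r : ℕ} (p : (V.cycInertia {r} r).X) {S : Set V.X}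
    (h : ∀ (g : V.G), ∀ x ∈ S, g • x ∈ S) {i j : Fin r} (hi : cycInertia.pt p i ∈ S) :
    cycInertia.pt p j ∈ S := by
  obtain ⟨k, rfl⟩ := exists_iterate_eq (cycInertia.elt_mem p) i j
  generalize (k : ℕ) = m
  induction m with
  | zero => exact hi
  | succ m ih =>
    rw [Function.iterate_succ_apply', ← cycInertia.fiberElt_smul]
    exact h _ _ ih

/-- Full cycles are additive: all coordinates of a point lie on the same side of the cut as the
first one. -/
lemma cls_cycInertia_add (V : GVariety) (r : ℕ) [NeZero r] (Y : Set V.X) (hY : IsClosed Y)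
    (h : ∀ (g : V.G), ∀ x ∈ Y, g • x ∈ Y) :
    cls (V.cycInertia {r} r) = cls ((V.sub Y hY.isLocallyClosed h).cycInertia {r} r) +
      cls ((V.sub Yᶜ hY.isOpen_compl.isLocallyClosed (V.compl_invariant h)).cycInertia {r} r) := by
  let Y' : Set (V.cycInertia {r} r).X := {p | cycInertia.pt p 0 ∈ Y}
  have hY' : IsClosed Y' := hY.preimage (cycInertia.isRegular_pt 0).continuous
  have h' : ∀ (g : (V.cycInertia {r} r).G), ∀ p ∈ Y', g • p ∈ Y' := fun g p hp => by
    obtain ⟨h1, h2⟩ := (cycInertia.smul_eq_iff g p _).1 rfl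
    have h3 := h (fiberElt (G := V.G) g 0) _ hp
    rw [h2] at h3
    exact cycInertia_pt_mem_iff (g • p) h h3
  rw [cls_scissor _ Y' hY' h']
  exact congrArg₂ (· + ·)
    (cls_iso (isomorphic_cycInertia_sub V _ r Y _ h Y'
      (fun p => ⟨fun hp i => cycInertia_pt_mem_iff p h hp, fun hp => hp 0⟩) _ h'))
    (cls_iso (isomorphic_cycInertia_sub V _ r Yᶜ _ (V.compl_invariant h) Y'ᶜ
      (fun p => ⟨fun hp i => cycInertia_pt_mem_iff p (V.compl_invariant h) (i := 0) hp,
        fun hp => hp 0⟩) hY'.isOpen_compl.isLocallyClosed _))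

/-- The homomorphism `α_r`, which takes the class of a pair to that of the full cycles in the
inertia variety of its `r`-th power. -/
noncomputable def rootInertiaHom (r : ℕ) [NeZero r] : K0 →+ K0 :=
  K0.lift (fun V => cls (V.cycInertia {r} r)) (lift_eq_zero_of_rel _
    (fun _ _ _ _ H => H.cls_cycInertia _ _) fun V => cls_cycInertia_add V r)

lemma rootInertiaHom_cls (r : ℕ) [NeZero r] (V : GVariety) :
    rootInertiaHom r (cls V) = cls (V.cycInertia {r} r) := K0.lift_cls _ _ _

/-! ### Centralizers of full cycles -/

/-- The diagonal embedding of `G` in `G_n`. -/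
def diagWreath (G : Type) [Group G] (n : ℕ) : G →* Wreath G n :=
  MonoidHom.mk' (fun g => mkWreath 1 fun _ => g) fun g g' =>
    wreath_ext (fun _ => rfl) fun i => by simp [fiberElt_mul]

@[simp] lemma right_diagWreath {G : Type} [Group G] {n : ℕ} (g : G) :
    (diagWreath G n g).right = 1 := rfl

@[simp] lemma fiberElt_diagWreath {G : Type} [Group G] {n : ℕ} (g : G) (i : Fin n) :
    fiberElt (diagWreath G n g) i = g := by
  simp [diagWreath]

lemma right_pow {G : Type} [Group G] {n : ℕ} (w : Wreath G n) (k : ℕ) (i : Fin n) :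
    (w ^ k).right i = w.right^[k] i := by
  rw [← Equiv.Perm.coe_pow]
  exact Equiv.congr_fun (map_pow SemidirectProduct.rightHom w k) i

section StdCycle

variable {G : Type} [Group G] {r : ℕ} [NeZero r]

/-- Addition of `1` in `Fin r` is that of natural numbers, except at the last element. -/
lemma fin_add_one_cases (i : Fin r) :
    (i + 1 ≠ 0 ∧ ((i + 1 : Fin r) : ℕ) = i + 1) ∨ (i + 1 = 0 ∧ (i : ℕ) + 1 = r) := by
  have hr := NeZero.pos r
  have hv : ((i + 1 : Fin r) : ℕ) = (i + 1) % r := by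
    rw [Fin.val_add, Fin.val_one', Nat.add_mod_mod]
  rcases Nat.lt_or_ge (i + 1) r with h | h
  · left
    rw [Nat.mod_eq_of_lt h] at hv
    exact ⟨fun h0 => by simp [h0] at hv, hv⟩
  · right
    have h' : (i : ℕ) + 1 = r := le_antisymm i.2 h
    rw [h', Nat.mod_self] at hv
    exact ⟨Fin.ext hv, h'⟩

/-- Induction in `Fin r` along `i ↦ i + 1`, short of the last element. -/
lemma fin_induction_add_one {P : Fin r → Prop} (h0 : P 0) (h : ∀ i, i + 1 ≠ 0 → P i → P (i + 1))
    (i : Fin r) : P i := by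
  obtain ⟨k, hk⟩ := i
  induction k with
  | zero => exact h0
  | succ k ih =>
    obtain ⟨h1, h2⟩ | ⟨_, h2⟩ := fin_add_one_cases (⟨k, Nat.lt_of_succ_lt hk⟩ : Fin r)
    · have := h _ h1 (ih _)
      rwa [show (⟨k, Nat.lt_of_succ_lt hk⟩ : Fin r) + 1 = ⟨k + 1, hk⟩ from Fin.ext h2] at this
    · exact absurd hk (by simp at h2; omega)

/-- The element of `G_r` which permutes the `r` factors cyclically, and which acts as `g` on the
way from the last factor to the first one. -/
def stdCycle (r : ℕ) [NeZero r] (g : G) : Wreath G r :=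
  mkWreath (Equiv.addRight 1) fun i => if i + 1 = 0 then g else 1

lemma right_stdCycle (g : G) (i : Fin r) : (stdCycle r g).right i = i + 1 := rfl

lemma fiberElt_stdCycle (g : G) (i : Fin r) :
    fiberElt (stdCycle r g) i = if i + 1 = 0 then g else 1 := fiberElt_mkWreath _ _ _

lemma iterate_stdCycle (g : G) (i : Fin r) : (stdCycle r g).right^[(i : ℕ)] 0 = i := by
  induction i using fin_induction_add_one with
  | h0 => simp
  | h i hi ih =>
    rw [(fin_add_one_cases i).resolve_right (fun h => hi h.1) |>.2,
      Function.iterate_succ_apply', ih, right_stdCycle]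

lemma stdCycle_mem (g : G) : stdCycle r g ∈ cycleLengthsIn G {r} r := by
  have hr := NeZero.pos r
  have h0 : Function.minimalPeriod (stdCycle r g).right (0 : Fin r) = r := by
    refine le_antisymm ?_ ?_
    · refine Function.IsPeriodicPt.minimalPeriod_le hr ?_
      obtain ⟨i, hi⟩ : ∃ i : Fin r, i + 1 = 0 := ⟨-1, by simp⟩
      have h := (fin_add_one_cases i).resolve_left (fun h => h.1 hi)
      refine (congrArg (fun m => (stdCycle r g).right^[m] 0) h.2).symm.trans ?_
      rw [Function.iterate_succ_apply', iterate_stdCycle, right_stdCycle, hi]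
    · by_contra! hlt
      have hp := Function.isPeriodicPt_minimalPeriod (stdCycle r g).right (0 : Fin r)
      have h1 := iterate_stdCycle g
        (⟨Function.minimalPeriod (stdCycle r g).right (0 : Fin r), hlt⟩ : Fin r)
      have h2 := h1.symm.trans hp
      have h3 : Function.minimalPeriod (stdCycle r g).right (0 : Fin r) = 0 := congrArg Fin.val h2
      have h4 := Function.minimalPeriod_pos_of_mem_periodicPts
        ((stdCycle r g).right.injective.mem_periodicPts (0 : Fin r))
      omega
  intro i
  have h1 := Function.minimalPeriod_apply_iterate
    ((stdCycle r g).right.injective.mem_periodicPts 0) i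
  rw [iterate_stdCycle] at h1
  exact h1.trans h0

/-- An element of the centralizer of the standard cycle which fixes an index is diagonal. -/
lemma eq_diagWreath_of_commute {g : G} {u : Wreath G r} (hu : u * stdCycle r g = stdCycle r g * u)
    (h0 : u.right 0 = 0) : ∃ h, h * g = g * h ∧ u = diagWreath G r h := by
  have hr : ∀ i, u.right i = i := fun i => by
    induction i using fin_induction_add_one with
    | h0 => exact h0
    | h i _ ih =>
      have := Equiv.congr_fun (congrArg SemidirectProduct.right hu) i
      change u.right (i + 1) = u.right i + 1 at this
      rw [this, ih]
  have hf : ∀ i, fiberElt u (i + 1) * (if i + 1 = 0 then g else 1) =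
      (if i + 1 = 0 then g else 1) * fiberElt u i := fun i => by
    have := congrArg (fiberElt · i) hu
    simpa only [fiberElt_mul, right_stdCycle, hr, fiberElt_stdCycle] using this
  have hc : ∀ i, fiberElt u i = fiberElt u 0 := fun i => by
    induction i using fin_induction_add_one with
    | h0 => rfl
    | h i hi ih => simpa [hi, ih] using hf i
  refine ⟨fiberElt u 0, ?_, wreath_ext (fun i => by simp [hr]) fun i => by simp [hc i]⟩
  have := hf (-1)
  rwa [if_pos (by simp), hc (-1 + 1), hc (-1)] at this

lemma diagWreath_commute {g h : G} (e : h * g = g * h) :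
    diagWreath G r h * stdCycle r g = stdCycle r g * diagWreath G r h := by
  refine wreath_ext (fun i => rfl) fun i => ?_
  rw [fiberElt_mul, fiberElt_mul, fiberElt_diagWreath, fiberElt_diagWreath, fiberElt_stdCycle,
    right_diagWreath, Equiv.Perm.one_apply, fiberElt_stdCycle]
  split_ifs <;> simp [e]

/-- The transport along the standard cycle is trivial before the cycle closes. -/
lemma fiberElt_stdCycle_pow (g : G) (i : Fin r) : fiberElt (stdCycle r g ^ (i : ℕ)) 0 = 1 := by
  induction i using fin_induction_add_one with
  | h0 => simp
  | h i hi ih =>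
    rw [(fin_add_one_cases i).resolve_right (fun h => hi h.1) |>.2, pow_succ', fiberElt_mul,
      right_pow, iterate_stdCycle, ih, fiberElt_stdCycle, if_neg hi, one_mul]

/-- The relation `a^r = g` for the standard cycle. -/
lemma stdCycle_pow (g : G) : stdCycle r g ^ r = diagWreath G r g := by
  have hlast : (-1 : Fin r) + 1 = 0 := by simp
  have hr := ((fin_add_one_cases (-1 : Fin r)).resolve_left fun h => h.1 hlast).2
  have h0 : (stdCycle r g ^ r).right 0 = 0 := by
    rw [right_pow]
    refine (congrArg (fun m => (stdCycle r g).right^[m] 0) hr).symm.trans ?_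
    rw [Function.iterate_succ_apply', iterate_stdCycle, right_stdCycle, hlast]
  obtain ⟨h, -, e⟩ := eq_diagWreath_of_commute (pow_mul_comm' (stdCycle r g) r) h0
  have hg : fiberElt (stdCycle r g ^ r) 0 = g := by
    refine (congrArg (fun m => fiberElt (stdCycle r g ^ m) 0) hr).symm.trans ?_
    rw [pow_succ', fiberElt_mul, right_pow, iterate_stdCycle, fiberElt_stdCycle_pow,
      fiberElt_stdCycle, if_pos hlast, mul_one]
  rw [e, fiberElt_diagWreath] at hg
  rw [e, hg]

/-- An element of `G_r` with a full cycle is conjugate to a standard cycle, for each `g` in the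
class of the total transport along the cycle. -/
lemma exists_conj_stdCycle {w : Wreath G r} (hw : w ∈ cycleLengthsIn G {r} r) {g : G}
    (hg : IsConj g (fiberElt (w ^ r) 0)) : ∃ u, u * stdCycle r g = w * u := by
  obtain ⟨k, hk⟩ := isConj_iff.1 hg
  let σ : Fin r → Fin r := fun i => w.right^[(i : ℕ)] 0
  have hσ : Function.Bijective σ :=
    Function.Surjective.bijective_of_finite fun j => exists_iterate_eq hw 0 j
  have hper : w.right^[r] 0 = (0 : Fin r) := by
    have := Function.isPeriodicPt_minimalPeriod w.right (0 : Fin r)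
    rwa [show Function.minimalPeriod w.right (0 : Fin r) = r from hw 0] at this
  refine ⟨mkWreath (Equiv.ofBijective σ hσ) fun i => fiberElt (w ^ (i : ℕ)) 0 * k,
    wreath_ext (fun i => ?_) fun i => ?_⟩
  · change w.right^[((i + 1 : Fin r) : ℕ)] 0 = w.right (w.right^[(i : ℕ)] 0)
    rw [← Function.iterate_succ_apply' w.right]
    obtain ⟨-, h⟩ | ⟨h, h'⟩ := fin_add_one_cases i
    · rw [h]
    · rw [h, Nat.succ_eq_add_one, h', hper]
      rfl
  · rw [fiberElt_mul, fiberElt_mul, fiberElt_mkWreath, fiberElt_mkWreath, right_stdCycle,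
      fiberElt_stdCycle, right_mkWreath, Equiv.ofBijective_apply, ← mul_assoc,
      show σ i = (w ^ (i : ℕ)).right 0 from (right_pow w i 0).symm,
      ← fiberElt_mul, ← pow_succ']
    obtain ⟨h, h'⟩ | ⟨h, h'⟩ := fin_add_one_cases i
    · rw [if_neg h, h', mul_one]
    · rw [if_pos h, h, h', ← hk]
      simp

/-- The conjugacy class of the total transport along a full cycle. -/
def transportClass (w : Wreath G r) : ConjClasses G := ConjClasses.mk (fiberElt (w ^ r) 0)

lemma transportClass_eq_of_conj {g : G} {u w : Wreath G r} (e : u * stdCycle r g = w * u) :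
    transportClass w = ConjClasses.mk g := by
  have h : w = u * stdCycle r g * u⁻¹ := eq_mul_inv_of_mul_eq e.symm
  have h' : w ^ r * u = u * diagWreath G r g := by
    rw [h, conj_pow, stdCycle_pow, inv_mul_cancel_right]
  obtain ⟨i, hi⟩ := u.right.surjective 0
  have h2 := congrArg (fiberElt · i) h'
  simp only [fiberElt_mul, hi, fiberElt_diagWreath, right_diagWreath, Equiv.Perm.one_apply] at h2
  exact (ConjClasses.mk_eq_mk_iff_isConj.2
    (isConj_iff.2 ⟨fiberElt u i, mul_inv_eq_iff_eq_mul.2 h2.symm⟩)).symm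

lemma transportClass_conj {h w w' : Wreath G r} (hw : w ∈ cycleLengthsIn G {r} r)
    (e : h * w = w' * h) : transportClass w' = transportClass w := by
  obtain ⟨u, hu⟩ := exists_conj_stdCycle hw (IsConj.refl _)
  exact transportClass_eq_of_conj (u := h * u) (by rw [mul_assoc, hu, ← mul_assoc, e, mul_assoc])

end StdCycle

/-- The homomorphism `C_G(g) × ℤ → G_r` which embeds the first factor diagonally and takes the
generator of the second one to the standard cycle. -/
noncomputable def prodToWreath {G : Type} [Group G] (r : ℕ+) (g : G) :
    Subgroup.centralizer {g} × Multiplicative ℤ →* Wreath G r :=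
  MonoidHom.noncommCoprod ((diagWreath G r).comp (Subgroup.centralizer {g}).subtype)
    (zpowersHom (Wreath G r) (stdCycle (r : ℕ) g)) fun h _ =>
      Commute.zpow_right (diagWreath_commute (Subgroup.mem_centralizer_singleton_iff.1 h.2)) _

lemma prodToWreath_apply {G : Type} [Group G] (r : ℕ+) (g : G)
    (p : Subgroup.centralizer {g} × Multiplicative ℤ) : prodToWreath r g p =
      diagWreath G r (p.1 : G) * stdCycle (r : ℕ) g ^ Multiplicative.toAdd p.2 := rfl

/-- The homomorphism `C_G(g)⟨a⟩ → G_r` which embeds `C_G(g)` diagonally and takes `a` to the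
standard cycle. It is an isomorphism onto the centralizer of the standard cycle. -/
noncomputable def rootWreath {G : Type} [Group G] (r : ℕ+) (g : G) :
    RootCentralizer r g →* Wreath G r :=
  QuotientGroup.lift (rootRelation r g) (prodToWreath r g) (by
    refine (Subgroup.zpowers_le (H := (prodToWreath r g).ker)).2 ?_
    rw [MonoidHom.mem_ker, prodToWreath_apply]
    simp [selfCentralizer, stdCycle_pow])

lemma rootWreath_mk {G : Type} [Group G] (r : ℕ+) (g : G)
    (p : Subgroup.centralizer {g} × Multiplicative ℤ) :
    rootWreath r g (QuotientGroup.mk p) =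
      diagWreath G r (p.1 : G) * stdCycle (r : ℕ) g ^ Multiplicative.toAdd p.2 := rfl

lemma rootWreath_injective {G : Type} [Group G] (r : ℕ+) (g : G) :
    Function.Injective (rootWreath r g) := by
  refine (injective_iff_map_eq_one _).2 fun y hy => ?_
  induction y using QuotientGroup.induction_on with
  | H p =>
    obtain ⟨h, k⟩ := p
    rw [rootWreath_mk] at hy
    dsimp only at hy
    have h1 : (stdCycle (r : ℕ) g).right ^ Multiplicative.toAdd k = 1 := by
      have := congrArg SemidirectProduct.rightHom hy
      rwa [map_mul, map_zpow, map_one, SemidirectProduct.rightHom_eq_right, right_diagWreath,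
        one_mul] at this
    have h2 : ((r : ℕ) : ℤ) ∣ Multiplicative.toAdd k := by
      have h3 := MulAction.zpow_smul_eq_iff_minimalPeriod_dvd
        (a := (stdCycle (r : ℕ) g).right) (b := (0 : Fin r)) (n := Multiplicative.toAdd k)
      have h4 : Function.minimalPeriod (stdCycle (r : ℕ) g).right (0 : Fin r) = r :=
        stdCycle_mem g 0
      rw [h1, one_smul, eq_self_iff_true, true_iff] at h3
      rw [← h4]
      exact h3
    obtain ⟨l, hl⟩ := h2
    rw [hl, zpow_mul, zpow_natCast, stdCycle_pow, ← map_zpow, ← map_mul] at hy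
    have h5 : (h : G) * g ^ l = 1 := by
      rw [← fiberElt_diagWreath (n := r) ((h : G) * g ^ l) 0, hy, fiberElt_one]
    refine (QuotientGroup.eq_one_iff _).2 ⟨-l, Prod.ext (Subtype.ext ?_) ?_⟩
    · simpa [selfCentralizer] using (eq_inv_of_mul_eq_one_left h5).symm
    · apply Multiplicative.toAdd.injective
      simp [hl, mul_comm]

/-- The centralizer of the standard cycle is generated by that cycle and the diagonal elements:
multiplication by a power of the cycle makes an element fix an index. -/
lemma exists_rootWreath_eq {G : Type} [Group G] {r : ℕ+} {g : G} {u : Wreath G r}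
    (hu : u * stdCycle (r : ℕ) g = stdCycle (r : ℕ) g * u) : ∃ y, rootWreath r g y = u := by
  obtain ⟨k, hk⟩ := exists_iterate_eq (stdCycle_mem (r := (r : ℕ)) g) 0 (u.right 0)
  have hc : Commute ((stdCycle (r : ℕ) g ^ (k : ℕ))⁻¹ * u) (stdCycle (r : ℕ) g) :=
    ((Commute.refl _).pow_left _).inv_left.mul_left hu
  obtain ⟨h, hg, e⟩ := eq_diagWreath_of_commute hc (by
    change (stdCycle (r : ℕ) g ^ (k : ℕ)).right.symm (u.right 0) = 0
    rw [Equiv.symm_apply_eq, right_pow, hk])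
  refine ⟨QuotientGroup.mk (⟨h, Subgroup.mem_centralizer_singleton_iff.2 hg⟩,
    Multiplicative.ofAdd (k : ℤ)), ?_⟩
  rw [rootWreath_mk]
  change diagWreath G r h * stdCycle (r : ℕ) g ^ ((k : ℕ) : ℤ) = u
  rw [zpow_natCast, (Commute.pow_right (diagWreath_commute hg) _).eq, ← e, mul_inv_cancel_left]

/-! ### Full cycles and the groups `C_G(g)⟨a⟩` -/

/-- The point of the inertia variety of `X^r` given by the standard cycle of `g` and by the
diagonal point of a fixed point of `g`. -/
noncomputable def stdCyclePoint (V : GVariety) (r : ℕ) [NeZero r] (g : V.G) (x : V.X)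
    (h : g • x = x) : (V.cycInertia {r} r).X :=
  cycInertia.mk (stdCycle r g) (fun _ => x) (stdCycle_mem g) fun i => by
    rw [fiberElt_stdCycle]
    split_ifs
    · exact h
    · exact one_smul V.G x

/-- The points fixed by the standard cycle are the diagonal ones with coordinate fixed by `g`. -/
lemma exists_stdCyclePoint_eq {V : GVariety} {r : ℕ} [NeZero r] {g : V.G}
    {p : (V.cycInertia {r} r).X} (h : cycInertia.elt p = stdCycle r g) :
    g • cycInertia.pt p 0 = cycInertia.pt p 0 ∧ ∀ i, cycInertia.pt p i = cycInertia.pt p 0 := by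
  have hp : ∀ i, (if i + 1 = 0 then g else 1) • cycInertia.pt p i = cycInertia.pt p (i + 1) :=
    fun i => by
      have := cycInertia.fiberElt_smul p i
      rwa [h, fiberElt_stdCycle, right_stdCycle] at this
  have hc : ∀ i, cycInertia.pt p i = cycInertia.pt p 0 := fun i => by
    induction i using fin_induction_add_one with
    | h0 => rfl
    | h i hi ih => rw [← hp, if_neg hi, one_smul, ih]
  refine ⟨?_, hc⟩
  have := hp (-1)
  rwa [if_pos (by simp), hc (-1), hc (-1 + 1)] at this

lemma diagWreath_smul_stdCyclePoint {V : GVariety} {r : ℕ} [NeZero r] {g h : V.G} {x : V.X}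
    (hx : g • x = x) (hg : h * g = g * h) (hx' : g • h • x = h • x) :
    diagWreath V.G r h • stdCyclePoint V r g x hx = stdCyclePoint V r g (h • x) hx' :=
  (cycInertia.smul_eq_iff _ _ _).2 ⟨diagWreath_commute hg, fun i =>
    congrArg (· • x) (fiberElt_diagWreath h i)⟩

lemma stdCycle_zpow_smul_stdCyclePoint {V : GVariety} {r : ℕ} [NeZero r] {g : V.G} {x : V.X}
    (hx : g • x = x) (k : ℤ) :
    stdCycle r g ^ k • stdCyclePoint V r g x hx = stdCyclePoint V r g x hx := by
  have h : stdCycle r g ∈ MulAction.stabilizer (Wreath V.G r) (stdCyclePoint V r g x hx) :=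
    (cycInertia.smul_eq_iff _ _ _).2 ⟨rfl, fun i =>
      cycInertia.fiberElt_smul (stdCyclePoint V r g x hx) i⟩
  exact zpow_mem h k

/-- The full cycles in the inertia variety of `X^r` decompose according to the class of the total
transport; each piece is induced from a variety `X^⟨g⟩` with the action of `C_G(g)⟨a⟩`. -/
lemma cls_cycInertia_eq_sum (V : GVariety) (r : ℕ+) : cls (V.cycInertia {(r : ℕ)} r) =
    ∑ᶠ c : ConjClasses V.G, cls (V.rootFixed r (conjRep c)) := by
  have := Fintype.ofFinite (ConjClasses V.G)
  let E := V.cycInertia {(r : ℕ)} r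
  have hcl : ∀ c : ConjClasses V.G,
      IsClosed {p : E.X | transportClass (cycInertia.elt p) = c} := fun c =>
    (cycInertia.isLocallyConstant_elt.comp transportClass).isClosed_fiber c
  have hinv : ∀ (h : E.G) (p : E.X),
      transportClass (cycInertia.elt (h • p)) = transportClass (cycInertia.elt p) := fun h p =>
    transportClass_conj (h := h) (cycInertia.elt_mem p)
      ((cycInertia.smul_eq_iff (V := V) h p _).1 rfl).1
  rw [finsum_eq_sum_of_fintype, cls_eq_sum_fibers E _ hcl hinv]
  refine Finset.sum_congr rfl fun c _ => ?_
  let g := conjRep c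
  have hstd : ∀ (x : V.fixedPoints g),
      transportClass (cycInertia.elt (stdCyclePoint V r g x.1 x.2)) = c := fun x =>
    (transportClass_eq_of_conj (u := 1) ((one_mul _).trans (mul_one _).symm)).trans (mk_conjRep c)
  refine IsInductionMap.cls_eq (φ := rootWreath r g)
    (j := fun x : V.fixedPoints g => ⟨stdCyclePoint V r g x.1 x.2, hstd x⟩) ⟨?_, ?_, ?_, ?_, ?_⟩
  · have hv := isRegular_val E.X _ (hcl c).isLocallyClosed
    have hC : IsClosed (X := (E.X.sub _ (hcl c).isLocallyClosed).carrier)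
        ((fun p => cycInertia.elt p.1) ⁻¹' {stdCycle (r : ℕ) g}) :=
      (hv.isLocallyConstant_comp cycInertia.isLocallyConstant_elt).isClosed_fiber _
    refine IsClosedEmb.of_inverse (Y := E.X.sub _ (hcl c).isLocallyClosed)
      (cycInertia.isRegular_of_elt_pt (V := V) (IsLocallyConstant.const _) fun i =>
        (isRegular_val V.X _ ((V.regular g).isClosed_eq (isRegular_id V.X)).isLocallyClosed))
      hC (fun x => rfl)
      (fun p => ⟨cycInertia.pt p.1.1 0, (exists_stdCyclePoint_eq p.2).1⟩) ?_ (fun _ => rfl)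
      (fun p => Subtype.ext (cycInertia.ext
        (show cycInertia.elt p.1.1 = stdCycle (r : ℕ) g from p.2).symm
        fun i => ((exists_stdCyclePoint_eq p.2).2 i).symm))
    exact (cycInertia.isRegular_pt 0).comp (hv.comp (isRegular_val _ _ hC.isLocallyClosed))
  · exact rootWreath_injective r g
  · intro y x
    induction y using QuotientGroup.induction_on with
    | H p =>
      refine Subtype.ext ?_
      have hp := Subgroup.mem_centralizer_singleton_iff.1 p.1.2
      refine Eq.symm ((mul_smul (diagWreath V.G r (p.1 : V.G))
        (stdCycle (r : ℕ) g ^ Multiplicative.toAdd p.2) (stdCyclePoint V r g x.1 x.2)).trans ?_)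
      rw [stdCycle_zpow_smul_stdCyclePoint]
      exact diagWreath_smul_stdCyclePoint x.2 hp (V.smul_fixed g p.1 x.1 x.2)
  · intro u x x' e
    exact exists_rootWreath_eq
      ((cycInertia.smul_eq_iff (V := V) u _ _).1 (congrArg Subtype.val e)).1
  · rintro ⟨p, hp⟩
    obtain ⟨u, hu⟩ := exists_conj_stdCycle (g := g) (cycInertia.elt_mem p)
      (ConjClasses.mk_eq_mk_iff_isConj.1 ((mk_conjRep c).trans hp.symm))
    have hq : cycInertia.elt (u⁻¹ • p) = stdCycle (r : ℕ) g := by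
      have h1 := ((cycInertia.smul_eq_iff u⁻¹ p _).1 rfl).1
      rw [eq_mul_inv_of_mul_eq h1.symm, inv_inv, mul_assoc, ← hu, inv_mul_cancel_left]
    obtain ⟨h1, h2⟩ := exists_stdCyclePoint_eq hq
    refine ⟨u, ⟨cycInertia.pt (u⁻¹ • p) 0, h1⟩, Subtype.ext ?_⟩
    have h3 : stdCyclePoint V r g _ h1 = u⁻¹ • p :=
      cycInertia.ext hq.symm fun i => (h2 i).symm
    exact (congrArg (u • ·) h3).trans (smul_inv_smul u p)

lemma isRootInertiaHom_iff {r : ℕ+} {β : K0 →+ K0} :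
    IsRootInertiaHom r β ↔ β = rootInertiaHom r := by
  have key : ∀ V : GVariety, rootInertiaHom r (cls V) =
      ∑ᶠ c : ConjClasses V.G, cls (V.rootFixed r (conjRep c)) := fun V =>
    (rootInertiaHom_cls r V).trans (cls_cycInertia_eq_sum V r)
  constructor
  · exact fun h => K0.hom_ext fun V => (h V).trans (key V).symm
  · rintro rfl
    exact key

/-! ### Splitting off cycles by their lengths -/

section

variable {G : Type} [Group G] {a b n : ℕ} (e : Fin a ⊕ Fin b ≃ Fin n)
  (p : Wreath G a × Wreath G b)

lemma minimalPeriod_sumWreath_inl (i : Fin a) :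
    Function.minimalPeriod (sumWreath e p).right (e (.inl i)) =
      Function.minimalPeriod p.1.right i :=
  minimalPeriod_eq_of_semiconj (u := fun i => e (.inl i)) (e.injective.comp Sum.inl_injective)
    (fun i => (right_sumWreath_inl e p i).symm) i

lemma minimalPeriod_sumWreath_inr (i : Fin b) :
    Function.minimalPeriod (sumWreath e p).right (e (.inr i)) =
      Function.minimalPeriod p.2.right i :=
  minimalPeriod_eq_of_semiconj (u := fun i => e (.inr i)) (e.injective.comp Sum.inr_injective)
    (fun i => (right_sumWreath_inr e p i).symm) i

end

namespace GVariety.cycInertia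

variable {V : GVariety} {T T' : Set ℕ} {a b n : ℕ} (e : Fin a ⊕ Fin b ≃ Fin n)

/-- The coordinates of two points of powers of `X`, put together. -/
noncomputable def sumPt (p : (V.cycInertia T a).X) (q : (V.cycInertia T' b).X) (k : Fin n) : V.X :=
  Sum.elim (pt p) (pt q) (e.symm k)

section

variable (p : (V.cycInertia T a).X) (q : (V.cycInertia T' b).X)

@[simp] lemma sumPt_inl (i : Fin a) : sumPt e p q (e (.inl i)) = pt p i := by simp [sumPt]

@[simp] lemma sumPt_inr (i : Fin b) : sumPt e p q (e (.inr i)) = pt q i := by simp [sumPt]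

end

lemma sumWreath_smul_sumPt (u : Wreath V.G a × Wreath V.G b) {p p' : (V.cycInertia T a).X}
    {q q' : (V.cycInertia T' b).X} (h : ∀ i, fiberElt u.1 i • pt p i = pt p' (u.1.right i))
    (h' : ∀ i, fiberElt u.2 i • pt q i = pt q' (u.2.right i)) (k : Fin n) :
    fiberElt (sumWreath e u) k • sumPt e p q k = sumPt e p' q' ((sumWreath e u).right k) := by
  obtain ⟨i | i, rfl⟩ := e.surjective k
  · rw [right_sumWreath_inl, fiberElt_sumWreath_inl, sumPt_inl, sumPt_inl, h]
  · rw [right_sumWreath_inr, fiberElt_sumWreath_inr, sumPt_inr, sumPt_inr, h']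

/-- The juxtaposition of two points `(w, x)` and `(w', x')`. -/
noncomputable def sum (p : (V.cycInertia T a).X) (q : (V.cycInertia T' b).X) :
    (V.cycInertia (T ∪ T') n).X :=
  mk (sumWreath e (elt p, elt q)) (sumPt e p q)
    (fun k => by
      obtain ⟨i | i, rfl⟩ := e.surjective k
      · exact Or.inl ((minimalPeriod_sumWreath_inl e (elt p, elt q) i).symm ▸ elt_mem p i)
      · exact Or.inr ((minimalPeriod_sumWreath_inr e (elt p, elt q) i).symm ▸ elt_mem q i))
    (sumWreath_smul_sumPt e (elt p, elt q) (fiberElt_smul p) (fiberElt_smul q))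

lemma isRegular_sum : IsRegular (X := (V.cycInertia T a).X.prod (V.cycInertia T' b).X)
    (Y := (V.cycInertia (T ∪ T') n).X) fun x => sum e x.1 x.2 := by
  have hfst := isRegular_fst (V.cycInertia T a).X (V.cycInertia T' b).X
  have hsnd := isRegular_snd (V.cycInertia T a).X (V.cycInertia T' b).X
  refine isRegular_of_elt_pt (V := V) ?_ fun k => ?_
  · exact ((hfst.isLocallyConstant_comp isLocallyConstant_elt).prodMk
      (hsnd.isLocallyConstant_comp isLocallyConstant_elt)).comp (sumWreath e)
  · change IsRegular (X := (V.cycInertia T a).X.prod (V.cycInertia T' b).X)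
      fun x => Sum.elim (pt x.1) (pt x.2) (e.symm k)
    rcases e.symm k with i | i
    · exact (isRegular_pt i).comp hfst
    · exact (isRegular_pt i).comp hsnd

lemma sum_smul (u : Wreath V.G a × Wreath V.G b) (p : (V.cycInertia T a).X)
    (q : (V.cycInertia T' b).X) : sum e (u.1 • p) (u.2 • q) = sumWreath e u • sum e p q := by
  obtain ⟨h1, h2⟩ := (smul_eq_iff u.1 p _).1 rfl
  obtain ⟨h3, h4⟩ := (smul_eq_iff u.2 q _).1 rfl
  refine ((smul_eq_iff (V := V) _ _ _).2 ⟨?_, sumWreath_smul_sumPt e u h2 h4⟩).symm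
  exact (map_mul (sumWreath e) _ _).symm.trans
    ((congrArg (sumWreath e) (Prod.ext h1 h3)).trans (map_mul _ _ _))

/-- The indices lying on cycles with lengths in `T`. -/
noncomputable def marked (T : Set ℕ) {S : Set ℕ} (p : (V.cycInertia S n).X) : Finset (Fin n) := by
  classical exact {i | Function.minimalPeriod (elt p).right i ∈ T}

lemma mem_marked {S : Set ℕ} {p : (V.cycInertia S n).X} {i : Fin n} :
    i ∈ marked T p ↔ Function.minimalPeriod (elt p).right i ∈ T := by
  simp [marked]

lemma isMarking_marked (V : GVariety) (T S : Set ℕ) (n : ℕ) :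
    IsMarking (G := V.G) (V.cycInertia S n) (MulEquiv.refl _) (marked (V := V) T) := by
  refine ⟨fun w p i => ?_, fun i => ?_⟩
  · rw [mem_marked, mem_marked]
    refine iff_of_eq (congrArg (· ∈ T) ?_)
    exact minimalPeriod_eq_of_semiconj (SemidirectProduct.right w).injective (fun l =>
      Equiv.congr_fun (congrArg SemidirectProduct.right ((smul_eq_iff w p _).1 rfl).1) l) i
  · have h : {p : (V.cycInertia S n).X | i ∈ marked T p} =
        elt ⁻¹' {w : Wreath V.G n | Function.minimalPeriod w.right i ∈ T} :=
      Set.ext fun p => mem_marked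
    rw [h, ← isOpen_compl_iff]
    exact isLocallyConstant_elt (V := V) {w : Wreath V.G n | Function.minimalPeriod w.right i ∈ T}ᶜ

lemma sum_mem_std (hT : Disjoint T T') (p : (V.cycInertia T a).X) (q : (V.cycInertia T' b).X) :
    sum e p q ∈ IsMarking.std (marked (V := V) T) e := by
  refine ⟨fun i => mem_marked.2 ?_, fun i hi => ?_⟩
  · exact (minimalPeriod_sumWreath_inl e (elt p, elt q) i).symm ▸ elt_mem p i
  · have h1 : Function.minimalPeriod (sumWreath e (elt p, elt q)).right (e (.inr i)) ∈ T :=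
      mem_marked.1 hi
    rw [minimalPeriod_sumWreath_inr] at h1
    exact hT.le_bot ⟨h1, elt_mem q i⟩

/-- Cycles do not leave the set of marked indices. -/
lemma sumWreath_invFun_elt {S : Set ℕ} {p : (V.cycInertia S n).X}
    (hp : p ∈ IsMarking.std (marked (V := V) T) e) :
    sumWreath e (Function.invFun (sumWreath e) (elt p)) = elt p :=
  Function.invFun_eq (exists_sumWreath_eq e fun i => by
    obtain ⟨k | k, hk⟩ := e.surjective ((elt p).right (e (.inl i)))
    · exact ⟨k, hk.symm⟩
    · have h1 := mem_marked.1 (hp.1 i)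
      rw [← Function.minimalPeriod_apply ((elt p).right.injective.mem_periodicPts _), ← hk] at h1
      exact absurd (mem_marked.2 h1) (hp.2 k))

section

variable {p : (V.cycInertia (T ∪ T') n).X} (hp : p ∈ IsMarking.std (marked (V := V) T) e)

/-- The part of `p` with the marked indices. -/
noncomputable def markedPart : (V.cycInertia T a).X :=
  mk (Function.invFun (sumWreath e) (elt p)).1 (fun i => pt p (e (.inl i)))
    (fun i => by
      have h := mem_marked.1 (hp.1 i)
      rwa [← sumWreath_invFun_elt e hp, minimalPeriod_sumWreath_inl] at h)
    (fun i => by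
      have h := fiberElt_smul p (e (.inl i))
      rwa [← sumWreath_invFun_elt e hp, right_sumWreath_inl, fiberElt_sumWreath_inl] at h)

/-- The part of `p` with the other indices. -/
noncomputable def unmarkedPart : (V.cycInertia T' b).X :=
  mk (Function.invFun (sumWreath e) (elt p)).2 (fun i => pt p (e (.inr i)))
    (fun i => by
      have h := (elt_mem p (e (.inr i))).resolve_left fun h => hp.2 i (mem_marked.2 h)
      rwa [← sumWreath_invFun_elt e hp, minimalPeriod_sumWreath_inr] at h)
    (fun i => by
      have h := fiberElt_smul p (e (.inr i))
      rwa [← sumWreath_invFun_elt e hp, right_sumWreath_inr, fiberElt_sumWreath_inr] at h)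

lemma sum_markedPart : sum e (markedPart e hp) (unmarkedPart e hp) = p := by
  refine ext (sumWreath_invFun_elt e hp) fun k => ?_
  obtain ⟨i | i, rfl⟩ := e.surjective k
  · exact sumPt_inl e (markedPart e hp) (unmarkedPart e hp) i
  · exact sumPt_inr e (markedPart e hp) (unmarkedPart e hp) i

end

section

variable (hT : Disjoint T T') (p : (V.cycInertia T a).X) (q : (V.cycInertia T' b).X)

lemma markedPart_sum : markedPart e (sum_mem_std e hT p q) = p :=
  ext (congrArg (fun u : Wreath V.G a × Wreath V.G b => u.1)
      (Function.leftInverse_invFun (sumWreath_injective e) (elt p, elt q)))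
    (sumPt_inl e p q)

lemma unmarkedPart_sum : unmarkedPart e (sum_mem_std e hT p q) = q :=
  ext (congrArg (fun u : Wreath V.G a × Wreath V.G b => u.2)
      (Function.leftInverse_invFun (sumWreath_injective e) (elt p, elt q)))
    (sumPt_inr e p q)

end

/-- The points with `a` marked indices are induced from pairs of points of smaller powers. -/
lemma cls_stratum_marked (e : Fin a ⊕ Fin b ≃ Fin n) (hT : Disjoint T T') :
    cls ((isMarking_marked V T (T ∪ T') n).stratum a) =
      cls (V.cycInertia T a) * cls (V.cycInertia T' b) := by
  have hval := isRegular_val (V.cycInertia (T ∪ T') n).X _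
    ((isMarking_marked V T (T ∪ T') n).isLocallyClosed_std e)
  have hl := hval.isLocallyConstant_comp (isLocallyConstant_elt (V := V))
  rw [cls_mul]
  refine (isMarking_marked V T (T ∪ T') n).cls_stratum e
    ((V.cycInertia T a).prod (V.cycInertia T' b)) (MulEquiv.refl _) (fun x => sum e x.1 x.2)
    (isRegular_sum e) (fun x => sum_mem_std e hT x.1 x.2) (fun u x => sum_smul e u x.1 x.2)
    (fun y => (markedPart e y.2, unmarkedPart e y.2)) ?_
    (fun x => Prod.ext (markedPart_sum e hT x.1 x.2) (unmarkedPart_sum e hT x.1 x.2))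
    (fun y => sum_markedPart e y.2)
  exact IsRegular.pair (Y := (V.cycInertia T a).X) (Z := (V.cycInertia T' b).X)
    (isRegular_of_elt_pt (hl.comp fun v => (Function.invFun (sumWreath e) v).1)
      fun i => (isRegular_pt (V := V) (e (.inl i))).comp hval)
    (isRegular_of_elt_pt (hl.comp fun v => (Function.invFun (sumWreath e) v).2)
      fun i => (isRegular_pt (V := V) (e (.inr i))).comp hval)

end GVariety.cycInertia

/-- The generating function of the inertia varieties of the powers of `X`, restricted to
permutations with cycle lengths in `T`. -/
noncomputable def cycleZeta (V : GVariety) (T : Set ℕ) : PowerSeries K0 :=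
  PowerSeries.mk fun n => cls (V.cycInertia T n)

lemma coeff_cycleZeta (V : GVariety) (T : Set ℕ) (n : ℕ) :
    PowerSeries.coeff n (cycleZeta V T) = cls (V.cycInertia T n) := PowerSeries.coeff_mk _ _

/-- Cycles with lengths in `T` and those with lengths in `T'` are chosen independently. -/
lemma cycleZeta_union (V : GVariety) {T T' : Set ℕ} (hT : Disjoint T T') :
    cycleZeta V (T ∪ T') = cycleZeta V T * cycleZeta V T' := by
  ext n
  rw [PowerSeries.coeff_mul, coeff_cycleZeta,
    (cycInertia.isMarking_marked V T (T ∪ T') n).cls_eq_sum_stratum]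
  refine Finset.sum_congr rfl fun p hp => ?_
  rw [coeff_cycleZeta, coeff_cycleZeta, cycInertia.cls_stratum_marked (sumIndexEquiv hp) hT]

/-! ### Permutations whose cycles have one and the same length -/

/-- If all cycles of a permutation have length `r`, then they may be numbered and each of them be
identified with `Fin r`. -/
lemma exists_cycleEquiv {n r : ℕ} (hr : 0 < r) (σ : Equiv.Perm (Fin n))
    (hσ : ∀ i, Function.minimalPeriod σ i = r) :
    ∃ (m : ℕ) (e : Fin m × Fin r ≃ Fin n), ∀ i, (e.symm (σ i)).1 = (e.symm i).1 := by
  classical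
  let Q := Quotient (Equiv.Perm.SameCycle.setoid σ)
  let cyc : Fin n → Q := Quotient.mk _
  have hcyc : ∀ {x y}, cyc x = cyc y ↔ σ.SameCycle x y := Quotient.eq
  let f : Q × Fin r → Fin n := fun p => σ^[(p.2 : ℕ)] p.1.out
  have hf : ∀ p, cyc (f p) = p.1 := fun p => by
    have : cyc (f p) = cyc p.1.out := by
      rw [hcyc]
      change σ.SameCycle (σ^[(p.2 : ℕ)] p.1.out) _
      rw [← Equiv.Perm.coe_pow, Equiv.Perm.sameCycle_pow_left]
    rw [this]
    exact Quotient.out_eq _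
  have hinj : Function.Injective f := fun p q h => by
    have h1 : p.1 = q.1 := by rw [← hf p, ← hf q, h]
    refine Prod.ext h1 (Fin.ext (Function.iterate_injOn_Iio_minimalPeriod (f := σ)
      (x := p.1.out) (Set.mem_Iio.2 (by rw [hσ]; exact p.2.2))
      (Set.mem_Iio.2 (by rw [hσ]; exact q.2.2)) ?_))
    dsimp only [f] at h
    rw [← h1] at h
    exact h
  have hsurj : Function.Surjective f := fun x => by
    obtain ⟨k, hk⟩ := (hcyc.1 (Quotient.out_eq (cyc x))).exists_nat_pow_eq
    refine ⟨(cyc x, ⟨k % r, Nat.mod_lt _ hr⟩), ?_⟩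
    rw [Equiv.Perm.coe_pow] at hk
    dsimp only [f]
    rw [← hσ (cyc x).out, Function.iterate_mod_minimalPeriod_eq]
    exact hk
  let F := Equiv.ofBijective f ⟨hinj, hsurj⟩
  have hF : ∀ x, (F.symm x).1 = cyc x := fun x => by
    obtain ⟨p, rfl⟩ := F.surjective x
    rw [F.symm_apply_apply]
    exact (hf p).symm
  refine ⟨Fintype.card Q, ((Fintype.equivFin Q).symm.prodCongr (Equiv.refl _)).trans F,
    fun i => congrArg (Fintype.equivFin Q) ?_⟩
  change (F.symm (σ i)).1 = (F.symm i).1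
  rw [hF, hF, hcyc, Equiv.Perm.sameCycle_apply_left]

section

variable {G : Type} [Group G] {m r n : ℕ} (e : Fin m × Fin r ≃ Fin n)

/-- The element of `G_n` which acts on the `k`-th block of indices by `l k`. -/
def blockDiag (l : Fin m → Wreath G r) : Wreath G n := blockWreath e (mkWreath 1 l)

@[simp] lemma right_blockDiag (l : Fin m → Wreath G r) (k : Fin m) (i : Fin r) :
    (blockDiag e l).right (e (k, i)) = e (k, (l k).right i) := by
  simp [blockDiag]

@[simp] lemma fiberElt_blockDiag (l : Fin m → Wreath G r) (k : Fin m) (i : Fin r) :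
    fiberElt (blockDiag e l) (e (k, i)) = fiberElt (l k) i := by
  simp [blockDiag]

lemma blockDiag_injective [NeZero r] : Function.Injective (blockDiag (G := G) e) :=
  (blockWreath_injective e).comp fun l l' h => funext fun k => by
    simpa using congrArg (fun v => fiberElt v k) h

lemma exists_blockDiag_eq [NeZero r] {w : Wreath G n}
    (h : ∀ i, (e.symm (w.right i)).1 = (e.symm i).1) : ∃ l, blockDiag e l = w := by
  obtain ⟨v, rfl⟩ := exists_blockWreath_eq e (w := w) fun k i i' => by rw [h, h]; simp
  refine ⟨fiberElt v, congrArg _ (wreath_ext (fun k => ?_) fun k => by simp)⟩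
  have := h (e (k, 0))
  simpa using this.symm

lemma minimalPeriod_blockDiag (l : Fin m → Wreath G r) (k : Fin m) (i : Fin r) :
    Function.minimalPeriod (blockDiag e l).right (e (k, i)) =
      Function.minimalPeriod (l k).right i :=
  minimalPeriod_eq_of_semiconj (u := fun i => e (k, i))
    (fun _ _ h => (Prod.ext_iff.1 (e.injective h)).2)
    (fun i => (right_blockDiag e l k i).symm) i

lemma blockWreath_mul_blockDiag (v : Wreath (Wreath G r) m) (l l' : Fin m → Wreath G r)
    (h : ∀ k, fiberElt v k * l k = l' (v.right k) * fiberElt v k) :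
    blockWreath e v * blockDiag e l = blockDiag e l' * blockWreath e v := by
  rw [blockDiag, blockDiag, ← map_mul, ← map_mul]
  exact congrArg _ (wreath_ext (fun k => rfl) fun k => by simp [fiberElt_mul, h])

/-- An element conjugating two elements which preserve the blocks, the first of them being
transitive on each block, maps blocks to blocks. -/
lemma exists_blockWreath_eq_of_mul_eq [NeZero r] {w : Wreath G n} {l l' : Fin m → Wreath G r}
    (hl : ∀ k, l k ∈ cycleLengthsIn G {r} r) (h : w * blockDiag e l = blockDiag e l' * w) :
    ∃ v, blockWreath e v = w := by
  have hw : ∀ i, w.right ((blockDiag e l).right i) = (blockDiag e l').right (w.right i) :=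
    fun i => Equiv.congr_fun (congrArg SemidirectProduct.right h) i
  have hl' : ∀ i, (e.symm ((blockDiag e l').right i)).1 = (e.symm i).1 := fun i => by
    obtain ⟨⟨k, i⟩, rfl⟩ := e.surjective i
    simp
  refine exists_blockWreath_eq e fun k i i' => ?_
  obtain ⟨t, rfl⟩ := exists_iterate_eq (hl k) i i'
  generalize (t : ℕ) = t
  induction t with
  | zero => rfl
  | succ t ih => rw [Function.iterate_succ_apply', ← right_blockDiag, hw, hl', ih]

end

namespace GVariety.cycInertia

variable {V : GVariety} {m r n : ℕ} (e : Fin m × Fin r ≃ Fin n)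

/-- The juxtaposition of `m` points over full cycles. -/
noncomputable def block (x : ((V.cycInertia {r} r).pow m).X) : (V.cycInertia {r} n).X :=
  mk (blockDiag e fun k => elt (x k)) (fun i => pt (x (e.symm i).1) (e.symm i).2)
    (fun i => by
      obtain ⟨⟨k, i⟩, rfl⟩ := e.surjective i
      rw [minimalPeriod_blockDiag]
      exact elt_mem (x k) i)
    (fun i => by
      obtain ⟨⟨k, i⟩, rfl⟩ := e.surjective i
      rw [right_blockDiag, fiberElt_blockDiag, e.symm_apply_apply, e.symm_apply_apply]
      exact fiberElt_smul (x k) i)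

@[simp] lemma pt_block (x : ((V.cycInertia {r} r).pow m).X) (k : Fin m) (i : Fin r) :
    pt (block e x) (e (k, i)) = pt (x k) i := by
  change pt (x (e.symm (e (k, i))).1) (e.symm (e (k, i))).2 = _
  rw [e.symm_apply_apply]

lemma isRegular_block : IsRegular (X := (V.cycInertia {r} r).X.pow m)
    (Y := (V.cycInertia {r} n).X) (block e) := by
  refine isRegular_of_elt_pt (V := V) ?_ fun i => ?_
  · exact (isLocallyConstant_pi fun k =>
      (isRegular_proj (V.cycInertia {r} r).X k).isLocallyConstant_comp isLocallyConstant_elt).comp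
        (blockDiag e)
  · exact (isRegular_pt (V := V) (e.symm i).2).comp
      (isRegular_proj (V.cycInertia {r} r).X (e.symm i).1)

lemma blockWreath_smul_block (v : Wreath (Wreath V.G r) m)
    {x x' : ((V.cycInertia {r} r).pow m).X}
    (h : ∀ k, (fiberElt v k • x k : (V.cycInertia {r} r).X) = x' (v.right k)) :
    blockWreath e v • block e x = block e x' := by
  have h' := fun k => (smul_eq_iff _ _ _).1 (h k)
  refine (smul_eq_iff _ _ _).2 ⟨blockWreath_mul_blockDiag e v _ _ fun k => (h' k).1, fun i => ?_⟩
  obtain ⟨⟨k, i⟩, rfl⟩ := e.surjective i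
  rw [right_blockWreath, fiberElt_blockWreath, pt_block, pt_block]
  exact (h' k).2 i

/-- The points over elements that preserve the blocks of indices. -/
def preservingBlocks (V : GVariety) (e : Fin m × Fin r ≃ Fin n) : Set (V.cycInertia {r} n).X :=
  {p | elt p ∈ Set.range (blockDiag e)}

lemma isClosed_preservingBlocks : IsClosed (preservingBlocks V e) :=
  isOpen_compl_iff.1 (isLocallyConstant_elt (V := V) (Set.range (blockDiag e))ᶜ)

lemma blockDiag_invFun_elt {p : (V.cycInertia {r} n).X} (hp : p ∈ preservingBlocks V e) :
    blockDiag e (Function.invFun (blockDiag e) (elt p)) = elt p := Function.invFun_eq hp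

/-- The `k`-th block of `p`. -/
noncomputable def blockPart {p : (V.cycInertia {r} n).X} (hp : p ∈ preservingBlocks V e)
    (k : Fin m) : (V.cycInertia {r} r).X :=
  mk (Function.invFun (blockDiag e) (elt p) k) (fun i => pt p (e (k, i)))
    (fun i => by
      have h := elt_mem p (e (k, i))
      rwa [← blockDiag_invFun_elt e hp, minimalPeriod_blockDiag] at h)
    (fun i => by
      have h := fiberElt_smul p (e (k, i))
      rwa [← blockDiag_invFun_elt e hp, right_blockDiag, fiberElt_blockDiag] at h)

lemma block_blockPart {p : (V.cycInertia {r} n).X} (hp : p ∈ preservingBlocks V e) :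
    block e (blockPart e hp) = p := by
  refine ext (blockDiag_invFun_elt e hp) fun i => ?_
  obtain ⟨⟨k, i⟩, rfl⟩ := e.surjective i
  exact pt_block e (blockPart e hp) k i

lemma blockPart_block [NeZero r] (x : ((V.cycInertia {r} r).pow m).X)
    (hx : block e x ∈ preservingBlocks V e) : blockPart e hx = x :=
  funext fun k => ext (congrFun (Function.leftInverse_invFun (blockDiag_injective e)
    fun k => elt (x k)) k) (pt_block e x k)

/-- The points over permutations with all cycles of length `r` are induced from the Cartesian
power of the variety of points over full cycles. -/
lemma isInductionMap_block [NeZero r] : IsInductionMap (V.cycInertia {r} n)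
    ((V.cycInertia {r} r).pow m) (blockWreath (G := V.G) e) (block e) where
  emb := by
    have hval := isRegular_val (V.cycInertia {r} n).X _
      (isClosed_preservingBlocks (V := V) e).isLocallyClosed
    have hl := hval.isLocallyConstant_comp (isLocallyConstant_elt (V := V))
    refine IsClosedEmb.of_inverse (isRegular_block e) (isClosed_preservingBlocks e)
      (fun x => ⟨_, rfl⟩) (fun y => blockPart e y.2) ?_ (fun x => blockPart_block e x _)
      (fun y => block_blockPart e y.2)
    exact IsRegular.tuple (Y := (V.cycInertia {r} r).X) fun k =>
      isRegular_of_elt_pt (hl.comp fun v => Function.invFun (blockDiag e) v k)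
        fun i => (isRegular_pt (V := V) (e (k, i))).comp hval
  injective := blockWreath_injective e
  map_smul := fun v x => (blockWreath_smul_block e v fun k =>
    (pow_smul_eq_iff (V.cycInertia {r} r) v x _).1 rfl k).symm
  mem_range := fun w x x' h =>
    exists_blockWreath_eq_of_mul_eq e (l := fun k => elt (x k)) (l' := fun k => elt (x' k))
      (fun k => elt_mem (x k)) ((smul_eq_iff (V := V) _ _ _).1 h).1
  cover := fun p => by
    obtain ⟨m', e', he'⟩ := exists_cycleEquiv (NeZero.pos r) (elt p).right (elt_mem p)
    obtain rfl : m' = m := by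
      have h := Fintype.card_congr (e'.trans e.symm)
      simpa [NeZero.ne r] using h
    -- renumbering the indices so that the cycles become the blocks
    let h : Wreath V.G n := mkWreath (e.symm.trans e') 1
    have hp : h⁻¹ • p ∈ preservingBlocks V e := by
      refine exists_blockDiag_eq e fun i => ?_
      have h1 := ((smul_eq_iff h (h⁻¹ • p) p).1 (smul_inv_smul h p)).1
      have h2 := Equiv.congr_fun (congrArg SemidirectProduct.right h1) i
      change e' (e.symm ((elt (h⁻¹ • p)).right i)) = (elt p).right (e' (e.symm i)) at h2
      rw [← Equiv.eq_symm_apply] at h2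
      rw [h2, he', Equiv.symm_apply_apply]
    refine ⟨h, blockPart e hp, ?_⟩
    exact (congrArg (h • ·) (block_blockPart e hp)).trans (smul_inv_smul h p)

end GVariety.cycInertia

/-! ### The product formula -/

lemma minimalPeriod_perm_mem_Icc {n : ℕ} (σ : Equiv.Perm (Fin n)) (i : Fin n) :
    Function.minimalPeriod σ i ∈ Set.Icc 1 n := by
  refine ⟨Function.minimalPeriod_pos_of_mem_periodicPts (σ.injective.mem_periodicPts i), ?_⟩
  simpa using Function.minimalPeriod_le_card (f := σ) (x := i)

/-- The coefficient of `t^n` only involves cycles of length at most `n`. -/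
lemma coeff_cycleZeta_congr (V : GVariety) {T T' : Set ℕ} {n : ℕ}
    (h : ∀ r ∈ Set.Icc 1 n, r ∈ T ↔ r ∈ T') :
    PowerSeries.coeff n (cycleZeta V T) = PowerSeries.coeff n (cycleZeta V T') := by
  rw [coeff_cycleZeta, coeff_cycleZeta]
  refine cls_sub_congr _ ?_ _ _ _ _
  have : cycleLengthsIn V.G T n = cycleLengthsIn V.G T' n :=
    Set.ext fun w => forall_congr' fun i => h _ (minimalPeriod_perm_mem_Icc w.right i)
  rw [this]

lemma cycleZeta_univ (V : GVariety) :
    cycleZeta V Set.univ = PowerSeries.map inertiaHom (kapranovZeta V) := by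
  ext n
  rw [PowerSeries.coeff_map, coeff_kapranovZeta, inertiaHom_cls, coeff_cycleZeta,
    ← cls_sub_univ (V.pow n).inertia]
  exact cls_sub_congr _ (Set.eq_univ_of_forall fun _ _ => trivial) _ _ _ _

lemma cycleZeta_empty (V : GVariety) : cycleZeta V ∅ = 1 := by
  ext n
  rcases n.eq_zero_or_pos with rfl | hn
  -- Without indices there is no condition on the cycles.
  · rw [coeff_cycleZeta_congr V (T' := Set.univ)
      (fun r hr => absurd (hr.1.trans hr.2) (by simp)), cycleZeta_univ, PowerSeries.coeff_map,
      coeff_kapranovZeta, cls_pow_zero, map_one, PowerSeries.coeff_zero_one]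
  · have : IsEmpty (V.cycInertia ∅ n).X := ⟨fun p => cycInertia.elt_mem p ⟨0, hn⟩⟩
    rw [coeff_cycleZeta, cls_eq_zero_of_isEmpty, PowerSeries.coeff_one, if_neg hn.ne']

/-- Permutations all of whose cycles have length `r` contribute the Kapranov zeta function of the
variety of points over full cycles. -/
lemma cycleZeta_singleton (V : GVariety) (r : ℕ) [NeZero r] :
    cycleZeta V {r} =
      PowerSeries.expand r (NeZero.ne r) (kapranovZeta (V.cycInertia {r} r)) := by
  ext n
  by_cases h : r ∣ n
  · obtain ⟨m, rfl⟩ := h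
    rw [PowerSeries.coeff_expand_mul, coeff_kapranovZeta, coeff_cycleZeta]
    exact (cycInertia.isInductionMap_block (V := V)
      (finProdFinEquiv.trans (finCongr (mul_comm m r)))).cls_eq
  · have : IsEmpty (V.cycInertia {r} n).X := ⟨fun p => by
      obtain ⟨m, e, -⟩ := exists_cycleEquiv (NeZero.pos r) _ (cycInertia.elt_mem p)
      refine h ⟨m, ?_⟩
      simpa [mul_comm] using (Fintype.card_congr e).symm⟩
    rw [PowerSeries.coeff_expand_of_not_dvd r (NeZero.ne r) _ h, coeff_cycleZeta,
      cls_eq_zero_of_isEmpty]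

lemma prod_cycleZeta_singleton (V : GVariety) (s : Finset ℕ+) :
    ∏ r ∈ s, cycleZeta V {(r : ℕ)} = cycleZeta V ((fun r : ℕ+ => (r : ℕ)) '' s) := by
  classical
  induction s using Finset.induction_on with
  | empty => simp [cycleZeta_empty]
  | insert r s hr ih =>
    rw [Finset.prod_insert hr, ih, Finset.coe_insert, Set.image_insert_eq, Set.insert_eq,
      cycleZeta_union]
    rw [Set.disjoint_singleton_left]
    rintro ⟨r', hr', h⟩
    exact hr (PNat.coe_injective h ▸ hr')

/-- Each length of cycles contributes one factor, and the coefficient of `t^n` no longer changes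
once the factors for the lengths `1, …, n` are present. -/
lemma hasProd_cycleZeta (V : GVariety) :
    HasProd (fun r : ℕ+ => cycleZeta V {(r : ℕ)}) (cycleZeta V Set.univ) := by
  refine (PowerSeries.WithPiTopology.tendsto_iff_coeff_tendsto K0 _ _ _).2 fun n => ?_
  refine tendsto_atTop_of_eventually_const (i₀ := Finset.univ.image fun i : Fin n => i.1.succPNat)
    fun s hs => ?_
  rw [prod_cycleZeta_singleton]
  refine coeff_cycleZeta_congr V fun r hr => iff_of_true ?_ trivial
  obtain ⟨k, rfl⟩ := Nat.exists_eq_add_of_le' hr.1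
  exact ⟨k.succPNat, hs (Finset.mem_image.2 ⟨⟨k, hr.2⟩, Finset.mem_univ _, rfl⟩), rfl⟩

end FGr

theorem mainTheorem1 :
    (∃! α : FGr.K0 →+* FGr.K0, FGr.IsInertiaHom α) ∧
    (∀ r : ℕ+, ∃! β : FGr.K0 →+ FGr.K0, FGr.IsRootInertiaHom r β) ∧
    (∃! ζ : FGr.K0 → PowerSeries FGr.K0, FGr.IsKapranovZeta ζ) ∧
    ∀ (α : FGr.K0 →+* FGr.K0) (αr : ℕ+ → (FGr.K0 →+ FGr.K0))
      (ζ : FGr.K0 → PowerSeries FGr.K0),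
      FGr.IsInertiaHom α → (∀ r, FGr.IsRootInertiaHom r (αr r)) → FGr.IsKapranovZeta ζ →
      ∀ V : FGr.GVariety,
        HasProd (fun r : ℕ+ => PowerSeries.expand (r : ℕ) r.ne_zero (ζ (αr r (FGr.cls V))))
          (PowerSeries.map α (FGr.kapranovZeta V)) := by
  refine ⟨⟨_, FGr.isInertiaHom_iff.2 rfl, fun α => FGr.isInertiaHom_iff.1⟩,
    fun r => ⟨_, FGr.isRootInertiaHom_iff.2 rfl, fun β => FGr.isRootInertiaHom_iff.1⟩,
    FGr.existsUnique_isKapranovZeta, fun α αr ζ hα hαr hζ V => ?_⟩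
  obtain rfl := FGr.isInertiaHom_iff.1 hα
  obtain rfl : αr = fun r : ℕ+ => FGr.rootInertiaHom (r : ℕ) :=
    funext fun r => FGr.isRootInertiaHom_iff.1 (hαr r)
  rw [← FGr.cycleZeta_univ]
  convert FGr.hasProd_cycleZeta V using 2 with r
  rw [FGr.rootInertiaHom_cls, hζ.map_cls, FGr.cycleZeta_singleton]
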